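/- **Setting.** Fix $\beta_0\in\mathbb R$ and constants $K_1,K_2\in\mathbb R$, $\underline C,\sigma_0>0$. For every sample size $n$ let $p=p_n\ge 2$ (arbitrary, possibly much larger than $n$) and let $(\mathbf Z_i,\eta_i,\varepsilon_i,U_i)$, $1\le i\le n$, be i.i.d. (with a law that may depend on $n$), $\mathbf Z_i$ with values in $\mathbb R^p$ and the others real. Put $$X_i=f(\mathbf Z_i)+\eta_i,\qquad W_i=X_i+U_i,\qquad Y_i=X_i\beta_0+g(\mathbf Z_i)+\varepsilon_i$$ with measurable $f,g$ (which may depend on $n$). Here $U_i$ is independent of $(X_i,\mathbf Z_i,\varepsilon_i)$ with $\mathbb E U_i=0$ and known variance $\sigma_U^2$; $\varepsilon_i$ is independent of $(X_i,\mathbf Z_i)$ with $\mathbb E\varepsilon_i=0$; and $\mathbb E(\eta_i\mid\mathbf Z_i)=0$. Only $(Y_i,W_i,\mathbf Z_i)$ is observed. Let $\boldsymbol\theta_0$ minimise $\mathbb E(X_1-\mathbf Z_1^\top\boldsymbol\theta)^2$ and $\boldsymbol\gamma_0$ minimise $\mathbb E(Y_1-X_1\beta_0-\mathbf Z_1^\top\boldsymbol\gamma)^2$.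 Write $\|S\|_{\psi_2}=\sup_{q\ge1}q^{-1/2}(\mathbb E|S|^q)^{1/q}$ and $\boldsymbol\Sigma=\mathbb E[(X_1,\mathbf Z_1^\top)^\top(X_1,\mathbf Z_1^\top)]$. **Conditions.** One of the two linear models is correct: * (a) for all $n$: $g(z)=z^\top\boldsymbol\gamma_0$, $|f(\mathbf Z_1)|\le K_2$ almost surely, and $\mathbb E[(\varepsilon_1-U_1\beta_0)(f(\mathbf Z_1)-\mathbf Z_1^\top\boldsymbol\theta_0+\eta_1+U_1)+\sigma_U^2\beta_0]^2\ge\sigma_0^2$; or * (b) for all $n$: $f(z)=z^\top\boldsymbol\theta_0$, $|g(\mathbf Z_1)|\le K_2$ almost surely, and $\mathbb E[(\eta_1+U_1)(\varepsilon_1-U_1\beta_0+g(\mathbf Z_1)-\mathbf Z_1^\top\boldsymbol\gamma_0)+\sigma_U^2\beta_0]^2\ge\sigma_0^2$. The $\psi_2$-norms of $\varepsilon_1,U_1,\eta_1,X_1,Z_{1,j}$ $(1\le j\le p)$, $\mathbf Z_1^\top\boldsymbol\theta_0$, $\mathbf Z_1^\top\boldsymbol\gamma_0$ are at most $K_1$;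 all eigenvalues of $\boldsymbol\Sigma$ are at least $\underline C$; and $\|\boldsymbol\gamma_0\|_0=o(\sqrt n/\log p)$, $\|\boldsymbol\theta_0\|_0=o(\sqrt n/\log p)$. **Penalties.** Let $p_\lambda$ stand for either of two families of scalar penalties ($\lambda>0$), one used for $\boldsymbol\gamma$ and one for $\boldsymbol\theta$, such that, with constants $L,\mu>0$ not depending on $\lambda$ (they may differ for the two families): $p_\lambda(0)=0$ and $p_\lambda$ is even; $p_\lambda$ is nondecreasing on $[0,\infty)$; $p_\lambda(t)/t$ is nonincreasing for $t>0$; $p_\lambda$ is differentiable at every $t\ne0$ and subdifferentiable at $0$, with $\lim_{t\to0^+}p_\lambda'(t)=\lambda L$; and $t\mapsto p_\lambda(t)+\frac\mu2t^2$ is convex. Unless both are Lasso penalties $p_\lambda(t)=\lambda L|t|$, assume that the covariates are sub-Gaussian as random vectors, $\|\mathbf Z_1^\top v\|_{\psi_2}\le K_1$ for all $v\in\mathbb R^p$ with $\|v\|_2=1$. **Statistic.** For $\beta_t\in\mathbb R$ let $\hat{\boldsymbol\gamma}(\beta_t)$ and $\hat{\boldsymbol\theta}$ be (measurable) global minimisers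 over $\mathbb R^p$ of $$\frac1{2n}\sum_{i=1}^n(Y_i-W_i\beta_t-\mathbf Z_i^\top\boldsymbol\gamma)^2+\sum_{j=1}^pp_{\lambda_\gamma}(\gamma_j)\quad\text{and}\quad\frac1{2n}\sum_{i=1}^n(W_i-\mathbf Z_i^\top\boldsymbol\theta)^2+\sum_{j=1}^pp_{\lambda_\theta}(\theta_j),$$ where $\lambda_\gamma=D_1\sqrt{\log p/n}$ and $\lambda_\theta=D_2\sqrt{\log p/n}$. Put $S_i(\beta_t)=(W_i-\mathbf Z_i^\top\hat{\boldsymbol\theta})(Y_i-W_i\beta_t-\mathbf Z_i^\top\hat{\boldsymbol\gamma}(\beta_t))+\sigma_U^2\beta_t$ and $$T_{DF}(\beta_t)=\frac{n^{-1/2}\sum_{i=1}^nS_i(\beta_t)}{\big(n^{-1}\sum_{i=1}^nS_i(\beta_t)^2\big)^{1/2}},\qquad C_\alpha=\{\beta_t\in\mathbb R:|T_{DF}(\beta_t)|\le\Phi^{-1}(1-\alpha/2)\},$$ where $\Phi$ is the standard normal distribution function. **Claim.** There is a constant $D_0$, depending only on $\beta_0,K_1,K_2,\underline C,\sigma_0$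 and the penalties (with their $L,\mu$), such that for all $D_1,D_2\ge D_0$, every sequence of models as above and every $\alpha\in(0,1)$, $$P(\beta_0\in C_\alpha)=P\big(|T_{DF}(\beta_0)|\le\Phi^{-1}(1-\alpha/2)\big)\longrightarrow1-\alpha\qquad(n\to\infty).$$ -/

import Mathlib

open MeasureTheory ProbabilityTheory Filter Topology Asymptotics
open scoped ENNReal

universe u

/-- The sub-Gaussian norm `sup_{q ≥ 1} q^{-1/2} (E |X|^q)^{1/q}` (with value `∞` allowed). -/
noncomputable def psi2Norm {Ω : Type*} [MeasurableSpace Ω] (P : Measure Ω) (X : Ω → ℝ) : ℝ≥0∞ :=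
  ⨆ (q : ℝ) (_ : 1 ≤ q), ENNReal.ofReal (q ^ (-(1 / 2) : ℝ)) * eLpNorm X (ENNReal.ofReal q) P

/-- The primitive random objects of the measurement error model with `n` observations and
`p` covariates: regression functions `f` (for `X`) and `g` (for `Y`), covariates `Z i`, errors
`ε i` (of the `Y`-model), `η i` (of the `X`-model), measurement errors `U i` and the known
standard deviation `sigmaU` of the measurement error. -/
structure MEModel (n p : ℕ) (Ω : Type*) where
  f : (Fin p → ℝ) → ℝ
  g : (Fin p → ℝ) → ℝ
  Z : Fin n → Ω → Fin p → ℝ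
  ε : Fin n → Ω → ℝ
  η : Fin n → Ω → ℝ
  U : Fin n → Ω → ℝ
  sigmaU : ℝ

namespace MEModel

variable {n p : ℕ} {Ω : Type*}

/-- The unobserved covariate `X_i = f(Z_i) + η_i`. -/
def X (M : MEModel n p Ω) (i : Fin n) (ω : Ω) : ℝ := M.f (M.Z i ω) + M.η i ω

/-- The observed surrogate `W_i = X_i + U_i`. -/
def W (M : MEModel n p Ω) (i : Fin n) (ω : Ω) : ℝ := M.X i ω + M.U i ω

/-- The response `Y_i = X_i β₀ + g(Z_i) + ε_i`. -/
def Y (M : MEModel n p Ω) (β0 : ℝ) (i : Fin n) (ω : Ω) : ℝ :=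
  M.X i ω * β0 + M.g (M.Z i ω) + M.ε i ω

/-- The standing assumptions of the model. Independence of `η` from `(U, ε)` follows from
`indep_U` and `indep_ε`, because `η i = X i - f (Z i)`. -/
structure Standing [MeasurableSpace Ω] (M : MEModel n p Ω) (P : Measure Ω) : Prop where
  measurable_f : Measurable M.f
  measurable_g : Measurable M.g
  measurable_Z : ∀ i, Measurable (M.Z i)
  measurable_ε : ∀ i, Measurable (M.ε i)
  measurable_η : ∀ i, Measurable (M.η i)
  measurable_U : ∀ i, Measurable (M.U i)
  indep : iIndepFun (fun i ω => (M.Z i ω, M.η i ω, M.ε i ω, M.U i ω)) P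
  identDistrib : ∀ i j, IdentDistrib (fun ω => (M.Z i ω, M.η i ω, M.ε i ω, M.U i ω))
    (fun ω => (M.Z j ω, M.η j ω, M.ε j ω, M.U j ω)) P P
  indep_U : ∀ i, IndepFun (M.U i) (fun ω => (M.X i ω, M.Z i ω, M.ε i ω)) P
  indep_ε : ∀ i, IndepFun (M.ε i) (fun ω => (M.X i ω, M.Z i ω)) P
  mean_U : ∀ i, ∫ ω, M.U i ω ∂P = 0
  var_U : ∀ i, variance (M.U i) P = M.sigmaU ^ 2
  mean_ε : ∀ i, ∫ ω, M.ε i ω ∂P = 0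
  condMean_η : ∀ i, P[M.η i | MeasurableSpace.comap (M.Z i) inferInstance] =ᵐ[P] 0

/-- `θ0` minimises `E (X_i - Z_iᵀ θ)²`. -/
def IsThetaZero [MeasurableSpace Ω] (M : MEModel n p Ω) (P : Measure Ω) (θ0 : Fin p → ℝ) : Prop :=
  ∀ i, IsMinOn (fun θ : Fin p → ℝ => ∫ ω, (M.X i ω - M.Z i ω ⬝ᵥ θ) ^ 2 ∂P) Set.univ θ0

/-- `γ0` minimises `E (Y_i - X_i β₀ - Z_iᵀ γ)²`. -/
def IsGammaZero [MeasurableSpace Ω] (M : MEModel n p Ω) (P : Measure Ω) (β0 : ℝ)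
    (γ0 : Fin p → ℝ) : Prop :=
  ∀ i, IsMinOn (fun γ : Fin p → ℝ => ∫ ω, (M.Y β0 i ω - M.X i ω * β0 - M.Z i ω ⬝ᵥ γ) ^ 2 ∂P)
    Set.univ γ0

/-- Uniform bound on the sub-Gaussian norms of the scalar variables of the model. -/
structure SubGaussianBound [MeasurableSpace Ω] (M : MEModel n p Ω) (P : Measure Ω)
    (θ0 γ0 : Fin p → ℝ) (K : ℝ) : Prop where
  ε : ∀ i, psi2Norm P (M.ε i) ≤ ENNReal.ofReal K
  U : ∀ i, psi2Norm P (M.U i) ≤ ENNReal.ofReal K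
  η : ∀ i, psi2Norm P (M.η i) ≤ ENNReal.ofReal K
  Z : ∀ i j, psi2Norm P (fun ω => M.Z i ω j) ≤ ENNReal.ofReal K
  X : ∀ i, psi2Norm P (M.X i) ≤ ENNReal.ofReal K
  Zθ0 : ∀ i, psi2Norm P (fun ω => M.Z i ω ⬝ᵥ θ0) ≤ ENNReal.ofReal K
  Zγ0 : ∀ i, psi2Norm P (fun ω => M.Z i ω ⬝ᵥ γ0) ≤ ENNReal.ofReal K

/-- The covariate vectors are sub-Gaussian random vectors with norm at most `K`: every
projection on a Euclidean unit vector has sub-Gaussian norm at most `K`. -/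
def SubGaussianVector [MeasurableSpace Ω] (M : MEModel n p Ω) (P : Measure Ω) (K : ℝ) : Prop :=
  ∀ i, ∀ v : Fin p → ℝ, v ⬝ᵥ v = 1 → psi2Norm P (fun ω => M.Z i ω ⬝ᵥ v) ≤ ENNReal.ofReal K

/-- The second moment matrix `Σ = E[(X_i, Z_iᵀ)ᵀ (X_i, Z_iᵀ)]`. -/
noncomputable def secondMoment [MeasurableSpace Ω] (M : MEModel n p Ω) (P : Measure Ω)
    (i : Fin n) : Matrix (Fin (p + 1)) (Fin (p + 1)) ℝ :=
  Matrix.of fun a b => ∫ ω,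
    Matrix.vecCons (M.X i ω) (M.Z i ω) a * Matrix.vecCons (M.X i ω) (M.Z i ω) b ∂P

/-- `σ₁² = E[(ε - Uβ)(f(Z) - Zᵀθ0 + η + U) + σ_U² β]²`. -/
noncomputable def sigma1Sq [MeasurableSpace Ω] (M : MEModel n p Ω) (P : Measure Ω) (β : ℝ)
    (θ0 : Fin p → ℝ) (i : Fin n) : ℝ :=
  ∫ ω, ((M.ε i ω - M.U i ω * β) * (M.f (M.Z i ω) - M.Z i ω ⬝ᵥ θ0 + M.η i ω + M.U i ω)
    + M.sigmaU ^ 2 * β) ^ 2 ∂P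

/-- `σ₂² = E[(η + U)(ε - Uβ + g(Z) - Zᵀγ0) + σ_U² β]²`. -/
noncomputable def sigma2Sq [MeasurableSpace Ω] (M : MEModel n p Ω) (P : Measure Ω) (β : ℝ)
    (γ0 : Fin p → ℝ) (i : Fin n) : ℝ :=
  ∫ ω, ((M.η i ω + M.U i ω) * (M.ε i ω - M.U i ω * β + M.g (M.Z i ω) - M.Z i ω ⬝ᵥ γ0)
    + M.sigmaU ^ 2 * β) ^ 2 ∂P

/-- Model (a): the `Y`-model is linear with coefficient `γ0`, `f` is arbitrary but bounded by
`K` on the covariates, and `σ₁ ≥ σ0`. -/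
structure ModelA [MeasurableSpace Ω] (M : MEModel n p Ω) (P : Measure Ω) (β0 : ℝ)
    (θ0 γ0 : Fin p → ℝ) (K σ0 : ℝ) : Prop where
  linear : ∀ z, M.g z = z ⬝ᵥ γ0
  bounded : ∀ i, ∀ᵐ ω ∂P, |M.f (M.Z i ω)| ≤ K
  variance_lower : ∀ i, σ0 ^ 2 ≤ M.sigma1Sq P β0 θ0 i

/-- Model (b): the `X`-model is linear with coefficient `θ0`, `g` is arbitrary but bounded by
`K` on the covariates, and `σ₂ ≥ σ0`. -/
structure ModelB [MeasurableSpace Ω] (M : MEModel n p Ω) (P : Measure Ω) (β0 : ℝ)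
    (θ0 γ0 : Fin p → ℝ) (K σ0 : ℝ) : Prop where
  linear : ∀ z, M.f z = z ⬝ᵥ θ0
  bounded : ∀ i, ∀ᵐ ω ∂P, |M.g (M.Z i ω)| ≤ K
  variance_lower : ∀ i, σ0 ^ 2 ≤ M.sigma2Sq P β0 γ0 i

end MEModel

/-- The conditions on a family of scalar penalties `ρ lam`, `lam > 0`, with constants `L` and
`μ` that do not depend on `lam`. Subdifferentiability at `0` is automatic, since `0` is a
minimiser of `ρ lam` by `zero`, `symm` and `mono`. -/
structure IsAmenablePenalty (ρ : ℝ → ℝ → ℝ) (L μ : ℝ) : Prop where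
  L_pos : 0 < L
  μ_pos : 0 < μ
  zero : ∀ lam, 0 < lam → ρ lam 0 = 0
  symm : ∀ lam, 0 < lam → ∀ t, ρ lam (-t) = ρ lam t
  mono : ∀ lam, 0 < lam → MonotoneOn (ρ lam) (Set.Ici 0)
  ratio : ∀ lam, 0 < lam → AntitoneOn (fun t => ρ lam t / t) (Set.Ioi 0)
  diff : ∀ lam, 0 < lam → ∀ t, t ≠ 0 → DifferentiableAt ℝ (ρ lam) t
  deriv_zero : ∀ lam, 0 < lam → Tendsto (deriv (ρ lam)) (𝓝[>] 0) (𝓝 (lam * L))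
  weakConvex : ∀ lam, 0 < lam → ConvexOn ℝ Set.univ (fun t => ρ lam t + μ / 2 * t ^ 2)

/-- `ρ` is the Lasso penalty `ρ lam t = lam * L * |t|`. -/
def IsLassoPenalty (ρ : ℝ → ℝ → ℝ) (L : ℝ) : Prop :=
  ∀ lam, 0 < lam → ∀ t, ρ lam t = lam * L * |t|

/-- The penalised least squares objective
`(1 / 2n) ∑ᵢ (rᵢ - zᵢᵀ v)² + ∑ⱼ ρ lam (vⱼ)`. -/
noncomputable def penalizedLoss {n p : ℕ} (ρ : ℝ → ℝ → ℝ) (lam : ℝ) (r : Fin n → ℝ)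
    (z : Fin n → Fin p → ℝ) (v : Fin p → ℝ) : ℝ :=
  1 / (2 * (n : ℝ)) * ∑ i, (r i - z i ⬝ᵥ v) ^ 2 + ∑ j, ρ lam (v j)

/-- The `i`-th summand `(wᵢ - zᵢᵀ θ)(yᵢ - wᵢ β - zᵢᵀ γ) + s² β` of the score, where `s` is the
standard deviation of the measurement error. -/
def scoreTerm {n p : ℕ} (s : ℝ) (w y : Fin n → ℝ) (z : Fin n → Fin p → ℝ)
    (θ γ : Fin p → ℝ) (β : ℝ) (i : Fin n) : ℝ :=
  (w i - z i ⬝ᵥ θ) * (y i - w i * β - z i ⬝ᵥ γ) + s ^ 2 * β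

/-- The test statistic `T_DF = T / σ̂`, with `T = n^{-1/2} ∑ᵢ scoreᵢ` and
`σ̂² = n⁻¹ ∑ᵢ scoreᵢ²`. -/
noncomputable def TDF {n p : ℕ} (s : ℝ) (w y : Fin n → ℝ) (z : Fin n → Fin p → ℝ)
    (θ γ : Fin p → ℝ) (β : ℝ) : ℝ :=
  (1 / √(n : ℝ) * ∑ i, scoreTerm s w y z θ γ β i) /
    √(1 / (n : ℝ) * ∑ i, scoreTerm s w y z θ γ β i ^ 2)

/-- The quantile function `Φ⁻¹` of the standard normal distribution. -/
noncomputable def stdNormalQuantile (q : ℝ) : ℝ :=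
  sInf {x : ℝ | q ≤ cdf (gaussianReal 0 1) x}

/-- The confidence set obtained by inverting a family of tests with statistics `T β`,
at level `α`. -/
def confidenceSet (T : ℝ → ℝ) (α : ℝ) : Set ℝ :=
  {βt : ℝ | |T βt| ≤ stdNormalQuantile (1 - α / 2)}

/-- The number of nonzero coordinates of a vector. -/
noncomputable def l0Norm {p : ℕ} (v : Fin p → ℝ) : ℕ := (Function.support v).ncard

/-- The tuning parameter `D √(log p / n)`. -/
noncomputable def tuning (D : ℝ) (n p : ℕ) : ℝ := D * √(Real.log p / n)

/-! Write `q`, `r` for the residuals W - Zᵀθ0 and Y - Wβ0 - Zᵀγ0; the score at the true parameters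
is ξ = qr + σ_U²β0. Both residuals are uncorrelated with Z whether or not the linear models hold: θ0
and γ0 solve population least squares problems, so the normal equations hold, and U is centred and
independent of Z. The correction σ_U²β0 cancels -β0 E U², so the mean of ξ is E(X - Zᵀθ0)(g(Z) -
Zᵀγ0). In model (a) the second factor is zero; in model (b) the first is η, which is conditionally
centred given Z. This is the double robustness (`integral_score_eq_zero`).

Let u, v be the estimation errors for θ0, γ0 and a = √(log p / n). The estimated score differs from
ξ by -r Zᵀu - q Zᵀv + (Zᵀu)(Zᵀv). By Hölder the averaged linear terms are at most a sup norm of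
correlations, of order a, times an ℓ¹ error, of order s a. The product term is bounded by prediction
errors, of order s a². Multiplied by √n everything is of order s log p / √n, which tends to zero
(`score_perturbation_bound`). A triangular central limit theorem and a sandwich of the studentised
ratio finish the proof (`studentized_clt`).

The error rates need three arguments. For the Lasso (`lasso_rate`) the cone condition allows an
entrywise bound on the Gram matrix. For other amenable penalties (`amenable_rate`) there is no cone.
Instead, a global minimiser has loss at most that of the truth, so the total penalty R of the error
is bounded a priori. Coordinates above `lam * L / μ` cost a fixed amount each and smaller ones at
least half the Lasso penalty, so for large D L the curvature defect a²‖v‖₁² is absorbed by ‖v‖₂² and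
R. A defect of order a² follows from sub-Gaussian lower tails on sums of signed basis vectors and
Maurey's empirical method (`maurey_transfer`).

Finally, p need not tend to infinity, and the union bounds fail with probability of order 1/p. Rows
with p below a threshold are treated by Chebyshev, with all coordinates active (`lowdim_rate`).
There the constant depends on the tolerated probability, but D does not. `eventually_errorBound`
joins the cases. -/

namespace IsAmenablePenalty

/-! ### Comparison of amenable penalties with the Lasso. -/

variable {ρ : ℝ → ℝ → ℝ} {L μ lam : ℝ}

lemma abs_eq (h : IsAmenablePenalty ρ L μ) (hl : 0 < lam) (t : ℝ) : ρ lam |t| = ρ lam t := by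
  rcases abs_choice t with h1 | h1 <;> rw [h1]
  exact h.symm lam hl t

lemma nonneg (h : IsAmenablePenalty ρ L μ) (hl : 0 < lam) (t : ℝ) : 0 ≤ ρ lam t := by
  rw [← h.abs_eq hl, ← h.zero lam hl]
  exact h.mono lam hl (by simp) (by simp) (abs_nonneg t)

lemma abs_mono (h : IsAmenablePenalty ρ L μ) (hl : 0 < lam) {s t : ℝ} (hst : |s| ≤ |t|) :
    ρ lam s ≤ ρ lam t := by
  rw [← h.abs_eq hl s, ← h.abs_eq hl t]
  exact h.mono lam hl (by simp) (by simp) hst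

/-- Weak convexity gives continuity, also at 0, so the mean value theorem on [0, x] turns the limit
of the derivative into the limit of the quotient. -/
lemma tendsto_ratio (h : IsAmenablePenalty ρ L μ) (hl : 0 < lam) :
    Tendsto (fun t => ρ lam t / t) (𝓝[>] 0) (𝓝 (lam * L)) := by
  have hcont : Continuous (ρ lam) := by
    have h1 : ContinuousOn (fun t => ρ lam t + μ / 2 * t ^ 2) Set.univ :=
      (h.weakConvex lam hl).continuousOn isOpen_univ
    have h2 : Continuous (fun t => ρ lam t + μ / 2 * t ^ 2) := by
      rwa [← continuousOn_univ]
    have h3 : ρ lam = fun t => (ρ lam t + μ / 2 * t ^ 2) - μ / 2 * t ^ 2 := by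
      ext t; ring
    rw [h3]
    fun_prop
  rw [Metric.tendsto_nhdsWithin_nhds]
  intro e he
  obtain ⟨d, hd, hd'⟩ := Metric.tendsto_nhdsWithin_nhds.1 (h.deriv_zero lam hl) e he
  refine ⟨d, hd, fun {x} hx hxd => ?_⟩
  have hx0 : (0 : ℝ) < x := hx
  obtain ⟨c, hc, hc'⟩ := exists_deriv_eq_slope (ρ lam) hx0 hcont.continuousOn
    (fun y hy => (h.diff lam hl y hy.1.ne').differentiableWithinAt)
  have h4 : deriv (ρ lam) c = ρ lam x / x := by rw [hc', h.zero lam hl]; simp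
  rw [← h4]
  refine hd' hc.1 (lt_of_le_of_lt ?_ hxd)
  simp only [dist_zero_right, Real.norm_eq_abs]
  rw [abs_of_pos hc.1, abs_of_pos hx0]
  exact hc.2.le

/-- A penalty is dominated by the Lasso penalty with the same slope at zero. -/
lemma le_lasso (h : IsAmenablePenalty ρ L μ) (hl : 0 < lam) (t : ℝ) :
    ρ lam t ≤ lam * L * |t| := by
  rw [← h.abs_eq hl]
  rcases (abs_nonneg t).eq_or_lt with h0 | h0
  · rw [← h0, h.zero lam hl]; simp
  · have : ρ lam |t| / |t| ≤ lam * L := by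
      refine ge_of_tendsto (h.tendsto_ratio hl) ?_
      filter_upwards [Ioo_mem_nhdsGT h0] with s hs
      exact h.ratio lam hl hs.1 h0 hs.2.le
    rwa [div_le_iff₀ h0] at this

/-- The convex function `ρ lam t + μ / 2 * t ^ 2` vanishes at 0, so its chord slopes from 0
increase, starting from the limit `lam * L`. -/
lemma lasso_sub_le (h : IsAmenablePenalty ρ L μ) (hl : 0 < lam) (t : ℝ) :
    lam * L * |t| - μ / 2 * t ^ 2 ≤ ρ lam t := by
  rw [← h.abs_eq hl, ← sq_abs t]
  rcases (abs_nonneg t).eq_or_lt with h0 | h0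
  · rw [← h0, h.zero lam hl]; simp
  · set x := |t|
    have hlim : Tendsto (fun s => ρ lam s / s + μ / 2 * s) (𝓝[>] 0) (𝓝 (lam * L + μ / 2 * 0)) :=
      (h.tendsto_ratio hl).add
        ((tendsto_id.mono_left nhdsWithin_le_nhds).const_mul (μ / 2))
    have : lam * L + μ / 2 * 0 ≤ ρ lam x / x + μ / 2 * x := by
      refine le_of_tendsto hlim ?_
      filter_upwards [Ioo_mem_nhdsGT h0] with s hs
      have hs0 : 0 < s := hs.1
      have h1 := (h.weakConvex lam hl).2 (Set.mem_univ (0 : ℝ)) (Set.mem_univ x)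
        (sub_nonneg.2 ((div_le_one h0).2 hs.2.le)) (by positivity : 0 ≤ s / x) (by ring)
      simp only [smul_eq_mul, mul_zero, zero_add, h.zero lam hl] at h1
      rw [div_mul_cancel₀ _ h0.ne'] at h1
      have h2 : ρ lam s / s + μ / 2 * s = (ρ lam s + μ / 2 * s ^ 2) / s := by field_simp
      rw [h2, div_le_iff₀ hs0]
      refine h1.trans (le_of_eq ?_)
      field_simp
      ring
    have h3 : lam * L ≤ (ρ lam x + μ / 2 * x ^ 2) / x := by
      have h2 : ρ lam x / x + μ / 2 * x = (ρ lam x + μ / 2 * x ^ 2) / x := by field_simp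
      linarith
    rw [le_div_iff₀ h0] at h3
    linarith

/-- Amenable penalties are subadditive. -/
lemma subadd (h : IsAmenablePenalty ρ L μ) (hl : 0 < lam) (s t : ℝ) :
    ρ lam (s + t) ≤ ρ lam s + ρ lam t := by
  have key : ∀ x y : ℝ, 0 ≤ x → 0 ≤ y → ρ lam (x + y) ≤ ρ lam x + ρ lam y := by
    intro x y hx hy
    rcases hx.eq_or_lt with rfl | hx
    · simp [h.zero lam hl]
    rcases hy.eq_or_lt with rfl | hy
    · simp [h.zero lam hl]
    have h1 := h.ratio lam hl (show x ∈ Set.Ioi 0 from hx) (show x + y ∈ Set.Ioi 0 from by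
      simp only [Set.mem_Ioi]; linarith) (by linarith)
    have h2 := h.ratio lam hl (show y ∈ Set.Ioi 0 from hy) (show x + y ∈ Set.Ioi 0 from by
      simp only [Set.mem_Ioi]; linarith) (by linarith)
    simp only at h1 h2
    rw [le_div_iff₀ hx] at h1
    rw [le_div_iff₀ hy] at h2
    have h3 : ρ lam (x + y) / (x + y) * x + ρ lam (x + y) / (x + y) * y = ρ lam (x + y) := by
      field_simp
    linarith
  calc ρ lam (s + t) ≤ ρ lam (|s| + |t|) := h.abs_mono hl (by
        rw [abs_of_nonneg (by positivity : 0 ≤ |s| + |t|)]; exact abs_add_le s t)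
    _ ≤ ρ lam |s| + ρ lam |t| := key _ _ (abs_nonneg _) (abs_nonneg _)
    _ = _ := by rw [h.abs_eq hl, h.abs_eq hl]

/-- In this range the quadratic term in `lasso_sub_le` takes away at most half of the Lasso value.
-/
lemma half_lasso_le (h : IsAmenablePenalty ρ L μ) (hl : 0 < lam) {t : ℝ}
    (ht : |t| ≤ lam * L / μ) : lam * L / 2 * |t| ≤ ρ lam t := by
  have h1 := h.lasso_sub_le hl t
  rw [le_div_iff₀ h.μ_pos] at ht
  rw [← sq_abs] at h1
  nlinarith [abs_nonneg t]

/-- The constant is the maximum of the lower bound `lasso_sub_le`, attained at `lam * L / μ`;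
monotonicity carries it to larger arguments. A bound on the total penalty therefore bounds the
number of large coordinates. -/
lemma const_le (h : IsAmenablePenalty ρ L μ) (hl : 0 < lam) {t : ℝ}
    (ht : lam * L / μ ≤ |t|) : (lam * L) ^ 2 / (2 * μ) ≤ ρ lam t := by
  have hLp := h.L_pos
  have hm := h.μ_pos
  have h0 : 0 ≤ lam * L / μ := by positivity
  have h1 := h.lasso_sub_le hl (lam * L / μ)
  rw [abs_of_nonneg h0] at h1
  refine le_trans (le_of_eq ?_) (h1.trans (h.abs_mono hl (by rwa [abs_of_nonneg h0])))
  field_simp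
  ring

end IsAmenablePenalty

/-! ### Deterministic inequalities for penalised least squares. -/

/-- The empirical second moment `n⁻¹ ∑ᵢ (zᵢᵀ v)²`. -/
noncomputable def empQuad {n p : ℕ} (z : Fin n → Fin p → ℝ) (v : Fin p → ℝ) : ℝ :=
  1 / (n : ℝ) * ∑ i, (z i ⬝ᵥ v) ^ 2

/-- The empirical correlation `n⁻¹ ∑ᵢ zᵢⱼ rᵢ`. -/
noncomputable def empGrad {n p : ℕ} (z : Fin n → Fin p → ℝ) (r : Fin n → ℝ) (j : Fin p) : ℝ :=
  1 / (n : ℝ) * ∑ i, z i j * r i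

/-- The empirical second moment matrix `n⁻¹ ∑ᵢ zᵢⱼ zᵢₖ`. -/
noncomputable def empGram {n p : ℕ} (z : Fin n → Fin p → ℝ) (j k : Fin p) : ℝ :=
  1 / (n : ℝ) * ∑ i, z i j * z i k

section Deterministic

variable {n p : ℕ}

lemma empQuad_nonneg (z : Fin n → Fin p → ℝ) (v : Fin p → ℝ) : 0 ≤ empQuad z v := by
  unfold empQuad; positivity

lemma empQuad_eq_empGram (z : Fin n → Fin p → ℝ) (v : Fin p → ℝ) :
    empQuad z v = ∑ j, ∑ k, empGram z j k * (v j * v k) := by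
  unfold empQuad empGram
  have : ∀ i, (z i ⬝ᵥ v) ^ 2 = ∑ j, ∑ k, z i j * z i k * (v j * v k) := by
    intro i
    rw [sq, dotProduct, Finset.sum_mul_sum]
    refine Finset.sum_congr rfl fun j _ => Finset.sum_congr rfl fun k _ => by ring
  simp_rw [this]
  rw [Finset.sum_comm, Finset.mul_sum]
  refine Finset.sum_congr rfl fun j _ => ?_
  rw [Finset.sum_comm, Finset.mul_sum]
  refine Finset.sum_congr rfl fun k _ => ?_
  rw [← Finset.sum_mul]
  ring

lemma sum_mul_dotProduct_eq (z : Fin n → Fin p → ℝ) (r : Fin n → ℝ) (v : Fin p → ℝ) :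
    1 / (n : ℝ) * ∑ i, r i * (z i ⬝ᵥ v) = ∑ j, empGrad z r j * v j := by
  unfold empGrad
  simp_rw [dotProduct, Finset.mul_sum]
  rw [Finset.sum_comm]
  refine Finset.sum_congr rfl fun j _ => ?_
  rw [Finset.sum_mul]
  refine Finset.sum_congr rfl fun k _ => by ring

lemma l0Norm_eq_card (v : Fin p → ℝ) :
    l0Norm v = (Finset.univ.filter (fun j => v j ≠ 0)).card := by
  rw [l0Norm, ← Set.ncard_coe_finset]
  congr 1
  ext j
  simp

/-- Cauchy-Schwarz for the `ℓ¹` norm on a set of coordinates. -/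
lemma sum_abs_le_sqrt_card (v : Fin p → ℝ) (S : Finset (Fin p)) :
    ∑ j ∈ S, |v j| ≤ √(S.card : ℝ) * √(∑ j, v j ^ 2) := by
  rw [← Real.sqrt_mul (by positivity)]
  refine Real.le_sqrt_of_sq_le ?_
  refine (sq_sum_le_card_mul_sum_sq (s := S) (f := fun j => |v j|)).trans ?_
  simp_rw [sq_abs]
  refine mul_le_mul_of_nonneg_left ?_ (by positivity)
  exact Finset.sum_le_sum_of_subset_of_nonneg (Finset.subset_univ S) fun _ _ _ => sq_nonneg _

lemma abs_sum_mul_le {g v : Fin p → ℝ} {b : ℝ} (S : Finset (Fin p)) (hg : ∀ j, |g j| ≤ b) :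
    |∑ j ∈ S, g j * v j| ≤ b * ∑ j ∈ S, |v j| := by
  refine (Finset.abs_sum_le_sum_abs _ _).trans ?_
  rw [Finset.mul_sum]
  refine Finset.sum_le_sum fun j _ => ?_
  rw [abs_mul]
  exact mul_le_mul_of_nonneg_right (hg j) (abs_nonneg _)

lemma sum_sq_le_sq_sum_abs (v : Fin p → ℝ) : ∑ j, v j ^ 2 ≤ (∑ j, |v j|) ^ 2 := by
  simpa using Finset.sum_sq_le_sq_sum_of_nonneg (s := Finset.univ) (f := fun j => |v j|)
    (fun _ _ => abs_nonneg _)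

variable {ρ : ℝ → ℝ → ℝ} {L μ lam : ℝ}

/-- The comparison of the penalised loss at the minimiser with its value at `γ0`. -/
lemma penalized_compare {y : Fin n → ℝ} {z : Fin n → Fin p → ℝ} {γ γ0 : Fin p → ℝ}
    (hmin : IsMinOn (penalizedLoss ρ lam y z) Set.univ γ) {r : Fin n → ℝ}
    (hr : ∀ i, y i = z i ⬝ᵥ γ0 + r i) :
    1 / (2 * (n : ℝ)) * ∑ i, (r i - z i ⬝ᵥ (γ - γ0)) ^ 2 + ∑ j, ρ lam (γ j) ≤
      1 / (2 * (n : ℝ)) * ∑ i, r i ^ 2 + ∑ j, ρ lam (γ0 j) := by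
  have h1 : penalizedLoss ρ lam y z γ ≤ penalizedLoss ρ lam y z γ0 :=
    isMinOn_iff.1 hmin γ0 (Set.mem_univ _)
  unfold penalizedLoss at h1
  convert h1 using 4 with i _ i _
  · rw [hr, dotProduct_sub]; ring
  · rw [hr]; ring

/-- The basic inequality for a global minimiser of the penalised loss. -/
lemma basic_inequality (h : IsAmenablePenalty ρ L μ) (hl : 0 < lam)
    {y : Fin n → ℝ} {z : Fin n → Fin p → ℝ} {γ γ0 : Fin p → ℝ}
    (hmin : IsMinOn (penalizedLoss ρ lam y z) Set.univ γ) {r : Fin n → ℝ}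
    (hr : ∀ i, y i = z i ⬝ᵥ γ0 + r i) {S : Finset (Fin p)} (hS : ∀ j, j ∉ S → γ0 j = 0) :
    empQuad z (γ - γ0) / 2 + ∑ j ∈ Sᶜ, ρ lam ((γ - γ0) j) ≤
      ∑ j, empGrad z r j * (γ - γ0) j + ∑ j ∈ S, ρ lam ((γ - γ0) j) := by
  have h1 := penalized_compare hmin hr
  set v := γ - γ0 with hv
  have hexp : 1 / (2 * (n : ℝ)) * ∑ i, (r i - z i ⬝ᵥ v) ^ 2 =
      1 / (2 * (n : ℝ)) * ∑ i, r i ^ 2 - ∑ j, empGrad z r j * v j + empQuad z v / 2 := by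
    rw [← sum_mul_dotProduct_eq, empQuad]
    have : ∀ i, (r i - z i ⬝ᵥ v) ^ 2 = r i ^ 2 - 2 * (r i * (z i ⬝ᵥ v)) + (z i ⬝ᵥ v) ^ 2 :=
      fun i => by ring
    simp_rw [this]
    rw [Finset.sum_add_distrib, Finset.sum_sub_distrib, ← Finset.mul_sum, one_div, one_div, mul_inv]
    ring
  rw [hexp] at h1
  have hγ : ∀ j, γ j = γ0 j + v j := fun j => by simp [hv]
  -- Off `S` the vector `γ0` vanishes and `γ = v`; on `S`, subadditivity and evenness give ρ(γ0) ≤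
  -- ρ(γ) + ρ(v).
  have h2 : ∑ j ∈ Sᶜ, ρ lam (v j) + ∑ j, ρ lam (γ0 j) ≤
      ∑ j, ρ lam (γ j) + ∑ j ∈ S, ρ lam (v j) := by
    have e1 := Finset.sum_add_sum_compl S (fun j => ρ lam (γ0 j))
    have e2 := Finset.sum_add_sum_compl S (fun j => ρ lam (γ j))
    have e3 : ∑ j ∈ Sᶜ, ρ lam (γ0 j) = 0 := Finset.sum_eq_zero fun j hj => by
      rw [hS j (Finset.mem_compl.1 hj), h.zero lam hl]
    have e4 : ∑ j ∈ Sᶜ, ρ lam (γ j) = ∑ j ∈ Sᶜ, ρ lam (v j) :=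
      Finset.sum_congr rfl fun j hj => by rw [hγ, hS j (Finset.mem_compl.1 hj), zero_add]
    have e5 : ∑ j ∈ S, ρ lam (γ0 j) ≤ ∑ j ∈ S, (ρ lam (γ j) + ρ lam (v j)) :=
      Finset.sum_le_sum fun j _ => by
        have := h.subadd hl (γ j) (-(v j))
        rw [h.symm lam hl] at this
        have e : γ j + -(v j) = γ0 j := by rw [hγ]; ring
        rwa [e] at this
    rw [Finset.sum_add_distrib] at e5
    linarith
  linarith

lemma sum_penalty_le (h : IsAmenablePenalty ρ L μ) (hl : 0 < lam) (v : Fin p → ℝ)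
    (S : Finset (Fin p)) : ∑ j ∈ S, ρ lam (v j) ≤ lam * L * ∑ j ∈ S, |v j| := by
  rw [Finset.mul_sum]
  exact Finset.sum_le_sum fun j _ => h.le_lasso hl _

/-- Crude bound on the total penalty of the estimation error. -/
lemma total_penalty_le (h : IsAmenablePenalty ρ L μ) (hl : 0 < lam)
    {y : Fin n → ℝ} {z : Fin n → Fin p → ℝ} {γ γ0 : Fin p → ℝ}
    (hmin : IsMinOn (penalizedLoss ρ lam y z) Set.univ γ) {r : Fin n → ℝ}
    (hr : ∀ i, y i = z i ⬝ᵥ γ0 + r i) :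
    ∑ j, ρ lam ((γ - γ0) j) ≤ (1 / (n : ℝ) * ∑ i, r i ^ 2) / 2 +
      2 * (lam * L * (√(l0Norm γ0 : ℝ) * √(∑ j, γ0 j ^ 2))) := by
  have h1 := penalized_compare hmin hr
  have h0 : 0 ≤ 1 / (2 * (n : ℝ)) * ∑ i, (r i - z i ⬝ᵥ (γ - γ0)) ^ 2 := by positivity
  -- The comparison at the minimiser already contains the penalty of `γ0` once; subadditivity adds
  -- it a second time, whence the factor 2.
  have h2 : ∑ j, ρ lam ((γ - γ0) j) ≤ ∑ j, ρ lam (γ j) + ∑ j, ρ lam (γ0 j) := by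
    rw [← Finset.sum_add_distrib]
    refine Finset.sum_le_sum fun j _ => ?_
    have := h.subadd hl (γ j) (-(γ0 j))
    rw [h.symm lam hl] at this
    simpa [sub_eq_add_neg] using this
  have h3 : ∑ j, ρ lam (γ0 j) ≤ lam * L * (√(l0Norm γ0 : ℝ) * √(∑ j, γ0 j ^ 2)) := by
    have hLp := h.L_pos
    calc ∑ j, ρ lam (γ0 j) = ∑ j ∈ Finset.univ.filter (fun j => γ0 j ≠ 0), ρ lam (γ0 j) := by
          rw [Finset.sum_filter_of_ne]
          intro j _ hj h0
          exact hj (by rw [h0, h.zero lam hl])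
      _ ≤ lam * L * ∑ j ∈ Finset.univ.filter (fun j => γ0 j ≠ 0), |γ0 j| :=
          sum_penalty_le h hl _ _
      _ ≤ _ := by
          rw [l0Norm_eq_card]
          exact mul_le_mul_of_nonneg_left (sum_abs_le_sqrt_card _ _) (by positivity)
  have h4 : 1 / (2 * (n : ℝ)) * ∑ i, r i ^ 2 = (1 / (n : ℝ) * ∑ i, r i ^ 2) / 2 := by
    rw [one_div, one_div, mul_inv]; ring
  linarith

/-- Estimation error when every coordinate may be active. -/
lemma lowdim_rate (h : IsAmenablePenalty ρ L μ) (hl : 0 < lam)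
    {y : Fin n → ℝ} {z : Fin n → Fin p → ℝ} {γ γ0 : Fin p → ℝ}
    (hmin : IsMinOn (penalizedLoss ρ lam y z) Set.univ γ) {r : Fin n → ℝ}
    (hr : ∀ i, y i = z i ⬝ᵥ γ0 + r i) {b c : ℝ} (hc : 0 < c) (hb : lam * L ≤ b)
    (hg : ∀ j, |empGrad z r j| ≤ b)
    (hre : c * ∑ j, (γ - γ0) j ^ 2 ≤ empQuad z (γ - γ0)) :
    ∑ j, |(γ - γ0) j| ≤ 4 * b * p / c ∧ empQuad z (γ - γ0) ≤ 16 * b ^ 2 * p / c := by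
  -- With all coordinates declared active, no penalty is left on the left side and no cone condition
  -- is needed.
  have h1 := basic_inequality h hl hmin hr (S := Finset.univ) (by simp)
  set v := γ - γ0
  have h2 := abs_sum_mul_le (v := v) Finset.univ hg
  have h3 := sum_penalty_le h hl v Finset.univ
  have hLp := h.L_pos
  have h4 := sum_abs_le_sqrt_card v Finset.univ
  simp only [Finset.compl_univ, Finset.sum_empty, add_zero, Finset.card_univ, Fintype.card_fin]
    at h1 h4
  set N := √(∑ j, v j ^ 2)
  have hN : N ^ 2 = ∑ j, v j ^ 2 := Real.sq_sqrt (by positivity)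
  have hN0 : 0 ≤ N := Real.sqrt_nonneg _
  have hp : √(p : ℝ) ^ 2 = p := Real.sq_sqrt (by positivity)
  have hp0 : 0 ≤ √(p : ℝ) := Real.sqrt_nonneg _
  have hbp : 0 ≤ b := le_trans (by positivity) hb
  have h5 : empQuad z v ≤ 4 * b * (√p * N) := by
    have e1 := (abs_le.1 h2).2
    have e2 : lam * L * ∑ j, |v j| ≤ b * ∑ j, |v j| :=
      mul_le_mul_of_nonneg_right hb (by positivity)
    have e3 : b * ∑ j, |v j| ≤ b * (√p * N) := mul_le_mul_of_nonneg_left h4 hbp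
    linarith
  rw [← hN] at hre
  have h6 : c * N ≤ 4 * b * √p := by
    rcases hN0.eq_or_lt with h0 | h0
    · rw [← h0]; simp; positivity
    · refine le_of_mul_le_mul_right ?_ h0
      nlinarith
  have h7 : N ≤ 4 * b * √p / c := by rw [le_div_iff₀ hc]; linarith
  constructor
  · calc ∑ j, |v j| ≤ √p * N := h4
      _ ≤ √p * (4 * b * √p / c) := by gcongr
      _ = 4 * b * (√p ^ 2) / c := by ring
      _ = _ := by rw [hp]
  · calc empQuad z v ≤ 4 * b * (√p * N) := h5
      _ ≤ 4 * b * (√p * (4 * b * √p / c)) := by gcongr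
      _ = 16 * b ^ 2 * (√p ^ 2) / c := by ring
      _ = _ := by rw [hp]

/-- Oracle inequality for the Lasso. -/
lemma lasso_rate (h : IsAmenablePenalty ρ L μ) (hlasso : IsLassoPenalty ρ L) (hl : 0 < lam)
    {y : Fin n → ℝ} {z : Fin n → Fin p → ℝ} {γ γ0 : Fin p → ℝ}
    (hmin : IsMinOn (penalizedLoss ρ lam y z) Set.univ γ) {r : Fin n → ℝ}
    (hr : ∀ i, y i = z i ⬝ᵥ γ0 + r i) {c τ : ℝ} (hc : 0 < c)
    (hg : ∀ j, |empGrad z r j| ≤ lam * L / 2) (hτ0 : 0 ≤ τ)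
    (hτ : 32 * (l0Norm γ0 : ℝ) * τ ≤ c)
    (hre : c * ∑ j, (γ - γ0) j ^ 2 - τ * (∑ j, |(γ - γ0) j|) ^ 2 ≤ empQuad z (γ - γ0)) :
    ∑ j, |(γ - γ0) j| ≤ 24 * (lam * L) * l0Norm γ0 / c ∧
      empQuad z (γ - γ0) ≤ 18 * (lam * L) ^ 2 * l0Norm γ0 / c := by
  set S := Finset.univ.filter (fun j => γ0 j ≠ 0) with hS
  have h1 := basic_inequality h hl hmin hr (S := S) (by simp [hS])
  rw [l0Norm_eq_card] at hτ ⊢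
  rw [← hS] at hτ ⊢
  set v := γ - γ0
  have h2 := (abs_le.1 (abs_sum_mul_le (v := v) Finset.univ hg)).2
  have hLp := h.L_pos
  have h4 := sum_abs_le_sqrt_card v S
  have hsplit := Finset.sum_add_sum_compl S (fun j => |v j|)
  simp_rw [hlasso lam hl, ← Finset.mul_sum] at h1
  have hQ := empQuad_nonneg z v
  set N := √(∑ j, v j ^ 2)
  have hN : N ^ 2 = ∑ j, v j ^ 2 := Real.sq_sqrt (by positivity)
  have hN0 : 0 ≤ N := Real.sqrt_nonneg _
  set s : ℝ := (S.card : ℝ)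
  have hs0 : 0 ≤ s := Nat.cast_nonneg _
  have hs : √s ^ 2 = s := Real.sq_sqrt hs0
  have hss0 : 0 ≤ √s := Real.sqrt_nonneg _
  set A := ∑ j ∈ S, |v j|
  set A' := ∑ j ∈ Sᶜ, |v j|
  have hA0 : 0 ≤ A := by positivity
  have hA0' : 0 ≤ A' := by positivity
  set ℓ := lam * L
  have hℓ : 0 < ℓ := by positivity
  rw [← hsplit] at h2 hre ⊢
  rw [← hN] at hre
  -- The correlations use only half of the penalty off the support, and the other half yields the
  -- cone condition A' ≤ 3A.
  have h5 : empQuad z v + ℓ * A' ≤ 3 * ℓ * A := by linarith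
  have h6 : A + A' ≤ 4 * (√s * N) := by
    have : A' ≤ 3 * A := by
      refine le_of_mul_le_mul_left ?_ hℓ
      linarith
    linarith
  -- On the cone ‖v‖₁² ≤ 16 s ‖v‖₂², so `hτ` makes the defect at most half of the curvature.
  have h7 : τ * (A + A') ^ 2 ≤ c / 2 * N ^ 2 := by
    calc τ * (A + A') ^ 2 ≤ τ * (4 * (√s * N)) ^ 2 := by gcongr
      _ = 16 * (√s ^ 2) * τ * N ^ 2 := by ring
      _ ≤ c / 2 * N ^ 2 := by rw [hs]; exact mul_le_mul_of_nonneg_right (by linarith) (sq_nonneg _)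
  have h8 : empQuad z v ≤ 3 * ℓ * (√s * N) := by
    have : 3 * ℓ * A ≤ 3 * ℓ * (√s * N) := by gcongr
    nlinarith [mul_nonneg hℓ.le hA0']
  have h9 : c * N ≤ 6 * ℓ * √s := by
    rcases hN0.eq_or_lt with h0 | h0
    · rw [← h0]; simp; positivity
    · refine le_of_mul_le_mul_right ?_ h0
      nlinarith
  have h10 : N ≤ 6 * ℓ * √s / c := by rw [le_div_iff₀ hc]; linarith
  constructor
  · calc A + A' ≤ 4 * (√s * N) := h6
      _ ≤ 4 * (√s * (6 * ℓ * √s / c)) := by gcongr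
      _ = 24 * ℓ * (√s ^ 2) / c := by ring
      _ = _ := by rw [hs]
  · calc empQuad z v ≤ 3 * ℓ * (√s * N) := h8
      _ ≤ 3 * ℓ * (√s * (6 * ℓ * √s / c)) := by gcongr
      _ = 18 * ℓ ^ 2 * (√s ^ 2) / c := by ring
      _ = _ := by rw [hs]

end Deterministic

/-! ### Error bound for nonconvex penalties, without a cone condition. -/

/-- The main estimate behind `amenable_rate`, in terms of the `ℓ²` error `N`, the number `k` and
`ℓ¹` size `A` of the large errors, the `ℓ¹` size `A'` of the small ones and the total penalty `R`. -/
lemma amenable_main_estimate {N k A A' R Q g E a c C1 C2 C4 μ : ℝ} (hc : 0 < c) (hC1 : 0 ≤ C1)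
    (hC2 : 0 ≤ C2) (hμ : 0 < μ) (ha : 0 < a) (hE0 : 0 < E) (hk0 : 0 ≤ k) (hA0 : 0 ≤ A)
    (hA0' : 0 ≤ A') (hR0 : 0 ≤ R) (hR : R ≤ C4) (hT4 : A ≤ √k * N)
    (hg2 : g ≤ C1 * a * (A + A')) (hre : c * N ^ 2 - C2 * a ^ 2 * (A + A') ^ 2 ≤ Q)
    (e1 : k * a ^ 2 * E ^ 2 ≤ 2 * μ * R) (e2 : (a * A') * E ≤ 2 * R)
    (hD1 : 8 * μ * C2 * C4 ≤ c * E ^ 2) (hD2 : 16 * C1 ≤ E)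
    (hD3 : 8 * C2 * C4 ≤ E ^ 2) (hD4 : 64 * C1 ^ 2 * μ ≤ c * E ^ 2) :
    c / 2 * N ^ 2 ≤ Q + R ∧ g ≤ Q / 8 + 3 * R / 8 := by
  have hk : √k ^ 2 = k := Real.sq_sqrt hk0
  have haA : 0 ≤ a * A' := by positivity
  -- The a priori bound R ≤ C4 turns a term quadratic in R into a linear one.
  have e3 : (a * A') ^ 2 * E ^ 2 ≤ 4 * C4 * R := by
    calc (a * A') ^ 2 * E ^ 2 = ((a * A') * E) ^ 2 := by ring
      _ ≤ (2 * R) ^ 2 := by gcongr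
      _ = 4 * R * R := by ring
      _ ≤ 4 * C4 * R := by gcongr
  -- A² ≤ k N², and k a² is at most 2μC4/E²; `hD1` makes the share of the large errors in the defect
  -- at most half of the curvature.
  have e4 : 2 * C2 * a ^ 2 * k ≤ c / 2 := by
    refine le_of_mul_le_mul_right ?_ (by positivity : 0 < E ^ 2)
    calc 2 * C2 * a ^ 2 * k * E ^ 2 = 2 * C2 * (k * a ^ 2 * E ^ 2) := by ring
      _ ≤ 2 * C2 * (2 * μ * R) := by gcongr
      _ ≤ 2 * C2 * (2 * μ * C4) := by gcongr
      _ ≤ _ := by linarith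
  have e5 : 2 * C2 * (a * A') ^ 2 ≤ R := by
    refine le_of_mul_le_mul_right ?_ (by positivity : 0 < E ^ 2)
    calc 2 * C2 * (a * A') ^ 2 * E ^ 2 = 2 * C2 * ((a * A') ^ 2 * E ^ 2) := by ring
      _ ≤ 2 * C2 * (4 * C4 * R) := by gcongr
      _ = 8 * C2 * C4 * R := by ring
      _ ≤ E ^ 2 * R := by gcongr
      _ = _ := by ring
  have e6 : c / 2 * N ^ 2 ≤ Q + R := by
    have : C2 * a ^ 2 * (A + A') ^ 2 ≤ c / 2 * N ^ 2 + R := by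
      calc C2 * a ^ 2 * (A + A') ^ 2 ≤ C2 * a ^ 2 * (2 * A ^ 2 + 2 * A' ^ 2) := by
            gcongr; nlinarith [sq_nonneg (A - A')]
        _ ≤ C2 * a ^ 2 * (2 * (√k * N) ^ 2 + 2 * A' ^ 2) := by gcongr
        _ = 2 * C2 * a ^ 2 * (√k ^ 2) * N ^ 2 + 2 * C2 * (a * A') ^ 2 := by ring
        _ ≤ _ := by rw [hk]; gcongr
    linarith
  have e7 : C1 * a * A' ≤ R / 8 := by
    refine le_of_mul_le_mul_right ?_ hE0
    calc C1 * a * A' * E = C1 * ((a * A') * E) := by ring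
      _ ≤ C1 * (2 * R) := by gcongr
      _ = (16 * C1) * R / 8 := by ring
      _ ≤ E * R / 8 := by gcongr
      _ = _ := by ring
  -- Young's inequality: one part goes into the curvature c N², the other is a multiple of a²k,
  -- which the penalty pays for.
  have e8 : C1 * a * A ≤ c / 16 * N ^ 2 + R / 8 := by
    have f1 : 4 / c * C1 ^ 2 * a ^ 2 * k ≤ R / 8 := by
      refine le_of_mul_le_mul_right ?_ (by positivity : 0 < E ^ 2)
      calc 4 / c * C1 ^ 2 * a ^ 2 * k * E ^ 2 = 4 / c * C1 ^ 2 * (k * a ^ 2 * E ^ 2) := by ring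
        _ ≤ 4 / c * C1 ^ 2 * (2 * μ * R) := by gcongr
        _ = (64 * C1 ^ 2 * μ) * R / (8 * c) := by field_simp; ring
        _ ≤ (c * E ^ 2) * R / (8 * c) := by gcongr
        _ = _ := by field_simp
    have f2 : C1 * a * (√k * N) ≤ c / 16 * N ^ 2 + 4 / c * C1 ^ 2 * a ^ 2 * k := by
      have f3 : c / 16 * N ^ 2 + 4 / c * C1 ^ 2 * a ^ 2 * √k ^ 2 - C1 * a * (√k * N) =
          c / 16 * (N - 8 / c * C1 * a * √k) ^ 2 := by field_simp; ring
      rw [hk] at f3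
      have : 0 ≤ c / 16 * (N - 8 / c * C1 * a * √k) ^ 2 := by positivity
      linarith
    calc C1 * a * A ≤ C1 * a * (√k * N) := by gcongr
      _ ≤ _ := by linarith
  exact ⟨e6, by linarith⟩

/-- `e6` bounds N² by Q + R and `e9` bounds Q and R by a multiple of N. Solving for N gives all
rates. The bound on R also gives k = O(s), so Cauchy-Schwarz controls the ℓ¹ size of the large
errors. -/
lemma amenable_rate_of_estimate {N k s A A' R Q E a c μ : ℝ} (hc : 0 < c) (hμ : 0 < μ)
    (ha : 0 < a) (hE0 : 0 < E) (hs0 : 0 ≤ s) (hN0 : 0 ≤ N) (hQ : 0 ≤ Q)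
    (hR0 : 0 ≤ R) (hT4 : A ≤ √k * N)
    (e1 : k * a ^ 2 * E ^ 2 ≤ 2 * μ * R) (e2 : (a * A') * E ≤ 2 * R)
    (e6 : c / 2 * N ^ 2 ≤ Q + R) (e9 : Q / 4 + R / 2 ≤ 2 * (E * a * (√s * N))) :
    A + A' ≤ (√(128 * μ / c) * 16 + 128) * (E * a) * s / c ∧ Q ≤ 128 * (E * a) ^ 2 * s / c := by
  have hs : √s ^ 2 = s := Real.sq_sqrt hs0
  have hss0 : 0 ≤ √s := Real.sqrt_nonneg _
  set ℓ := E * a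
  have hℓ : 0 < ℓ := by positivity
  have e10 : c * N ≤ 16 * ℓ * √s := by
    rcases hN0.eq_or_lt with h0 | h0
    · rw [← h0]; simp; positivity
    · refine le_of_mul_le_mul_right ?_ h0
      nlinarith
  have e11 : N ≤ 16 * ℓ * √s / c := by rw [le_div_iff₀ hc]; linarith
  have e12 : ℓ * (√s * N) ≤ 16 * ℓ ^ 2 * s / c := by
    calc ℓ * (√s * N) ≤ ℓ * (√s * (16 * ℓ * √s / c)) := by gcongr
      _ = 16 * ℓ ^ 2 * (√s ^ 2) / c := by ring
      _ = _ := by rw [hs]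
  have e13 : R ≤ 64 * ℓ ^ 2 * s / c := by
    have : 64 * ℓ ^ 2 * s / c = 4 * (16 * ℓ ^ 2 * s / c) := by ring
    linarith
  constructor
  · have f1 : k ≤ 128 * μ / c * s := by
      refine le_of_mul_le_mul_right ?_ (by positivity : 0 < ℓ ^ 2)
      calc k * ℓ ^ 2 = k * a ^ 2 * E ^ 2 := by ring
        _ ≤ 2 * μ * R := e1
        _ ≤ 2 * μ * (64 * ℓ ^ 2 * s / c) := by gcongr
        _ = _ := by ring
    have f2 : √k ≤ √(128 * μ / c) * √s := by
      rw [← Real.sqrt_mul (by positivity)]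
      exact Real.sqrt_le_sqrt f1
    have f3 : A' ≤ 128 * ℓ * s / c := by
      refine le_of_mul_le_mul_right ?_ hℓ
      calc A' * ℓ = a * A' * E := by ring
        _ ≤ 2 * R := e2
        _ ≤ 2 * (64 * ℓ ^ 2 * s / c) := by gcongr
        _ = _ := by ring
    calc A + A' ≤ √k * N + A' := by gcongr
      _ ≤ (√(128 * μ / c) * √s) * (16 * ℓ * √s / c) + 128 * ℓ * s / c := by gcongr
      _ = √(128 * μ / c) * 16 * ℓ * (√s ^ 2) / c + 128 * ℓ * s / c := by ring
      _ = _ := by rw [hs]; ring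
  · have : 128 * ℓ ^ 2 * s / c = 8 * (16 * ℓ ^ 2 * s / c) := by ring
    linarith

/-- Oracle inequality for a global minimiser with an amenable penalty `ρ`, at `lam = D a`, under
restricted strong convexity with tolerance `C2 a²`. -/
lemma amenable_rate {n p : ℕ} {ρ : ℝ → ℝ → ℝ} {L μ D a : ℝ} (h : IsAmenablePenalty ρ L μ)
    (hD : 0 < D) (ha : 0 < a)
    {y : Fin n → ℝ} {z : Fin n → Fin p → ℝ} {γ γ0 : Fin p → ℝ}
    (hmin : IsMinOn (penalizedLoss ρ (D * a) y z) Set.univ γ) {r : Fin n → ℝ}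
    (hr : ∀ i, y i = z i ⬝ᵥ γ0 + r i) {c C1 C2 C4 : ℝ} (hc : 0 < c) (hC1 : 0 ≤ C1)
    (hC2 : 0 ≤ C2)
    (hg : ∀ j, |empGrad z r j| ≤ C1 * a)
    (hre : c * ∑ j, (γ - γ0) j ^ 2 - C2 * a ^ 2 * (∑ j, |(γ - γ0) j|) ^ 2 ≤ empQuad z (γ - γ0))
    (hR : ∑ j, ρ (D * a) ((γ - γ0) j) ≤ C4)
    (hD1 : 8 * μ * C2 * C4 ≤ c * (D * L) ^ 2) (hD2 : 16 * C1 ≤ D * L)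
    (hD3 : 8 * C2 * C4 ≤ (D * L) ^ 2) (hD4 : 64 * C1 ^ 2 * μ ≤ c * (D * L) ^ 2) :
    ∑ j, |(γ - γ0) j| ≤
        (√(128 * μ / c) * 16 + 128) * (D * L * a) * l0Norm γ0 / c ∧
      empQuad z (γ - γ0) ≤ 128 * (D * L * a) ^ 2 * l0Norm γ0 / c := by
  have hl : 0 < D * a := by positivity
  have hLp := h.L_pos
  have hμ := h.μ_pos
  set S := Finset.univ.filter (fun j => γ0 j ≠ 0) with hS
  have h1 := basic_inequality h hl hmin hr (S := S) (by simp [hS])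
  rw [l0Norm_eq_card]
  rw [← hS]
  set v := γ - γ0
  -- The threshold separates the ranges of `const_le` (inside `T`) and `half_lasso_le` (outside).
  set T := Finset.univ.filter (fun j => D * a * L / μ < |v j|) with hT
  have hTsplit := Finset.sum_add_sum_compl T (fun j => |v j|)
  have hSsplit := Finset.sum_add_sum_compl S (fun j => ρ (D * a) (v j))
  have hTR := Finset.sum_add_sum_compl T (fun j => ρ (D * a) (v j))
  have hT4 := sum_abs_le_sqrt_card v T
  have hS4 := sum_abs_le_sqrt_card v S
  have hSR := sum_penalty_le h hl v S
  have hg2 : ∑ j, empGrad z r j * v j ≤ C1 * a * ∑ j, |v j| :=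
    (abs_le.1 (abs_sum_mul_le (v := v) Finset.univ hg)).2
  have hQ := empQuad_nonneg z v
  set N := √(∑ j, v j ^ 2)
  have hN : N ^ 2 = ∑ j, v j ^ 2 := Real.sq_sqrt (by positivity)
  have hN0 : 0 ≤ N := Real.sqrt_nonneg _
  have hTc : (T.card : ℝ) * ((D * a * L) ^ 2 / (2 * μ)) ≤ ∑ j ∈ T, ρ (D * a) (v j) := by
    rw [← nsmul_eq_mul]
    refine Finset.card_nsmul_le_sum _ _ _ fun j hj => h.const_le hl ?_
    exact (by simpa [hT] using hj : D * a * L / μ < |v j|).le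
  have hTc' : D * a * L / 2 * ∑ j ∈ Tᶜ, |v j| ≤ ∑ j ∈ Tᶜ, ρ (D * a) (v j) := by
    rw [Finset.mul_sum]
    refine Finset.sum_le_sum fun j hj => h.half_lasso_le hl ?_
    simpa [hT] using hj
  have hTn : 0 ≤ ∑ j ∈ T, ρ (D * a) (v j) := Finset.sum_nonneg fun j _ => h.nonneg hl _
  have hTn' : 0 ≤ ∑ j ∈ Tᶜ, ρ (D * a) (v j) := Finset.sum_nonneg fun j _ => h.nonneg hl _
  set k : ℝ := (T.card : ℝ)
  have hk0 : 0 ≤ k := Nat.cast_nonneg _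
  have hk : √k ^ 2 = k := Real.sq_sqrt hk0
  have hk0' : 0 ≤ √k := Real.sqrt_nonneg _
  set s : ℝ := (S.card : ℝ)
  have hs0 : 0 ≤ s := Nat.cast_nonneg _
  have hs : √s ^ 2 = s := Real.sq_sqrt hs0
  have hss0 : 0 ≤ √s := Real.sqrt_nonneg _
  set R := ∑ j, ρ (D * a) (v j)
  set RS := ∑ j ∈ S, ρ (D * a) (v j)
  set A := ∑ j ∈ T, |v j|
  set A' := ∑ j ∈ Tᶜ, |v j|
  have hA0 : 0 ≤ A := by positivity
  have hA0' : 0 ≤ A' := by positivity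
  set E := D * L with hE
  have hE0 : 0 < E := by positivity
  have hR0 : 0 ≤ R := by linarith
  rw [← hTsplit] at hg2 hre ⊢
  rw [← hN] at hre
  have e1 : k * a ^ 2 * E ^ 2 ≤ 2 * μ * R := by
    have : k * ((D * a * L) ^ 2 / (2 * μ)) ≤ R := by linarith
    rw [mul_div_assoc', div_le_iff₀ (by positivity)] at this
    calc k * a ^ 2 * E ^ 2 = k * (D * a * L) ^ 2 := by rw [hE]; ring
      _ ≤ _ := by linarith
  have e2 : (a * A') * E ≤ 2 * R := by
    have : D * a * L / 2 * A' ≤ R := by linarith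
    calc (a * A') * E = 2 * (D * a * L / 2 * A') := by rw [hE]; ring
      _ ≤ _ := by linarith
  obtain ⟨e6, e7⟩ := amenable_main_estimate hc hC1 hC2 hμ ha hE0 hk0 hA0 hA0' hR0 hR hT4 hg2 hre
    e1 e2 hD1 hD2 hD3 hD4
  have hSR' : RS ≤ E * a * (√s * N) := by
    refine hSR.trans ?_
    calc D * a * L * ∑ j ∈ S, |v j| ≤ D * a * L * (√s * N) := by gcongr
      _ = _ := by rw [hE]; ring
  -- The basic inequality reads Q/2 + R - RS ≤ g + RS, and `e7` bounds g by Q/8 + 3R/8.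
  have e9 : empQuad z v / 4 + R / 2 ≤ 2 * (E * a * (√s * N)) := by
    linarith
  exact amenable_rate_of_estimate hc hμ ha hE0 hs0 hN0 hQ hR0 hT4 e1 e2 e6 e9

/-! ### Maurey's empirical method for quadratic forms. -/

/-- Derandomised empirical method of Maurey: one step. -/
lemma maurey_step {p : ℕ} (A : Matrix (Fin p) (Fin p) ℝ) (hA : A.IsSymm) {d : ℝ}
    (hd : ∀ j, A j j ≤ d) {x : Fin p → ℝ} (hx : ∑ j, |x j| = 1) (b : Fin p → ℝ) :
    ∃ j : Fin p, ∃ s : Bool,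
      (b + Pi.single j (if s then (1 : ℝ) else -1)) ⬝ᵥ
          A.mulVec (b + Pi.single j (if s then (1 : ℝ) else -1)) ≤
        (b + x) ⬝ᵥ A.mulVec (b + x) + (d - x ⬝ᵥ A.mulVec x) := by
  set B := A.mulVec b with hB
  have hsymm : ∀ w : Fin p → ℝ, b ⬝ᵥ A.mulVec w = w ⬝ᵥ B := by
    intro w
    rw [hB, Matrix.dotProduct_mulVec, ← Matrix.mulVec_transpose, hA, dotProduct_comm]
  have hexp : ∀ w : Fin p → ℝ, (b + w) ⬝ᵥ A.mulVec (b + w) =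
      b ⬝ᵥ B + 2 * (w ⬝ᵥ B) + w ⬝ᵥ A.mulVec w := by
    intro w
    rw [Matrix.mulVec_add, add_dotProduct, dotProduct_add, dotProduct_add, hsymm w]
    ring
  have hval : ∀ (j : Fin p) (t : ℝ), t ^ 2 = 1 →
      (b + Pi.single j t) ⬝ᵥ A.mulVec (b + Pi.single j t) ≤ b ⬝ᵥ B + 2 * (t * B j) + d := by
    intro j t ht
    rw [hexp]
    have : (Pi.single j t : Fin p → ℝ) ⬝ᵥ A.mulVec (Pi.single j t) = t ^ 2 * A j j := by
      simp [Matrix.mulVec_single]; ring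
    rw [this, ht, single_dotProduct]
    linarith [hd j]
  rw [hexp x]
  -- The vector sign(x_j) e_j, drawn with probability |x_j|, has mean x, and the form at b plus this
  -- vector has mean at most the right side. If every outcome were larger, averaging with weights
  -- |x_j| would give a contradiction.
  by_contra! hcon
  have hlt : ∀ j, x ⬝ᵥ B < (if 0 ≤ x j then (1 : ℝ) else -1) * B j := by
    intro j
    by_cases h0 : 0 ≤ x j
    · have h1 := hcon j true
      have h2 := hval j 1 (by norm_num)
      simp only [if_true, if_pos h0] at h1 ⊢
      linarith
    · have h1 := hcon j false
      have h2 := hval j (-1) (by norm_num)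
      simp only [if_neg h0, Bool.false_eq_true, if_false] at h1 ⊢
      linarith
  have habs : ∀ j, |x j| * (if 0 ≤ x j then (1 : ℝ) else -1) = x j := by
    intro j
    split_ifs with h0
    · rw [abs_of_nonneg h0, mul_one]
    · rw [abs_of_neg (not_le.1 h0)]; ring
  have hsum : ∑ j, |x j| * (x ⬝ᵥ B) < ∑ j, |x j| * ((if 0 ≤ x j then (1 : ℝ) else -1) * B j) := by
    have hne : ∃ j, x j ≠ 0 := by
      by_contra! h0
      simp [h0] at hx
    obtain ⟨j, hj⟩ := hne
    refine Finset.sum_lt_sum (fun i _ => mul_le_mul_of_nonneg_left (hlt i).le (abs_nonneg _))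
      ⟨j, Finset.mem_univ _, mul_lt_mul_of_pos_left (hlt j) (abs_pos.2 hj)⟩
  rw [← Finset.sum_mul, hx, one_mul] at hsum
  simp_rw [← mul_assoc, habs] at hsum
  exact lt_irrefl _ hsum

/-- The sum of the signed basis vectors listed by `J`. -/
def signedSum {m p : ℕ} (J : Fin m → Fin p × Bool) : Fin p → ℝ :=
  ∑ l, Pi.single (J l).1 (if (J l).2 then (1 : ℝ) else -1)

/-- The m copies of x are replaced one at a time, each at cost at most d - xᵀAx. The vector `b` is
general because the induction step moves one copy of x into it. -/
lemma maurey_sum {p : ℕ} (A : Matrix (Fin p) (Fin p) ℝ) (hA : A.IsSymm) {d : ℝ}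
    (hd : ∀ j, A j j ≤ d) {x : Fin p → ℝ} (hx : ∑ j, |x j| = 1) (m : ℕ) (b : Fin p → ℝ) :
    ∃ J : Fin m → Fin p × Bool,
      (b + signedSum J) ⬝ᵥ A.mulVec (b + signedSum J) ≤
        (b + (m : ℝ) • x) ⬝ᵥ A.mulVec (b + (m : ℝ) • x) + m * (d - x ⬝ᵥ A.mulVec x) := by
  induction m generalizing b with
  | zero => exact ⟨Fin.elim0, by simp [signedSum]⟩
  | succ m ih =>
    obtain ⟨J, hJ⟩ := ih (b + x)
    obtain ⟨j, s, hjs⟩ := maurey_step A hA hd hx (b + signedSum J)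
    refine ⟨Fin.cons (j, s) J, ?_⟩
    have e1 : b + signedSum (Fin.cons (j, s) J : Fin (m + 1) → Fin p × Bool) =
        b + signedSum J + Pi.single j (if s then (1 : ℝ) else -1) := by
      simp only [signedSum, Fin.sum_univ_succ, Fin.cons_zero, Fin.cons_succ]
      abel
    have e2 : b + ((m + 1 : ℕ) : ℝ) • x = b + x + (m : ℝ) • x := by
      push_cast; rw [add_smul, one_smul]; abel
    have e3 : b + signedSum J + x = b + x + signedSum J := by abel
    rw [e1, e2]
    rw [e3] at hjs
    push_cast
    linarith

/-- If a quadratic form is nonnegative on all sums of `m` signed basis vectors, then it is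
nonnegative up to a multiple of the squared `ℓ¹` norm. -/
lemma maurey_transfer {p : ℕ} (A : Matrix (Fin p) (Fin p) ℝ) (hA : A.IsSymm) {d : ℝ}
    (hd : ∀ j, A j j ≤ d) {m : ℕ} (hm : 2 ≤ m)
    (hpos : ∀ J : Fin m → Fin p × Bool, 0 ≤ signedSum J ⬝ᵥ A.mulVec (signedSum J))
    (x : Fin p → ℝ) :
    -(d / (m - 1) * (∑ j, |x j|) ^ 2) ≤ x ⬝ᵥ A.mulVec x := by
  have hm' : (2 : ℝ) ≤ m := by exact_mod_cast hm
  set N := ∑ j, |x j| with hN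
  rcases (by positivity : 0 ≤ N).eq_or_lt with h0 | h0
  · have : x = 0 := by
      ext j
      have := (Finset.sum_eq_zero_iff_of_nonneg (fun j _ => abs_nonneg (x j))).1 h0.symm j
        (Finset.mem_univ _)
      simpa using this
    rw [← h0, this]
    simp
  · set w : Fin p → ℝ := N⁻¹ • x with hw
    have hw1 : ∑ j, |w j| = 1 := by
      simp only [hw, Pi.smul_apply, smul_eq_mul, abs_mul, abs_of_pos (inv_pos.2 h0),
        ← Finset.mul_sum]
      exact inv_mul_cancel₀ h0.ne'
    -- For b = 0 this gives 0 ≤ m²W + m(d - W) with W the form at the normalised vector, that is W ≥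
    -- -d/(m - 1).
    obtain ⟨J, hJ⟩ := maurey_sum A hA hd hw1 m 0
    have h1 := hpos J
    simp only [zero_add, Matrix.mulVec_smul, smul_dotProduct, dotProduct_smul, smul_eq_mul] at hJ
    have hxw : x ⬝ᵥ A.mulVec x = N ^ 2 * (w ⬝ᵥ A.mulVec w) := by
      simp only [hw, Matrix.mulVec_smul, smul_dotProduct, dotProduct_smul, smul_eq_mul]
      field_simp
    rw [hxw]
    set W := w ⬝ᵥ A.mulVec w
    have h2 : -d ≤ (m - 1) * W := by
      refine le_of_mul_le_mul_left ?_ (by linarith : (0 : ℝ) < m)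
      nlinarith
    have h3 : -(d / (m - 1)) ≤ W := by
      rw [← neg_div, div_le_iff₀ (by linarith)]
      linarith
    nlinarith [sq_nonneg N]

/-! ### Moments of sub-Gaussian variables and of their products. -/

section Psi2

variable {Ω : Type*} [MeasurableSpace Ω] {P : Measure Ω}

lemma psi2Norm_le_iff {X : Ω → ℝ} {K : ℝ} (hK : 0 ≤ K) :
    psi2Norm P X ≤ ENNReal.ofReal K ↔
      ∀ q : ℝ, 1 ≤ q → eLpNorm X (ENNReal.ofReal q) P ≤ ENNReal.ofReal (K * √q) := by
  unfold psi2Norm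
  rw [iSup₂_le_iff]
  refine forall₂_congr fun q hq => ?_
  have hq0 : 0 < q := by linarith
  have h1 : q ^ (-(1 / 2) : ℝ) = (√q)⁻¹ := by
    rw [Real.rpow_neg hq0.le, Real.sqrt_eq_rpow]
  have hs : 0 < √q := Real.sqrt_pos.2 hq0
  rw [h1, ENNReal.ofReal_inv_of_pos hs, ENNReal.ofReal_mul hK,
    ENNReal.inv_mul_le_iff (by simpa using hs) ENNReal.ofReal_ne_top, mul_comm]

lemma psi2Norm_mono {X : Ω → ℝ} {K K' : ℝ} (h : psi2Norm P X ≤ ENNReal.ofReal K) (hK : K ≤ K') :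
    psi2Norm P X ≤ ENNReal.ofReal K' :=
  h.trans (ENNReal.ofReal_le_ofReal hK)

lemma psi2Norm_add_le {X Y : Ω → ℝ} {K K' : ℝ} (hX : AEStronglyMeasurable X P)
    (hY : AEStronglyMeasurable Y P) (hK : 0 ≤ K) (hK' : 0 ≤ K')
    (h : psi2Norm P X ≤ ENNReal.ofReal K) (h' : psi2Norm P Y ≤ ENNReal.ofReal K') :
    psi2Norm P (fun ω => X ω + Y ω) ≤ ENNReal.ofReal (K + K') := by
  rw [psi2Norm_le_iff (by positivity)]
  rw [psi2Norm_le_iff hK] at h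
  rw [psi2Norm_le_iff hK'] at h'
  intro q hq
  refine (eLpNorm_add_le hX hY (by simpa using hq)).trans ?_
  rw [add_mul, ENNReal.ofReal_add (by positivity) (by positivity)]
  exact add_le_add (h q hq) (h' q hq)

lemma psi2Norm_const_mul_le {X : Ω → ℝ} {K : ℝ} (hK : 0 ≤ K) (b : ℝ)
    (h : psi2Norm P X ≤ ENNReal.ofReal K) :
    psi2Norm P (fun ω => b * X ω) ≤ ENNReal.ofReal (|b| * K) := by
  rw [psi2Norm_le_iff (by positivity)]
  rw [psi2Norm_le_iff hK] at h
  intro q hq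
  have : eLpNorm (fun ω => b * X ω) (ENNReal.ofReal q) P =
      ‖b‖ₑ * eLpNorm X (ENNReal.ofReal q) P := eLpNorm_const_smul b X _ P
  rw [this, mul_assoc, ENNReal.ofReal_mul (abs_nonneg b), ← Real.norm_eq_abs, ofReal_norm]
  gcongr
  exact h q hq

lemma psi2Norm_le_of_bounded [IsProbabilityMeasure P] {X : Ω → ℝ} {K : ℝ}
    (h : ∀ᵐ ω ∂P, |X ω| ≤ K) : psi2Norm P X ≤ ENNReal.ofReal K := by
  have hK : 0 ≤ K := by
    obtain ⟨ω, hω⟩ := h.exists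
    exact (abs_nonneg _).trans hω
  rw [psi2Norm_le_iff hK]
  intro q hq
  refine (eLpNorm_le_of_ae_bound (C := K) (by simpa using h)).trans ?_
  simp only [measure_univ, ENNReal.one_rpow, one_mul]
  refine ENNReal.ofReal_le_ofReal ?_
  exact le_mul_of_one_le_right hK (Real.one_le_sqrt.2 hq)

lemma memLp_of_psi2 [IsProbabilityMeasure P] {X : Ω → ℝ} {K : ℝ} (hX : AEStronglyMeasurable X P)
    (hK : 0 ≤ K) (h : psi2Norm P X ≤ ENNReal.ofReal K) (k : ℕ) : MemLp X k P := by
  rw [psi2Norm_le_iff hK] at h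
  -- The norm controls only exponents q ≥ 1 and k may be 0, so the exponent k + 1 is used and then
  -- lowered.
  have h1 : MemLp X ((k + 1 : ℕ) : ℝ≥0∞) P := by
    refine ⟨hX, ?_⟩
    have := h (k + 1) (by linarith [(Nat.cast_nonneg k : (0 : ℝ) ≤ k)])
    have e : ENNReal.ofReal ((k : ℝ) + 1) = ((k + 1 : ℕ) : ℝ≥0∞) := by
      rw [← ENNReal.ofReal_natCast]; push_cast; rfl
    rw [e] at this
    exact this.trans_lt ENNReal.ofReal_lt_top
  exact h1.mono_exponent (by exact_mod_cast Nat.le_succ k)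

lemma integrable_pow_of_psi2 [IsProbabilityMeasure P] {X : Ω → ℝ} {K : ℝ}
    (hX : AEStronglyMeasurable X P)
    (hK : 0 ≤ K) (h : psi2Norm P X ≤ ENNReal.ofReal K) (k : ℕ) :
    Integrable (fun ω => X ω ^ k) P := by
  have := (memLp_of_psi2 hX hK h k).integrable_norm_pow'
  refine (integrable_norm_iff (hX.pow k)).1 ?_
  simpa using this

lemma integral_even_pow_le_of_psi2 [IsProbabilityMeasure P] {X : Ω → ℝ} {K : ℝ}
    (hX : AEStronglyMeasurable X P)
    (hK : 0 ≤ K) (h : psi2Norm P X ≤ ENNReal.ofReal K) (k : ℕ) :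
    ∫ ω, X ω ^ (2 * k) ∂P ≤ (2 * K ^ 2) ^ k * (k : ℝ) ^ k := by
  rcases Nat.eq_zero_or_pos k with rfl | hk
  · simp
  have hm := memLp_of_psi2 hX hK h (2 * k)
  rw [psi2Norm_le_iff hK] at h
  have hk1 : (1 : ℝ) ≤ k := by exact_mod_cast hk
  have h1 := h ((2 * k : ℕ) : ℝ) (by push_cast; linarith)
  rw [ENNReal.ofReal_natCast, hm.eLpNorm_eq_integral_rpow_norm (by simp; omega) (ENNReal.natCast_ne_top _)] at h1
  have h2 := (ENNReal.ofReal_le_ofReal_iff (by positivity)).1 h1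
  simp only [ENNReal.toReal_natCast, Real.rpow_natCast, Real.norm_eq_abs] at h2
  have h3 : ∀ ω, |X ω| ^ (2 * k) = X ω ^ (2 * k) := fun ω => by
    rw [pow_mul, sq_abs, ← pow_mul]
  simp_rw [h3] at h2
  have h0 : 0 ≤ ∫ ω, X ω ^ (2 * k) ∂P := integral_nonneg fun ω => by
    rw [pow_mul]; positivity
  have h4 := pow_le_pow_left₀ (by positivity) h2 (2 * k)
  rw [Real.rpow_inv_natCast_pow h0 (by omega)] at h4
  refine h4.trans (le_of_eq ?_)
  rw [mul_pow, pow_mul (√_), Real.sq_sqrt (by positivity), pow_mul K, ← mul_pow, ← mul_pow]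
  push_cast
  ring

/-- One term of the exponential series, with e < 3. It converts k^k into the factorial growth on
which the exponential moment bound rests. -/
lemma pow_self_le_exp_mul_factorial (k : ℕ) : (k : ℝ) ^ k ≤ 3 ^ k * k.factorial := by
  have h1 := Real.pow_div_factorial_le_exp (k : ℝ) (by positivity) k
  rw [div_le_iff₀ (by positivity)] at h1
  refine h1.trans ?_
  gcongr
  rw [← Real.exp_one_pow]
  gcongr
  linarith [Real.exp_one_lt_d9]

lemma abs_mul_pow_le (x y : ℝ) (k : ℕ) :
    |x * y| ^ k ≤ (x ^ (2 * k) + y ^ (2 * k)) / 2 := by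
  have h1 : x ^ (2 * k) = (|x| ^ k) ^ 2 := by rw [pow_mul, ← sq_abs, ← pow_mul, ← pow_mul, mul_comm]
  have h2 : y ^ (2 * k) = (|y| ^ k) ^ 2 := by rw [pow_mul, ← sq_abs, ← pow_mul, ← pow_mul, mul_comm]
  rw [abs_mul, mul_pow, h1, h2]
  nlinarith [sq_nonneg (|x| ^ k - |y| ^ k)]

/-- Products of sub-Gaussian variables have the moments of a sub-exponential variable. -/
lemma product_moment_of_psi2 [IsProbabilityMeasure P] {X Y : Ω → ℝ} {K : ℝ}
    (hX : AEStronglyMeasurable X P) (hY : AEStronglyMeasurable Y P)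
    (hK : 0 ≤ K) (h : psi2Norm P X ≤ ENNReal.ofReal K) (h' : psi2Norm P Y ≤ ENNReal.ofReal K)
    (k : ℕ) :
    Integrable (fun ω => |X ω * Y ω| ^ k) P ∧
      ∫ ω, |X ω * Y ω| ^ k ∂P ≤ (6 * K ^ 2) ^ k * k.factorial := by
  have hiX := integrable_pow_of_psi2 hX hK h (2 * k)
  have hiY := integrable_pow_of_psi2 hY hK h' (2 * k)
  have hb : Integrable (fun ω => (X ω ^ (2 * k) + Y ω ^ (2 * k)) / 2) P := (hiX.add hiY).div_const 2
  have hi : Integrable (fun ω => |X ω * Y ω| ^ k) P := by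
    refine hb.mono' (((hX.mul hY).norm).pow k) (ae_of_all _ fun ω => ?_)
    rw [Real.norm_of_nonneg (by positivity)]
    exact abs_mul_pow_le _ _ _
  refine ⟨hi, ?_⟩
  have h1 := integral_even_pow_le_of_psi2 hX hK h k
  have h2 := integral_even_pow_le_of_psi2 hY hK h' k
  calc ∫ ω, |X ω * Y ω| ^ k ∂P ≤ ∫ ω, (X ω ^ (2 * k) + Y ω ^ (2 * k)) / 2 ∂P :=
        integral_mono hi hb fun ω => abs_mul_pow_le _ _ _
    _ = (∫ ω, X ω ^ (2 * k) ∂P + ∫ ω, Y ω ^ (2 * k) ∂P) / 2 := by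
        rw [integral_div, integral_add hiX hiY]
    _ ≤ (2 * K ^ 2) ^ k * (k : ℝ) ^ k := by linarith
    _ ≤ (2 * K ^ 2) ^ k * (3 ^ k * k.factorial) := by
        gcongr; exact pow_self_le_exp_mul_factorial k
    _ = _ := by rw [← mul_assoc, ← mul_pow]; ring

end Psi2

/-! ### Exponential and Chebyshev inequalities for averages. -/

section Tails

variable {Ω : Type*} [MeasurableSpace Ω] {P : Measure Ω} [IsProbabilityMeasure P]

/-- Bound on the moment generating function of a variable with sub-exponential moments. -/
lemma integral_exp_mul_le {ξ : Ω → ℝ} (hm : Measurable ξ) {B : ℝ}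
    (hi : ∀ k : ℕ, Integrable (fun ω => |ξ ω| ^ k) P)
    (hmom : ∀ k : ℕ, ∫ ω, |ξ ω| ^ k ∂P ≤ B ^ k * k.factorial) (hB : 0 ≤ B) {t : ℝ}
    (ht : |t| * B ≤ 1 / 2) :
    Integrable (fun ω => Real.exp (t * ξ ω)) P ∧
      ∫ ω, Real.exp (t * ξ ω) ∂P ≤ 1 + t * ∫ ω, ξ ω ∂P + 2 * (t * B) ^ 2 := by
  -- The exponential series is integrated term by term, dominated by the geometric series in |t|B ≤
  -- 1/2.
  set F : ℕ → Ω → ℝ := fun k ω => (t * ξ ω) ^ k / k.factorial with hF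
  have hnorm : ∀ k ω, ‖F k ω‖ = |t| ^ k / k.factorial * |ξ ω| ^ k := by
    intro k ω
    simp only [hF, norm_div, norm_pow, Real.norm_eq_abs, abs_mul, Nat.abs_cast]
    rw [mul_pow]; ring
  have hFm : ∀ k, Measurable (F k) := fun k => by fun_prop
  have hFi : ∀ k, Integrable (F k) P := by
    intro k
    refine (integrable_norm_iff (hFm k).aestronglyMeasurable).1 ?_
    simp_rw [hnorm]
    exact (hi k).const_mul _
  have hFn : ∀ k, ∫ ω, ‖F k ω‖ ∂P ≤ (|t| * B) ^ k := by
    intro k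
    simp_rw [hnorm]
    rw [integral_const_mul]
    calc |t| ^ k / k.factorial * ∫ ω, |ξ ω| ^ k ∂P
        ≤ |t| ^ k / k.factorial * (B ^ k * k.factorial) := by gcongr; exact hmom k
      _ = _ := by rw [mul_pow]; field_simp
  have hx0 : 0 ≤ |t| * B := by positivity
  have hgeo : Summable fun k : ℕ => (|t| * B) ^ k :=
    summable_geometric_of_lt_one hx0 (by linarith)
  have hsum : Summable fun k => ∫ ω, ‖F k ω‖ ∂P :=
    Summable.of_nonneg_of_le (fun k => integral_nonneg fun ω => norm_nonneg _) hFn hgeo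
  have hexp : ∀ ω, HasSum (fun k => F k ω) (Real.exp (t * ξ ω)) := by
    intro ω
    rw [Real.exp_eq_exp_ℝ]
    exact NormedSpace.expSeries_div_hasSum_exp (t * ξ ω)
  have hHS := hasSum_integral_of_summable_integral_norm hFi hsum
  have htsum : ∀ ω, ∑' k, F k ω = Real.exp (t * ξ ω) := fun ω => (hexp ω).tsum_eq
  simp_rw [htsum] at hHS
  constructor
  · have hmeas : Measurable fun ω => Real.exp (t * ξ ω) := by fun_prop
    refine ⟨hmeas.aestronglyMeasurable, ?_⟩
    rw [HasFiniteIntegral]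
    calc ∫⁻ ω, ‖Real.exp (t * ξ ω)‖ₑ ∂P ≤ ∫⁻ ω, ∑' k, ‖F k ω‖ₑ ∂P := by
          refine lintegral_mono fun ω => ?_
          rw [← htsum ω]
          exact enorm_tsum_le_tsum_enorm (f := fun k => F k ω)
      _ = ∑' k, ∫⁻ ω, ‖F k ω‖ₑ ∂P := lintegral_tsum fun k => (hFm k).enorm.aemeasurable
      _ = ∑' k, ENNReal.ofReal (∫ ω, ‖F k ω‖ ∂P) := by
          congr 1; ext k
          rw [ofReal_integral_norm_eq_lintegral_enorm (hFi k)]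
      _ < ⊤ := by
          rw [← ENNReal.ofReal_tsum_of_nonneg (fun k => integral_nonneg fun ω => norm_nonneg _) hsum]
          exact ENNReal.ofReal_lt_top
  -- The terms of order 0 and 1 are kept exactly; the geometric tail from order 2 sums to at most
  -- 2(tB)².
  · have h2 := (hasSum_nat_add_iff' 2).2 hHS
    have hgeo2 := (hasSum_geometric_of_lt_one hx0 (by linarith)).mul_left ((|t| * B) ^ 2)
    have h3 := hasSum_le (fun k => ?_) h2 hgeo2
    · simp only [Finset.sum_range_succ, Finset.sum_range_zero, hF, pow_zero, pow_one,
        Nat.factorial_zero, Nat.factorial_one, Nat.cast_one, div_one, integral_const,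
        probReal_univ, smul_eq_mul, mul_one, zero_add, integral_const_mul] at h3
      have h4 : (|t| * B) ^ 2 * (1 - |t| * B)⁻¹ ≤ (|t| * B) ^ 2 * 2 := by
        gcongr
        rw [inv_le_comm₀ (by linarith) (by norm_num)]
        linarith
      have h5 : (|t| * B) ^ 2 = (t * B) ^ 2 := by rw [mul_pow, sq_abs, mul_pow]
      rw [h5] at h3 h4
      linarith
    · calc ∫ ω, F (k + 2) ω ∂P ≤ ∫ ω, ‖F (k + 2) ω‖ ∂P :=
            integral_mono (hFi _) (hFi _).norm fun ω => Real.le_norm_self _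
        _ ≤ (|t| * B) ^ (k + 2) := hFn _
        _ = _ := by rw [pow_add, mul_comm]

/-- Chernoff bound for an average of independent variables. -/
lemma chernoff_average {n : ℕ} {X : Fin n → Ω → ℝ} (hindep : iIndepFun X P)
    (hm : ∀ i, Measurable (X i)) {t b x : ℝ} (ht : 0 ≤ t)
    (hi : ∀ i, Integrable (fun ω => Real.exp (t * X i ω)) P)
    (hb : ∀ i, ∫ ω, Real.exp (t * X i ω) ∂P ≤ Real.exp b) :
    P.real {ω | n * x ≤ ∑ i, X i ω} ≤ Real.exp (n * (b - t * x)) := by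
  have h1 := hindep.integrable_exp_mul_sum (t := t) (s := Finset.univ) hm (fun i _ => hi i)
  have h2 := measure_ge_le_exp_mul_mgf (n * x) ht h1
  rw [hindep.mgf_sum hm] at h2
  have h3 : ∏ i, mgf (X i) P t ≤ ∏ _i : Fin n, Real.exp b :=
    Finset.prod_le_prod (fun i _ => mgf_nonneg) fun i _ => hb i
  rw [Finset.prod_const, Finset.card_univ, Fintype.card_fin, ← Real.exp_nat_mul] at h3
  have h4 : {ω | n * x ≤ ∑ i, X i ω} = {ω | n * x ≤ (∑ i, X i) ω} := by
    ext ω; simp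
  rw [h4]
  refine h2.trans ((mul_le_mul_of_nonneg_left h3 (Real.exp_nonneg _)).trans (le_of_eq ?_))
  rw [← Real.exp_add]
  congr 1; ring

/-- One-sided Bernstein inequality. -/
lemma bernstein_upper {n : ℕ} (hn : 0 < n) {ξ : Fin n → Ω → ℝ} (hindep : iIndepFun ξ P)
    (hm : ∀ i, Measurable (ξ i)) {B m : ℝ} (hB : 0 < B)
    (hi : ∀ i, ∀ k : ℕ, Integrable (fun ω => |ξ i ω| ^ k) P)
    (hmom : ∀ i, ∀ k : ℕ, ∫ ω, |ξ i ω| ^ k ∂P ≤ B ^ k * k.factorial)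
    (hmean : ∀ i, ∫ ω, ξ i ω ∂P = m) {a : ℝ} (ha : 0 ≤ a) :
    P.real {ω | 12 * B * max a (a ^ 2) ≤ 1 / (n : ℝ) * ∑ i, ξ i ω - m} ≤
      Real.exp (-(3 * n * a ^ 2)) := by
  have hn' : (0 : ℝ) < n := by exact_mod_cast hn
  set M := max a (a ^ 2) with hM
  have hM0 : 0 ≤ M := ha.trans (le_max_left _ _)
  have key : ∀ t : ℝ, 0 ≤ t → t * B ≤ 1 / 2 →
      P.real {ω | 12 * B * M ≤ 1 / (n : ℝ) * ∑ i, ξ i ω - m} ≤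
        Real.exp (n * (2 * (t * B) ^ 2 - t * (12 * B * M))) := by
    intro t ht htB
    have hh : ∀ i, _ := fun i => integral_exp_mul_le (hm i) (hi i) (hmom i) hB.le
      (t := t) (by rwa [abs_of_nonneg ht])
    have h1 := chernoff_average (x := 12 * B * M + m) (b := t * m + 2 * (t * B) ^ 2) hindep hm ht
      (fun i => (hh i).1) (fun i => by
        refine (hh i).2.trans ?_
        rw [hmean i]
        linarith [Real.add_one_le_exp (t * m + 2 * (t * B) ^ 2)])
    have h2 : {ω | 12 * B * M ≤ 1 / (n : ℝ) * ∑ i, ξ i ω - m} =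
        {ω | n * (12 * B * M + m) ≤ ∑ i, ξ i ω} := by
      ext ω
      simp only [Set.mem_ofPred_eq]
      rw [le_sub_iff_add_le, one_div, inv_mul_eq_div, le_div_iff₀ hn', mul_comm]
    rw [h2]
    refine h1.trans (le_of_eq ?_)
    congr 1; ring
  -- Small deviations allow t = 3M/B; larger ones use the largest admissible t = 1/(2B). The scale
  -- max(a, a²) gives the exponent 3na² in both regimes.
  by_cases hc : M ≤ 1 / 6
  · have haM : M = a := by
      rw [hM, max_eq_left]
      have : a ≤ 1 / 6 := (le_max_left _ _).trans hc
      nlinarith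
    refine (key (3 * M / B) (by positivity) ?_).trans ?_
    · rw [div_mul_cancel₀ _ hB.ne']; linarith
    · rw [Real.exp_le_exp]
      have e : 2 * (3 * M / B * B) ^ 2 - 3 * M / B * (12 * B * M) = -(18 * M ^ 2) := by
        field_simp; ring
      rw [e, haM]
      nlinarith [mul_nonneg hn'.le (sq_nonneg a)]
  · refine (key (1 / (2 * B)) (by positivity) ?_).trans ?_
    · apply le_of_eq; field_simp
    · rw [Real.exp_le_exp]
      have e : 2 * (1 / (2 * B) * B) ^ 2 - 1 / (2 * B) * (12 * B * M) = 1 / 2 - 6 * M := by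
        field_simp; ring
      rw [e]
      have : a ^ 2 ≤ M := le_max_right _ _
      have h3 : 1 / 2 - 6 * M ≤ - (3 * a ^ 2) := by linarith
      calc n * (1 / 2 - 6 * M) ≤ n * (-(3 * a ^ 2)) := by gcongr
        _ = _ := by ring

/-- Two-sided Bernstein inequality. -/
lemma bernstein_abs {n : ℕ} (hn : 0 < n) {ξ : Fin n → Ω → ℝ} (hindep : iIndepFun ξ P)
    (hm : ∀ i, Measurable (ξ i)) {B m : ℝ} (hB : 0 < B)
    (hi : ∀ i, ∀ k : ℕ, Integrable (fun ω => |ξ i ω| ^ k) P)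
    (hmom : ∀ i, ∀ k : ℕ, ∫ ω, |ξ i ω| ^ k ∂P ≤ B ^ k * k.factorial)
    (hmean : ∀ i, ∫ ω, ξ i ω ∂P = m) {a : ℝ} (ha : 0 ≤ a) :
    P.real {ω | 12 * B * max a (a ^ 2) ≤ |1 / (n : ℝ) * ∑ i, ξ i ω - m|} ≤
      2 * Real.exp (-(3 * n * a ^ 2)) := by
  have h1 := bernstein_upper hn hindep hm hB hi hmom hmean ha
  have h2 := bernstein_upper (ξ := fun i ω => -ξ i ω) (m := -m) hn
    (hindep.comp (fun _ x => -x) (fun _ => measurable_neg)) (fun i => (hm i).neg) hB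
    (by simpa using hi) (by simpa using hmom) (fun i => by rw [integral_neg, hmean]) ha
  refine (measureReal_mono (fun ω hω => ?_)).trans
    ((measureReal_union_le {ω | 12 * B * max a (a ^ 2) ≤ 1 / (n : ℝ) * ∑ i, ξ i ω - m}
      {ω | 12 * B * max a (a ^ 2) ≤ 1 / (n : ℝ) * ∑ i, -ξ i ω - -m}).trans (by linarith))
  simp only [Set.mem_union, Set.mem_ofPred_eq, Finset.sum_neg_distrib] at hω ⊢
  rcases le_abs.1 hω with h | h
  · exact Or.inl h
  · right; linarith

/-- Lower tail of an average of nonnegative variables. -/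
lemma lower_tail_average {n : ℕ} {X : Fin n → Ω → ℝ} (hindep : iIndepFun X P)
    (hm : ∀ i, Measurable (X i)) (h0 : ∀ i ω, 0 ≤ X i ω) {m V : ℝ} (hm0 : 0 ≤ m) (hV : 0 < V)
    (hi : ∀ i, Integrable (X i) P) (hi2 : ∀ i, Integrable (fun ω => X i ω ^ 2) P)
    (hmean : ∀ i, m ≤ ∫ ω, X i ω ∂P) (hsq : ∀ i, ∫ ω, X i ω ^ 2 ∂P ≤ V) :
    P.real {ω | ∑ i, X i ω ≤ n * (m / 2)} ≤ Real.exp (-(n * (m ^ 2 / (8 * V)))) := by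
  -- The minimiser of t²V/2 - tm/2, the exponent per observation.
  set t := m / (2 * V) with ht
  have ht0 : 0 ≤ t := by positivity
  -- From exp x ≥ 1 + x + x²/2 and (1 + x + x²/2)(1 - x + x²/2) = 1 + x⁴/4.
  have hexp : ∀ x : ℝ, 0 ≤ x → Real.exp (-x) ≤ 1 - x + x ^ 2 / 2 := by
    intro x hx
    have h1 := Real.quadratic_le_exp_of_nonneg hx
    rw [Real.exp_neg, inv_le_comm₀ (Real.exp_pos x) (by nlinarith [sq_nonneg (x - 1)])]
    refine le_trans ?_ h1
    rw [inv_le_iff_one_le_mul₀ (by nlinarith [sq_nonneg (x - 1)])]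
    nlinarith [sq_nonneg (x ^ 2)]
  have hle1 : ∀ i ω, Real.exp (t * -X i ω) ≤ 1 - t * X i ω + t ^ 2 / 2 * X i ω ^ 2 := by
    intro i ω
    have := hexp (t * X i ω) (mul_nonneg ht0 (h0 i ω))
    rw [mul_neg]
    refine this.trans (le_of_eq (by ring))
  have hint : ∀ i, Integrable (fun ω => 1 - t * X i ω + t ^ 2 / 2 * X i ω ^ 2) P := fun i =>
    ((integrable_const 1).sub ((hi i).const_mul t)).add ((hi2 i).const_mul _)
  have hexpi : ∀ i, Integrable (fun ω => Real.exp (t * -X i ω)) P := by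
    intro i
    refine (hint i).mono' ?_ (ae_of_all _ fun ω => ?_)
    · have := hm i
      exact Measurable.aestronglyMeasurable (by fun_prop)
    · rw [Real.norm_of_nonneg (Real.exp_nonneg _)]
      exact hle1 i ω
  have h1 := chernoff_average (X := fun i ω => -X i ω) (x := -(m / 2)) (t := t)
    (b := -(t * m) + t ^ 2 / 2 * V) (hindep.comp (fun _ x => -x) (fun _ => measurable_neg))
    (fun i => (hm i).neg) ht0 hexpi (fun i => by
      refine (integral_mono (hexpi i) (hint i) (hle1 i)).trans ?_
      rw [integral_add (by exact (integrable_const 1).sub ((hi i).const_mul t))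
        ((hi2 i).const_mul _), integral_sub (integrable_const 1) ((hi i).const_mul t),
        integral_const_mul, integral_const_mul]
      simp only [integral_const, probReal_univ, smul_eq_mul, mul_one]
      have e1 : t * m ≤ t * ∫ ω, X i ω ∂P := mul_le_mul_of_nonneg_left (hmean i) ht0
      have e2 : t ^ 2 / 2 * ∫ ω, X i ω ^ 2 ∂P ≤ t ^ 2 / 2 * V :=
        mul_le_mul_of_nonneg_left (hsq i) (by positivity)
      linarith [Real.add_one_le_exp (-(t * m) + t ^ 2 / 2 * V)])
  have h2 : {ω | ∑ i, X i ω ≤ n * (m / 2)} = {ω | n * -(m / 2) ≤ ∑ i, -X i ω} := by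
    ext ω
    simp only [Set.mem_ofPred_eq, Finset.sum_neg_distrib]
    constructor <;> intro h <;> linarith
  rw [h2]
  refine h1.trans (le_of_eq ?_)
  congr 1
  rw [ht]
  field_simp
  ring

/-- Chebyshev's inequality for an average of independent variables. -/
lemma chebyshev_average {n : ℕ} (hn : 0 < n) {ξ : Fin n → Ω → ℝ} (hindep : iIndepFun ξ P)
    (hξ : ∀ i, MemLp (ξ i) 2 P) {m V : ℝ}
    (hmean : ∀ i, ∫ ω, ξ i ω ∂P = m) (hsq : ∀ i, ∫ ω, ξ i ω ^ 2 ∂P ≤ V) {t : ℝ} (ht : 0 < t) :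
    P.real {ω | t ≤ |1 / (n : ℝ) * ∑ i, ξ i ω - m|} ≤ V / (n * t ^ 2) := by
  have hn' : (0 : ℝ) < n := by exact_mod_cast hn
  have hS : MemLp (fun ω => 1 / (n : ℝ) * ∑ i, ξ i ω) 2 P :=
    (memLp_finsetSum _ fun i _ => hξ i).const_mul _
  have hE : ∫ ω, 1 / (n : ℝ) * ∑ i, ξ i ω ∂P = m := by
    rw [integral_const_mul, integral_finsetSum _ fun i _ => (hξ i).integrable one_le_two]
    simp only [hmean, Finset.sum_const, Finset.card_univ, Fintype.card_fin, nsmul_eq_mul]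
    field_simp
  have hvar : Var[fun ω => 1 / (n : ℝ) * ∑ i, ξ i ω; P] ≤ V / n := by
    rw [variance_const_mul]
    have h1 : Var[fun ω => ∑ i, ξ i ω; P] = ∑ i, Var[ξ i; P] := by
      have := IndepFun.variance_sum (s := Finset.univ) (X := ξ) (μ := P) (fun i _ => hξ i)
        (fun i _ j _ hij => hindep.indepFun hij)
      rw [← this]
      congr 1
      ext ω; simp
    have h2 : ∑ i, Var[ξ i; P] ≤ ∑ _i : Fin n, V :=
      Finset.sum_le_sum fun i _ => by
        refine (variance_le_expectation_sq (hξ i).aestronglyMeasurable).trans ?_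
        simpa using hsq i
    rw [h1]
    simp only [Finset.sum_const, Finset.card_univ, Fintype.card_fin, nsmul_eq_mul] at h2
    calc (1 / (n : ℝ)) ^ 2 * ∑ i, Var[ξ i; P] ≤ (1 / (n : ℝ)) ^ 2 * (n * V) := by gcongr
      _ = V / n := by field_simp
  have h1 := meas_ge_le_variance_div_sq hS ht
  rw [hE] at h1
  have h2 : P.real {ω | t ≤ |1 / (n : ℝ) * ∑ i, ξ i ω - m|} ≤
      Var[fun ω => 1 / (n : ℝ) * ∑ i, ξ i ω; P] / t ^ 2 := by
    rw [measureReal_def]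
    refine ENNReal.toReal_le_of_le_ofReal ?_ h1
    exact div_nonneg (variance_nonneg _ _) (sq_nonneg _)
  refine h2.trans ?_
  rw [← div_div]
  gcongr

end Tails

/-! ### The normal distribution function and its quantiles. -/

section NormalQuantile

lemma continuous_cdf_gaussian : Continuous (cdf (gaussianReal 0 1)) := by
  have hna : NullSingletonClass (gaussianReal 0 1) := nullSingletonClass_gaussianReal (by simp)
  rw [continuous_iff_continuousAt]
  intro x
  rw [(monotone_cdf _).continuousAt_iff_leftLim_eq_rightLim, (cdf _).rightLim_eq]
  have h1 := (cdf (gaussianReal 0 1)).measure_singleton x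
  rw [measure_cdf, measure_singleton] at h1
  have h2 := ENNReal.ofReal_eq_zero.1 h1.symm
  exact le_antisymm ((monotone_cdf _).leftLim_le le_rfl) (by linarith)

lemma cdf_gaussian_neg (x : ℝ) :
    cdf (gaussianReal 0 1) (-x) = 1 - cdf (gaussianReal 0 1) x := by
  have hna : NullSingletonClass (gaussianReal 0 1) := nullSingletonClass_gaussianReal (by simp)
  have hmap : (gaussianReal 0 1).map (fun y => -y) = gaussianReal 0 1 := by
    rw [gaussianReal_map_neg, neg_zero]
  rw [cdf_eq_real, cdf_eq_real]
  have h1 : (gaussianReal 0 1).real (Set.Iic (-x)) = (gaussianReal 0 1).real (Set.Ici x) := by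
    conv_lhs => rw [← hmap]
    rw [map_measureReal_apply measurable_neg measurableSet_Iic]
    congr 1
    ext y; simp
  have h2 : (gaussianReal 0 1).real (Set.Ici x) = (gaussianReal 0 1).real (Set.Ioi x) :=
    measureReal_congr Ioi_ae_eq_Ici.symm
  rw [h1, h2, ← Set.compl_Iic, probReal_compl_eq_one_sub measurableSet_Iic]

lemma gaussian_real_Icc {x : ℝ} (hx : 0 ≤ x) :
    (gaussianReal 0 1).real (Set.Icc (-x) x) = 2 * cdf (gaussianReal 0 1) x - 1 := by
  have hna : NullSingletonClass (gaussianReal 0 1) := nullSingletonClass_gaussianReal (by simp)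
  have h1 : (gaussianReal 0 1).real (Set.Icc (-x) x) =
      (gaussianReal 0 1).real (Set.Ioc (-x) x) := measureReal_congr Ioc_ae_eq_Icc.symm
  have h2 : Set.Ioc (-x) x = Set.Iic x \ Set.Iic (-x) := by
    ext y; simp [and_comm]
  rw [h1, h2, measureReal_sdiff (Set.Iic_subset_Iic.2 (by linarith)) measurableSet_Iic,
    ← cdf_eq_real, ← cdf_eq_real, cdf_gaussian_neg]
  ring

/-- The infimum is attained because the set is closed. To its left the distribution function is
below q, and continuity passes this to the limit. -/
lemma cdf_stdNormalQuantile {q : ℝ} (h0 : 0 < q) (h1 : q < 1) :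
    cdf (gaussianReal 0 1) (stdNormalQuantile q) = q := by
  set S : Set ℝ := {x : ℝ | q ≤ cdf (gaussianReal 0 1) x} with hS
  have hne : S.Nonempty := by
    obtain ⟨x, hx⟩ := ((tendsto_cdf_atTop (gaussianReal 0 1)).eventually (lt_mem_nhds h1)).exists
    exact ⟨x, hx.le⟩
  have hbdd : BddBelow S := by
    obtain ⟨x, hx⟩ := ((tendsto_cdf_atBot (gaussianReal 0 1)).eventually (gt_mem_nhds h0)).exists
    refine ⟨x, fun y hy => ?_⟩
    by_contra! hlt
    exact absurd (hx.trans_le hy) (not_lt.2 (monotone_cdf _ hlt.le))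
  have hcl : IsClosed S := isClosed_le continuous_const continuous_cdf_gaussian
  have hmem : sInf S ∈ S := hcl.csInf_mem hne hbdd
  refine le_antisymm ?_ hmem
  have hlim : Tendsto (cdf (gaussianReal 0 1)) (𝓝[<] (sInf S))
      (𝓝 (cdf (gaussianReal 0 1) (sInf S))) :=
    (continuous_cdf_gaussian.tendsto _).mono_left nhdsWithin_le_nhds
  refine le_of_tendsto hlim ?_
  filter_upwards [self_mem_nhdsWithin] with y hy
  by_contra! hlt
  exact absurd (csInf_le hbdd (show y ∈ S from hlt.le)) (not_le.2 hy)

lemma cdf_gaussian_zero : cdf (gaussianReal 0 1) 0 = 1 / 2 := by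
  have := cdf_gaussian_neg 0
  rw [neg_zero] at this
  linarith

lemma stdNormalQuantile_pos {q : ℝ} (h0 : 1 / 2 < q) (h1 : q < 1) : 0 < stdNormalQuantile q := by
  by_contra! hle
  have h2 := monotone_cdf (gaussianReal 0 1) hle
  rw [cdf_stdNormalQuantile (by linarith) h1, cdf_gaussian_zero] at h2
  linarith

end NormalQuantile

/-! ### Central limit theorem for triangular arrays. -/

section CLT

/-- For |x| ≤ 1 this is the remainder of the exponential series; for |x| > 1 the trivial bound 2 +
|x| + x²/2 is below 4|x|³. -/
lemma norm_cexp_taylor_le (x : ℝ) :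
    ‖Complex.exp (x * Complex.I) - (1 + x * Complex.I - (x : ℂ) ^ 2 / 2)‖ ≤ 4 * |x| ^ 3 := by
  rcases le_or_gt |x| 1 with h | h
  · have hn : ‖(x : ℂ) * Complex.I‖ = |x| := by simp
    have h1 := Complex.exp_bound (x := (x : ℂ) * Complex.I) (by rw [hn]; exact h)
      (n := 3) (by norm_num)
    rw [hn] at h1
    have h2 : ∑ m ∈ Finset.range 3, ((x : ℂ) * Complex.I) ^ m / m.factorial =
        1 + x * Complex.I - (x : ℂ) ^ 2 / 2 := by
      simp [Finset.sum_range_succ, Nat.factorial, mul_pow]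
      ring
    rw [h2] at h1
    refine h1.trans ?_
    rw [mul_comm]
    refine mul_le_mul_of_nonneg_right ?_ (by positivity)
    norm_num [Nat.factorial]
  · have h1 : ‖Complex.exp (x * Complex.I) - (1 + x * Complex.I - (x : ℂ) ^ 2 / 2)‖ ≤
        1 + (1 + |x| + |x| ^ 2 / 2) := by
      refine (norm_sub_le _ _).trans ?_
      rw [Complex.norm_exp_ofReal_mul_I]
      gcongr
      refine (norm_sub_le _ _).trans ?_
      refine add_le_add ((norm_add_le _ _).trans ?_) ?_
      · simp
      · simp
    refine h1.trans ?_
    nlinarith [sq_nonneg (|x| - 1), mul_pos (by linarith : (0:ℝ) < |x| - 1) (by linarith : (0:ℝ) < |x|),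
      mul_pos (by positivity : (0:ℝ) < |x| ^ 2) (by linarith : (0:ℝ) < |x| - 1)]

/-- Second order expansion of the characteristic function with an explicit remainder. -/
lemma norm_charFun_taylor_le {Ω : Type*} [MeasurableSpace Ω] {P : Measure Ω}
    [IsProbabilityMeasure P] {ξ : Ω → ℝ} (hm : Measurable ξ) {V : ℝ}
    (hi4 : Integrable (fun ω => ξ ω ^ 4) P) (h0 : ∫ ω, ξ ω ∂P = 0) (h2 : ∫ ω, ξ ω ^ 2 ∂P = 1)
    (h4 : ∫ ω, ξ ω ^ 4 ∂P ≤ V) (s : ℝ) :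
    ‖charFun (P.map ξ) s - (1 - (s : ℂ) ^ 2 / 2)‖ ≤ 4 * |s| ^ 3 * (1 + V) := by
  have hb : ∀ x : ℝ, |x| ≤ 1 + x ^ 4 ∧ x ^ 2 ≤ 1 + x ^ 4 ∧ |x| ^ 3 ≤ 1 + x ^ 4 := by
    intro x
    have e : x ^ 4 = |x| ^ 4 := by rw [← abs_pow, abs_of_nonneg (by positivity)]
    have e2 : x ^ 2 = |x| ^ 2 := (sq_abs x).symm
    rw [e, e2]
    have hx := abs_nonneg x
    generalize |x| = y at hx
    rcases le_total y 1 with h | h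
    · have : y ^ 2 ≤ 1 := pow_le_one₀ hx h
      have : y ^ 3 ≤ 1 := pow_le_one₀ hx h
      have : 0 ≤ y ^ 4 := by positivity
      refine ⟨by linarith, by linarith, by linarith⟩
    · have h1 : y ^ 1 ≤ y ^ 4 := pow_le_pow_right₀ h (by norm_num)
      have h2 : y ^ 2 ≤ y ^ 4 := pow_le_pow_right₀ h (by norm_num)
      have h3 : y ^ 3 ≤ y ^ 4 := pow_le_pow_right₀ h (by norm_num)
      rw [pow_one] at h1
      refine ⟨by linarith, by linarith, by linarith⟩
  have hdom : Integrable (fun ω => 1 + ξ ω ^ 4) P := (integrable_const 1).add hi4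
  have hi1 : Integrable ξ P := hdom.mono' hm.aestronglyMeasurable
    (ae_of_all _ fun ω => (hb _).1)
  have hi2 : Integrable (fun ω => ξ ω ^ 2) P := hdom.mono' (hm.pow_const 2).aestronglyMeasurable
    (ae_of_all _ fun ω => by
      rw [Real.norm_of_nonneg (by positivity)]; exact (hb _).2.1)
  have hi3 : Integrable (fun ω => |ξ ω| ^ 3) P := by
    have hm3 : Measurable fun ω => |ξ ω| ^ 3 := (continuous_abs.measurable.comp hm).pow_const 3
    refine hdom.mono' hm3.aestronglyMeasurable (ae_of_all _ fun ω => ?_)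
    rw [Real.norm_of_nonneg (by positivity)]; exact (hb _).2.2
  have hcf : charFun (P.map ξ) s = ∫ ω, Complex.exp ((s * ξ ω : ℝ) * Complex.I) ∂P := by
    rw [charFun_apply_real, integral_map hm.aemeasurable
      (Measurable.aestronglyMeasurable (by fun_prop))]
    push_cast
    rfl
  have hexpi : Integrable (fun ω => Complex.exp ((s * ξ ω : ℝ) * Complex.I)) P := by
    refine Integrable.of_bound (Measurable.aestronglyMeasurable (by fun_prop)) 1
      (ae_of_all _ fun ω => ?_)
    rw [Complex.norm_exp_ofReal_mul_I]
  have hi1c : Integrable (fun ω => ((s * ξ ω : ℝ) : ℂ) * Complex.I) P :=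
    ((hi1.const_mul s).ofReal).mul_const _
  have hi2c : Integrable (fun ω => ((s * ξ ω : ℝ) : ℂ) ^ 2 / 2) P := by
    have : Integrable (fun ω => (((s * ξ ω) ^ 2 / 2 : ℝ) : ℂ)) P := by
      refine Integrable.ofReal ?_
      simp_rw [mul_pow]
      exact (hi2.const_mul _).div_const 2
    simpa using this
  have hpoly : ∫ ω, (1 + ((s * ξ ω : ℝ) : ℂ) * Complex.I - ((s * ξ ω : ℝ) : ℂ) ^ 2 / 2) ∂P =
      1 - (s : ℂ) ^ 2 / 2 := by
    rw [integral_sub (by exact (integrable_const 1).add hi1c) hi2c,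
      integral_add (integrable_const 1) hi1c, integral_mul_const, integral_div]
    have e1 : ∫ ω, ((s * ξ ω : ℝ) : ℂ) ∂P = 0 := by
      rw [integral_complex_ofReal, integral_const_mul, h0]; simp
    have e2 : ∫ ω, ((s * ξ ω : ℝ) : ℂ) ^ 2 ∂P = (s : ℂ) ^ 2 := by
      have : ∀ ω, ((s * ξ ω : ℝ) : ℂ) ^ 2 = ((s ^ 2 * ξ ω ^ 2 : ℝ) : ℂ) := fun ω => by
        push_cast; ring
      simp_rw [this]
      rw [integral_complex_ofReal, integral_const_mul, h2]; simp
    rw [e1, e2]; simp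
  rw [hcf, ← hpoly, ← integral_sub hexpi (by exact ((integrable_const 1).add hi1c).sub hi2c)]
  refine (norm_integral_le_integral_norm _).trans ?_
  calc ∫ ω, ‖Complex.exp ((s * ξ ω : ℝ) * Complex.I) -
        (1 + ((s * ξ ω : ℝ) : ℂ) * Complex.I - ((s * ξ ω : ℝ) : ℂ) ^ 2 / 2)‖ ∂P
      ≤ ∫ ω, 4 * |s| ^ 3 * (1 + ξ ω ^ 4) ∂P := by
        refine integral_mono
          ((hexpi.sub (((integrable_const 1).add hi1c).sub hi2c)).norm) (hdom.const_mul _)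
          fun ω => ?_
        refine (norm_cexp_taylor_le (s * ξ ω)).trans ?_
        rw [abs_mul, mul_pow, mul_assoc]
        have := (hb (ξ ω)).2.2
        calc 4 * (|s| ^ 3 * |ξ ω| ^ 3) ≤ 4 * (|s| ^ 3 * (1 + ξ ω ^ 4)) := by gcongr
          _ = _ := by ring
    _ ≤ _ := by
        rw [integral_const_mul, integral_add (integrable_const 1) hi4]
        simp only [integral_const, probReal_univ, smul_eq_mul, mul_one]
        gcongr

/-- Central limit theorem for a triangular array with rows of i.i.d. variables with mean zero,
variance one and bounded fourth moment. -/
theorem clt_triangular {Ω : ℕ → Type u} [∀ n, MeasurableSpace (Ω n)] (P : ∀ n, Measure (Ω n))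
    [∀ n, IsProbabilityMeasure (P n)] {ξ : ∀ n, Fin n → Ω n → ℝ}
    (hm : ∀ n i, Measurable (ξ n i)) (hindep : ∀ n, iIndepFun (ξ n) (P n))
    (hident : ∀ n i j, IdentDistrib (ξ n i) (ξ n j) (P n) (P n)) {V : ℝ}
    (hi4 : ∀ n i, Integrable (fun ω => ξ n i ω ^ 4) (P n))
    (h0 : ∀ n i, ∫ ω, ξ n i ω ∂(P n) = 0) (h2 : ∀ n i, ∫ ω, ξ n i ω ^ 2 ∂(P n) = 1)
    (h4 : ∀ n i, ∫ ω, ξ n i ω ^ 4 ∂(P n) ≤ V) {x : ℝ} (hx : 0 ≤ x) :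
    Tendsto (fun n => (P n).real {ω | |(√(n : ℝ))⁻¹ * ∑ i, ξ n i ω| ≤ x}) atTop
      (𝓝 (2 * cdf (gaussianReal 0 1) x - 1)) := by
  have hna : NullSingletonClass (gaussianReal 0 1) := nullSingletonClass_gaussianReal (by simp)
  have hTm : ∀ n : ℕ, Measurable fun ω => (√(n : ℝ))⁻¹ * ∑ i, ξ n i ω := fun n =>
    (Finset.measurable_fun_sum _ fun i _ => hm n i).const_mul _
  have hprob : ∀ n : ℕ, IsProbabilityMeasure ((P n).map fun ω => (√(n : ℝ))⁻¹ * ∑ i, ξ n i ω) :=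
    fun n => Measure.isProbabilityMeasure_map (hTm n).aemeasurable
  set ν : ℕ → ProbabilityMeasure ℝ := fun n => ⟨_, hprob n⟩ with hν
  have hweak : Tendsto ν atTop (𝓝 (⟨gaussianReal 0 1, inferInstance⟩ : ProbabilityMeasure ℝ)) := by
    refine ProbabilityMeasure.tendsto_iff_tendsto_charFun.2 fun t => ?_
    simp only [hν, ProbabilityMeasure.coe_mk]
    -- The common characteristic function of a row at t/√n; row 0 is empty and receives an
    -- irrelevant value.
    set f : ℕ → ℂ := fun n => if h : 0 < n then
      charFun ((P n).map (ξ n ⟨0, h⟩)) ((√(n : ℝ))⁻¹ * t) else 0 with hf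
    have hpow : ∀ n, 0 < n →
        charFun ((P n).map fun ω => (√(n : ℝ))⁻¹ * ∑ i, ξ n i ω) t = f n ^ n := by
      intro n hn
      rw [charFun_map_mul_comp (Finset.measurable_fun_sum _ fun i _ => hm n i).aemeasurable,
        (hindep n).charFun_map_fun_sum_eq_prod fun i => (hm n i).aemeasurable]
      simp only [hf, dif_pos hn, Finset.prod_apply]
      rw [Finset.prod_congr rfl fun i _ => by rw [(hident n i ⟨0, hn⟩).map_eq]]
      simp
    have hlim : Tendsto (fun n => f n ^ n) atTop (𝓝 (Complex.exp (-(t : ℂ) ^ 2 / 2))) := by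
      refine Complex.tendsto_pow_exp_of_isLittleO_sub_add_div _ ?_
      rw [isLittleO_iff]
      intro c hc
      have hev : ∀ᶠ n : ℕ in atTop, 4 * |t| ^ 3 * (1 + V) / c < √(n : ℝ) :=
        (Real.tendsto_sqrt_atTop.comp tendsto_natCast_atTop_atTop).eventually_gt_atTop _
      filter_upwards [hev, eventually_gt_atTop 0] with n hn hn0
      have hn' : (0 : ℝ) < n := by exact_mod_cast hn0
      have hs : 0 < √(n : ℝ) := Real.sqrt_pos.2 hn'
      have hsq : √(n : ℝ) ^ 2 = n := Real.sq_sqrt hn'.le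
      have h1 := norm_charFun_taylor_le (hm n ⟨0, hn0⟩) (hi4 n _) (h0 n _) (h2 n _) (h4 n _)
        ((√(n : ℝ))⁻¹ * t)
      simp only [hf, dif_pos hn0]
      have e1 : (1 : ℂ) - (((√(n : ℝ))⁻¹ * t : ℝ) : ℂ) ^ 2 / 2 = 1 + -(t : ℂ) ^ 2 / 2 / n := by
        have : (((√(n : ℝ))⁻¹ * t : ℝ) : ℂ) ^ 2 = (t : ℂ) ^ 2 / n := by
          rw [← Complex.ofReal_pow, mul_pow, inv_pow, hsq]
          push_cast
          field_simp
        rw [this]; ring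
      rw [e1] at h1
      refine h1.trans ?_
      have e2 : ‖(1 : ℂ) / n‖ = 1 / n := by simp
      rw [e2, abs_mul, abs_of_pos (inv_pos.2 hs), mul_pow]
      rw [div_lt_iff₀ hc] at hn
      -- The third-order remainder is 1/n times a factor of order n^(-1/2), as needed for
      -- convergence of the n-th power.
      have e3 : 4 * ((√(n : ℝ))⁻¹ ^ 3 * |t| ^ 3) * (1 + V) =
          (4 * |t| ^ 3 * (1 + V)) * (√(n : ℝ))⁻¹ * (1 / n) := by
        rw [show (1 : ℝ) / n = (√(n : ℝ))⁻¹ ^ 2 by rw [inv_pow, hsq, one_div]]; ring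
      rw [e3]
      gcongr
      rw [mul_inv_le_iff₀ hs]
      linarith
    have hg : charFun (gaussianReal 0 1) t = Complex.exp (-(t : ℂ) ^ 2 / 2) := by
      rw [charFun_gaussianReal]
      congr 1
      simp
      ring
    rw [hg]
    refine hlim.congr' ?_
    filter_upwards [eventually_gt_atTop 0] with n hn
    exact (hpow n hn).symm
  have hfr : (gaussianReal 0 1) (frontier (Set.Icc (-x) x)) = 0 := by
    rw [frontier_Icc (by linarith)]
    exact Set.Finite.measure_zero (Set.toFinite _) _
  have h5 := ProbabilityMeasure.tendsto_measure_of_null_frontier_of_tendsto' hweak hfr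
  simp only [hν, ProbabilityMeasure.coe_mk] at h5
  have h6 := (ENNReal.tendsto_toReal (measure_ne_top _ _)).comp h5
  have h7 : ((gaussianReal 0 1) (Set.Icc (-x) x)).toReal = 2 * cdf (gaussianReal 0 1) x - 1 :=
    gaussian_real_Icc hx
  rw [h7] at h6
  refine h6.congr fun n => ?_
  simp only [Function.comp_apply]
  rw [Measure.map_apply (hTm n) measurableSet_Icc, measureReal_def]
  congr 2
  ext ω
  exact abs_le.symm

end CLT

/-! ### Studentised sums under small perturbations. -/

section SelfNormalized

/-- The reverse triangle inequality for the Euclidean norm. -/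
lemma abs_sqrt_average_sub_le {n : ℕ} (x y : Fin n → ℝ) :
    |√(1 / (n : ℝ) * ∑ i, x i ^ 2) - √(1 / (n : ℝ) * ∑ i, y i ^ 2)| ≤
      √(1 / (n : ℝ) * ∑ i, (x i - y i) ^ 2) := by
  have h := abs_norm_sub_norm_le (WithLp.toLp 2 x : EuclideanSpace ℝ (Fin n)) (WithLp.toLp 2 y)
  simp only [EuclideanSpace.norm_eq, Real.norm_eq_abs, sq_abs, PiLp.sub_apply] at h
  have h0 : (0 : ℝ) ≤ 1 / n := by positivity
  rw [Real.sqrt_mul h0, Real.sqrt_mul h0, Real.sqrt_mul h0, ← mul_sub, abs_mul,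
    abs_of_nonneg (Real.sqrt_nonneg _)]
  exact mul_le_mul_of_nonneg_left h (Real.sqrt_nonneg _)

/-- Factor |a - σ²| as |√a - σ|(√a + σ) and use √a + σ ≥ σ. -/
lemma abs_sqrt_sub_le {a σ σ0 κ : ℝ} (ha : 0 ≤ a) (hσ0 : 0 < σ0) (hσ : σ0 ≤ σ) (hκ : 0 ≤ κ)
    (h : |a - σ ^ 2| ≤ κ / 2 * σ0 ^ 2) : |√a - σ| ≤ κ / 2 * σ := by
  have hσp : 0 < σ := hσ0.trans_le hσ
  have h1 : |√a - σ| * (√a + σ) = |a - σ ^ 2| := by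
    rw [← abs_of_nonneg (by positivity : 0 ≤ √a + σ), ← abs_mul]
    congr 1
    nlinarith [Real.sq_sqrt ha]
  refine le_of_mul_le_mul_right ?_ hσp
  calc |√a - σ| * σ ≤ |√a - σ| * (√a + σ) := by
        gcongr; linarith [Real.sqrt_nonneg a]
    _ ≤ κ / 2 * σ0 ^ 2 := by rw [h1]; exact h
    _ ≤ κ / 2 * σ ^ 2 := by gcongr
    _ = _ := by ring

/-- Two-sided comparison of a studentised statistic with a normalised one. -/
lemma studentized_sandwich {s x r σ κ z : ℝ} (hσ : 0 < σ) (hκ : 0 < κ) (hκ1 : κ < 1) (hz : 0 < z)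
    (h1 : |s - x| ≤ κ * σ) (h2 : |r - σ| ≤ κ * σ) :
    (|s / r| ≤ z → |x / σ| ≤ z * (1 + κ) + κ) ∧ (|x / σ| ≤ z * (1 - κ) - κ → |s / r| ≤ z) := by
  obtain ⟨h2a, h2b⟩ := abs_le.1 h2
  have hr : 0 < r := by nlinarith
  rw [abs_div, abs_div, abs_of_pos hr, abs_of_pos hσ, div_le_iff₀ hr, div_le_iff₀ hσ,
    div_le_iff₀ hσ]
  have h3 : |x| ≤ |s| + κ * σ := by
    have := abs_sub_abs_le_abs_sub x s
    rw [abs_sub_comm] at this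
    linarith
  have h4 : |s| ≤ |x| + κ * σ := by
    have := abs_sub_abs_le_abs_sub s x
    linarith
  constructor <;> intro h <;> nlinarith

/-- Central limit theorem for studentised sums of perturbed i.i.d. rows. -/
theorem studentized_clt {Ω : ℕ → Type u} [∀ n, MeasurableSpace (Ω n)] (P : ∀ n, Measure (Ω n))
    [∀ n, IsProbabilityMeasure (P n)] {ξ S : ∀ n, Fin n → Ω n → ℝ}
    (hm : ∀ n i, Measurable (ξ n i)) (hindep : ∀ n, iIndepFun (ξ n) (P n))
    (hident : ∀ n i j, IdentDistrib (ξ n i) (ξ n j) (P n) (P n)) {V σ0 : ℝ} {v : ℕ → ℝ}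
    (hσ0 : 0 < σ0) (hi4 : ∀ n i, Integrable (fun ω => ξ n i ω ^ 4) (P n))
    (h0 : ∀ n i, ∫ ω, ξ n i ω ∂(P n) = 0) (h2 : ∀ n i, ∫ ω, ξ n i ω ^ 2 ∂(P n) = v n)
    (hv : ∀ n, σ0 ^ 2 ≤ v n) (h4 : ∀ n i, ∫ ω, ξ n i ω ^ 4 ∂(P n) ≤ V)
    (hΔ : ∀ κ > 0, Tendsto (fun n => (P n).real
      {ω | κ < |1 / √(n : ℝ) * ∑ i, S n i ω - 1 / √(n : ℝ) * ∑ i, ξ n i ω|}) atTop (𝓝 0))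
    (hE : ∀ κ > 0, Tendsto (fun n => (P n).real
      {ω | κ < 1 / (n : ℝ) * ∑ i, (S n i ω - ξ n i ω) ^ 2}) atTop (𝓝 0)) {z : ℝ} (hz : 0 < z) :
    Tendsto (fun n => (P n).real {ω | |(1 / √(n : ℝ) * ∑ i, S n i ω) /
      √(1 / (n : ℝ) * ∑ i, S n i ω ^ 2)| ≤ z}) atTop (𝓝 (2 * cdf (gaussianReal 0 1) z - 1)) := by
  have hσv : ∀ n, σ0 ≤ √(v n) := fun n => Real.le_sqrt_of_sq_le (hv n)
  have hσp : ∀ n, 0 < √(v n) := fun n => hσ0.trans_le (hσv n)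
  have hvp : ∀ n, 0 < v n := fun n => (by positivity : (0:ℝ) < σ0 ^ 2).trans_le (hv n)
  have hvs : ∀ n, √(v n) ^ 2 = v n := fun n => Real.sq_sqrt (hvp n).le
  have hV : 0 ≤ V := (integral_nonneg fun ω => by positivity).trans (h4 1 0)
  set F : ℝ → ℝ := fun x => 2 * cdf (gaussianReal 0 1) x - 1 with hF
  have hFc : Continuous F := (continuous_const.mul continuous_cdf_gaussian).sub continuous_const
  have hclt : ∀ x : ℝ, 0 ≤ x → Tendsto (fun n => (P n).real
      {ω | |(1 / √(n : ℝ) * ∑ i, ξ n i ω) / √(v n)| ≤ x}) atTop (𝓝 (F x)) := by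
    intro x hx
    -- The variances `v n` need not converge, so each row is normalised separately; the lower bound
    -- σ0 keeps the fourth moments bounded.
    have h := clt_triangular P (ξ := fun n i ω => ξ n i ω / √(v n)) (V := V / σ0 ^ 4)
      (fun n i => (hm n i).div_const _)
      (fun n => (hindep n).comp (fun _ y => y / √(v n)) fun _ => measurable_id.div_const _)
      (fun n i j => (hident n i j).comp (u := fun y => y / √(v n)) (measurable_id.div_const _))
      (fun n i => by simp_rw [div_pow]; exact (hi4 n i).div_const _)
      (fun n i => by rw [integral_div, h0, zero_div])
      (fun n i => by simp_rw [div_pow, hvs]; rw [integral_div, h2, div_self (hvp n).ne'])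
      (fun n i => by
        simp_rw [div_pow]
        rw [integral_div]
        have := hσv n
        gcongr
        exact h4 n i) hx
    refine h.congr fun n => ?_
    congr 1
    ext ω
    rw [Set.mem_ofPred_eq, ← Finset.sum_div, ← mul_div_assoc, ← one_div, Set.mem_ofPred_eq]
  have hvar : ∀ κ > 0, Tendsto (fun n => (P n).real
      {ω | κ ≤ |1 / (n : ℝ) * ∑ i, ξ n i ω ^ 2 - v n|}) atTop (𝓝 0) := by
    intro κ hκ
    have hlim : Tendsto (fun n : ℕ => V / (n * κ ^ 2)) atTop (𝓝 0) :=
      Tendsto.div_atTop tendsto_const_nhds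
        (Tendsto.atTop_mul_const (by positivity) tendsto_natCast_atTop_atTop)
    refine squeeze_zero' (Eventually.of_forall fun n => measureReal_nonneg) ?_ hlim
    filter_upwards [eventually_gt_atTop 0] with n hn
    have e : ∀ i ω, (ξ n i ω ^ 2) ^ 2 = ξ n i ω ^ 4 := fun i ω => by ring
    refine chebyshev_average hn (ξ := fun i ω => ξ n i ω ^ 2)
      ((hindep n).comp (fun _ y => y ^ 2) fun _ => measurable_id.pow_const 2) (fun i => ?_)
      (h2 n) (fun i => ?_) hκ
    · rw [memLp_two_iff_integrable_sq ((hm n i).pow_const 2).aestronglyMeasurable]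
      simp_rw [e]
      exact hi4 n i
    · simp_rw [e]
      exact h4 n i
  rw [Metric.tendsto_atTop']
  intro ε hε
  have hup : Tendsto (fun κ : ℝ => F (z * (1 + κ) + κ)) (𝓝[>] 0) (𝓝 (F z)) := by
    have : ContinuousAt (fun κ : ℝ => F (z * (1 + κ) + κ)) 0 := by fun_prop
    have h := this.tendsto.mono_left (nhdsWithin_le_nhds (s := Set.Ioi 0))
    simpa using h
  have hdn : Tendsto (fun κ : ℝ => F (z * (1 - κ) - κ)) (𝓝[>] 0) (𝓝 (F z)) := by
    have : ContinuousAt (fun κ : ℝ => F (z * (1 - κ) - κ)) 0 := by fun_prop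
    have h := this.tendsto.mono_left (nhdsWithin_le_nhds (s := Set.Ioi 0))
    simpa using h
  have hpos : Tendsto (fun κ : ℝ => z * (1 - κ) - κ) (𝓝[>] 0) (𝓝 z) := by
    have : ContinuousAt (fun κ : ℝ => z * (1 - κ) - κ) 0 := by fun_prop
    have h := this.tendsto.mono_left (nhdsWithin_le_nhds (s := Set.Ioi 0))
    simpa using h
  -- κ is fixed before n, so that both shifted thresholds of `studentized_sandwich` have limiting
  -- probabilities within ε/2 of the target; the bad events use the other ε/2.
  obtain ⟨κ, hκu, hκd, hκp, hκ0, hκ1⟩ := ((hup.eventually (gt_mem_nhds (show F z < F z + ε / 2 by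
    linarith))).and ((hdn.eventually (lt_mem_nhds (show F z - ε / 2 < F z by linarith))).and
    ((hpos.eventually (lt_mem_nhds hz)).and
    ((eventually_mem_nhdsWithin (a := (0 : ℝ)) (s := Set.Ioi 0)).and
      (Ioo_mem_nhdsGT (show (0 : ℝ) < 1 by norm_num)))))).exists
  have hκ0' : (0 : ℝ) < κ := hκ0
  have hu := hclt (z * (1 + κ) + κ) (by positivity)
  have hd := hclt (z * (1 - κ) - κ) hκp.le
  have hb1 := hΔ (κ * σ0) (by positivity)
  have hb2 := hE ((κ / 2 * σ0) ^ 2) (by positivity)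
  have hb3 := hvar (κ / 2 * σ0 ^ 2) (by positivity)
  have hb : Tendsto (fun n => (P n).real
      {ω | κ * σ0 < |1 / √(n : ℝ) * ∑ i, S n i ω - 1 / √(n : ℝ) * ∑ i, ξ n i ω|} + (P n).real
      {ω | (κ / 2 * σ0) ^ 2 < 1 / (n : ℝ) * ∑ i, (S n i ω - ξ n i ω) ^ 2} + (P n).real
      {ω | κ / 2 * σ0 ^ 2 ≤ |1 / (n : ℝ) * ∑ i, ξ n i ω ^ 2 - v n|}) atTop (𝓝 0) := by
    simpa using (hb1.add hb2).add hb3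
  have hev := (hu.eventually (gt_mem_nhds hκu)).and ((hd.eventually (lt_mem_nhds hκd)).and
    (hb.eventually (gt_mem_nhds (show (0 : ℝ) < ε / 2 by linarith))))
  obtain ⟨N, hN⟩ := eventually_atTop.1 hev
  refine ⟨N, fun n hn => ?_⟩
  obtain ⟨hn1, hn2, hn3⟩ := hN n hn.le
  set b1 := {ω | κ * σ0 < |1 / √(n : ℝ) * ∑ i, S n i ω - 1 / √(n : ℝ) * ∑ i, ξ n i ω|}
  set b2 := {ω | (κ / 2 * σ0) ^ 2 < 1 / (n : ℝ) * ∑ i, (S n i ω - ξ n i ω) ^ 2}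
  set b3 := {ω | κ / 2 * σ0 ^ 2 ≤ |1 / (n : ℝ) * ∑ i, ξ n i ω ^ 2 - v n|}
  have hgood : ∀ ω, ω ∉ b1 ∪ b2 ∪ b3 → _ := fun ω hω => by
    have hω' : ω ∉ b1 ∧ ω ∉ b2 ∧ ω ∉ b3 := by simpa [and_assoc] using hω
    obtain ⟨hω1, hω2, hω3⟩ := hω'
    have g1 : |1 / √(n : ℝ) * ∑ i, S n i ω - 1 / √(n : ℝ) * ∑ i, ξ n i ω| ≤ κ * σ0 :=
      not_lt.1 fun h => hω1 h
    have g2 : 1 / (n : ℝ) * ∑ i, (S n i ω - ξ n i ω) ^ 2 ≤ (κ / 2 * σ0) ^ 2 :=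
      not_lt.1 fun h => hω2 h
    have g3 : |1 / (n : ℝ) * ∑ i, ξ n i ω ^ 2 - v n| ≤ κ / 2 * σ0 ^ 2 :=
      (not_le.1 fun h => hω3 h).le
    have g4 := abs_sqrt_average_sub_le (fun i => S n i ω) (fun i => ξ n i ω)
    have g5 : √(1 / (n : ℝ) * ∑ i, (S n i ω - ξ n i ω) ^ 2) ≤ κ / 2 * σ0 :=
      Real.sqrt_le_iff.2 ⟨by positivity, g2⟩
    rw [← hvs n] at g3
    have g6 := abs_sqrt_sub_le (by positivity) hσ0 (hσv n) hκ0'.le g3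
    refine studentized_sandwich (hσp n) hκ0' hκ1.2 hz
      (g1.trans (mul_le_mul_of_nonneg_left (hσv n) hκ0'.le))
      (r := √(1 / (n : ℝ) * ∑ i, S n i ω ^ 2)) ?_
    refine (abs_sub_le _ (√(1 / (n : ℝ) * ∑ i, ξ n i ω ^ 2)) _).trans ?_
    have g7 : κ / 2 * σ0 ≤ κ / 2 * √(v n) := mul_le_mul_of_nonneg_left (hσv n) (by positivity)
    linarith
  have hbb : (P n).real (b1 ∪ b2 ∪ b3) ≤ (P n).real b1 + (P n).real b2 + (P n).real b3 :=
    (measureReal_union_le _ _).trans (by gcongr; exact measureReal_union_le _ _)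
  rw [Real.dist_eq, abs_lt]
  constructor
  · have : (P n).real {ω | |(1 / √(n : ℝ) * ∑ i, ξ n i ω) / √(v n)| ≤ z * (1 - κ) - κ} ≤
        (P n).real {ω | |(1 / √(n : ℝ) * ∑ i, S n i ω) / √(1 / (n : ℝ) * ∑ i, S n i ω ^ 2)| ≤ z} +
          (P n).real (b1 ∪ b2 ∪ b3) := by
      refine (measureReal_mono fun ω hω => ?_).trans (measureReal_union_le _ _)
      by_cases hb : ω ∈ b1 ∪ b2 ∪ b3
      · exact Or.inr hb
      · exact Or.inl ((hgood ω hb).2 hω)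
    linarith
  · have : (P n).real
        {ω | |(1 / √(n : ℝ) * ∑ i, S n i ω) / √(1 / (n : ℝ) * ∑ i, S n i ω ^ 2)| ≤ z} ≤
        (P n).real {ω | |(1 / √(n : ℝ) * ∑ i, ξ n i ω) / √(v n)| ≤ z * (1 + κ) + κ} +
          (P n).real (b1 ∪ b2 ∪ b3) := by
      refine (measureReal_mono fun ω hω => ?_).trans (measureReal_union_le _ _)
      by_cases hb : ω ∈ b1 ∪ b2 ∪ b3
      · exact Or.inr hb
      · exact Or.inl ((hgood ω hb).1 hω)
    linarith

end SelfNormalized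

/-! ### Concentration of Gram matrices and correlations. -/

/-- An i.i.d. sample of covariates `Z` and residuals `r` that are uncorrelated with `Z`, with
sub-Gaussian norms at most `K` and second moment matrix of `Z` bounded below by `c`. -/
structure RegressionSample {n p : ℕ} {Ω : Type*} [MeasurableSpace Ω] (P : Measure Ω)
    (Z : Fin n → Ω → Fin p → ℝ) (r : Fin n → Ω → ℝ) (K c : ℝ) : Prop where
  measurable_Z : ∀ i, Measurable (Z i)
  measurable_r : ∀ i, Measurable (r i)
  indep : iIndepFun (fun i ω => (Z i ω, r i ω)) P
  ident : ∀ i j, IdentDistrib (fun ω => (Z i ω, r i ω)) (fun ω => (Z j ω, r j ω)) P P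
  one_le : 1 ≤ K
  c_pos : 0 < c
  psi_Z : ∀ i j, psi2Norm P (fun ω => Z i ω j) ≤ ENNReal.ofReal K
  psi_r : ∀ i, psi2Norm P (r i) ≤ ENNReal.ofReal K
  orth : ∀ i j, ∫ ω, Z i ω j * r i ω ∂P = 0
  coercive : ∀ i, ∀ v : Fin p → ℝ, c * ∑ j, v j ^ 2 ≤ ∫ ω, (Z i ω ⬝ᵥ v) ^ 2 ∂P

lemma measureReal_exists_le {Ω ι : Type*} [MeasurableSpace Ω] (P : Measure Ω)
    [IsProbabilityMeasure P] [Fintype ι] (A : ι → Ω → Prop) {b : ℝ}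
    (h : ∀ i, P.real {ω | A i ω} ≤ b) : P.real {ω | ∃ i, A i ω} ≤ Fintype.card ι * b := by
  have h1 : {ω | ∃ i, A i ω} = ⋃ i, {ω | A i ω} := by ext ω; simp
  rw [h1]
  refine (measureReal_iUnion_fintype_le _).trans ((Finset.sum_le_sum fun i _ => h i).trans ?_)
  simp

namespace RegressionSample

variable {n p : ℕ} {Ω : Type*} [MeasurableSpace Ω] {P : Measure Ω}
  {Z : Fin n → Ω → Fin p → ℝ} {r : Fin n → Ω → ℝ} {K c : ℝ}

lemma measurable_Zj (S : RegressionSample P Z r K c) (i : Fin n) (j : Fin p) :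
    Measurable fun ω => Z i ω j := (measurable_pi_apply j).comp (S.measurable_Z i)

lemma K_nonneg (S : RegressionSample P Z r K c) : 0 ≤ K := zero_le_one.trans S.one_le

lemma B_pos (S : RegressionSample P Z r K c) : 0 < 6 * K ^ 2 := by
  have := S.one_le
  positivity

lemma integral_ZZ_eq (S : RegressionSample P Z r K c) (i i' : Fin n) (j k : Fin p) :
    ∫ ω, Z i ω j * Z i ω k ∂P = ∫ ω, Z i' ω j * Z i' ω k ∂P :=
  ((S.ident i i').comp (u := fun x : (Fin p → ℝ) × ℝ => x.1 j * x.1 k) (by fun_prop)).integral_eq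

variable [IsProbabilityMeasure P]

lemma integrable_ZZ (S : RegressionSample P Z r K c) (i : Fin n) (j k : Fin p) :
    Integrable (fun ω => Z i ω j * Z i ω k) P := by
  have h := (product_moment_of_psi2 (S.measurable_Zj i j).aestronglyMeasurable
    (S.measurable_Zj i k).aestronglyMeasurable S.K_nonneg (S.psi_Z i j) (S.psi_Z i k) 1).1
  simp only [pow_one] at h
  exact (integrable_norm_iff ((S.measurable_Zj i j).mul
    (S.measurable_Zj i k)).aestronglyMeasurable).1 h

lemma integral_quad (S : RegressionSample P Z r K c) (i : Fin n) (v : Fin p → ℝ) :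
    ∫ ω, (Z i ω ⬝ᵥ v) ^ 2 ∂P = ∑ j, ∑ k, (∫ ω, Z i ω j * Z i ω k ∂P) * (v j * v k) := by
  have : ∀ ω, (Z i ω ⬝ᵥ v) ^ 2 = ∑ j, ∑ k, Z i ω j * Z i ω k * (v j * v k) := by
    intro ω
    rw [sq, dotProduct, Finset.sum_mul_sum]
    refine Finset.sum_congr rfl fun j _ => Finset.sum_congr rfl fun k _ => by ring
  simp_rw [this]
  rw [integral_finsetSum _ fun j _ => integrable_finsetSum _ fun k _ =>
    (S.integrable_ZZ i j k).mul_const _]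
  refine Finset.sum_congr rfl fun j _ => ?_
  rw [integral_finsetSum _ fun k _ => (S.integrable_ZZ i j k).mul_const _]
  refine Finset.sum_congr rfl fun k _ => ?_
  rw [integral_mul_const]

lemma integral_Z_sq_le (S : RegressionSample P Z r K c) (i : Fin n) (j : Fin p) :
    ∫ ω, Z i ω j * Z i ω j ∂P ≤ 2 * K ^ 2 := by
  have h := integral_even_pow_le_of_psi2 (S.measurable_Zj i j).aestronglyMeasurable S.K_nonneg
    (S.psi_Z i j) 1
  simp only [mul_one, pow_one, Nat.cast_one] at h
  simpa [sq] using h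

lemma integral_r_sq_le (S : RegressionSample P Z r K c) (i : Fin n) :
    ∫ ω, r i ω ^ 2 ∂P ≤ 2 * K ^ 2 := by
  simpa using integral_even_pow_le_of_psi2 (S.measurable_r i).aestronglyMeasurable S.K_nonneg
    (S.psi_r i) 1

lemma integral_r_four_le (S : RegressionSample P Z r K c) (i : Fin n) :
    ∫ ω, r i ω ^ 4 ∂P ≤ 16 * K ^ 4 := by
  have h := integral_even_pow_le_of_psi2 (S.measurable_r i).aestronglyMeasurable S.K_nonneg
    (S.psi_r i) 2
  norm_num at h
  linarith [h, (by ring : (2 * K ^ 2) ^ 2 * 4 = 16 * K ^ 4)]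

/-- Deviation of the empirical second moment matrix and correlations: exponential tails. -/
lemma bernstein_gram (S : RegressionSample P Z r K c) (hn : 0 < n) (i0 : Fin n) (j k : Fin p)
    {a : ℝ} (ha : 0 ≤ a) :
    P.real {ω | 12 * (6 * K ^ 2) * max a (a ^ 2) ≤
      |empGram (fun i => Z i ω) j k - ∫ ω, Z i0 ω j * Z i0 ω k ∂P|} ≤
      2 * Real.exp (-(3 * n * a ^ 2)) :=
  bernstein_abs hn (ξ := fun i ω => Z i ω j * Z i ω k)
    (S.indep.comp (fun _ x => x.1 j * x.1 k) (fun _ => by fun_prop))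
    (fun i => (S.measurable_Zj i j).mul (S.measurable_Zj i k)) S.B_pos
    (fun i l => (product_moment_of_psi2 (S.measurable_Zj i j).aestronglyMeasurable
      (S.measurable_Zj i k).aestronglyMeasurable S.K_nonneg (S.psi_Z i j) (S.psi_Z i k) l).1)
    (fun i l => (product_moment_of_psi2 (S.measurable_Zj i j).aestronglyMeasurable
      (S.measurable_Zj i k).aestronglyMeasurable S.K_nonneg (S.psi_Z i j) (S.psi_Z i k) l).2)
    (fun i => S.integral_ZZ_eq i i0 j k) ha

lemma bernstein_grad (S : RegressionSample P Z r K c) (hn : 0 < n) (j : Fin p)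
    {a : ℝ} (ha : 0 ≤ a) :
    P.real {ω | 12 * (6 * K ^ 2) * max a (a ^ 2) ≤
      |empGrad (fun i => Z i ω) (fun i => r i ω) j|} ≤
      2 * Real.exp (-(3 * n * a ^ 2)) := by
  have h := bernstein_abs hn (ξ := fun i ω => Z i ω j * r i ω) (P := P) (m := 0)
    (S.indep.comp (fun _ x => x.1 j * x.2) (fun _ => by fun_prop))
    (fun i => (S.measurable_Zj i j).mul (S.measurable_r i)) S.B_pos
    (fun i l => (product_moment_of_psi2 (S.measurable_Zj i j).aestronglyMeasurable
      (S.measurable_r i).aestronglyMeasurable S.K_nonneg (S.psi_Z i j) (S.psi_r i) l).1)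
    (fun i l => (product_moment_of_psi2 (S.measurable_Zj i j).aestronglyMeasurable
      (S.measurable_r i).aestronglyMeasurable S.K_nonneg (S.psi_Z i j) (S.psi_r i) l).2)
    (fun i => S.orth i j) ha
  simp only [sub_zero] at h
  exact h

lemma product_memLp_two {X Y : Ω → ℝ} (hX : Measurable X) (hY : Measurable Y) (hK : 0 ≤ K)
    (h : psi2Norm P X ≤ ENNReal.ofReal K) (h' : psi2Norm P Y ≤ ENNReal.ofReal K) :
    MemLp (fun ω => X ω * Y ω) 2 P ∧ ∫ ω, (X ω * Y ω) ^ 2 ∂P ≤ 2 * (6 * K ^ 2) ^ 2 := by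
  obtain ⟨h1, h2⟩ := product_moment_of_psi2 hX.aestronglyMeasurable hY.aestronglyMeasurable hK
    h h' 2
  simp only [sq_abs] at h1 h2
  refine ⟨(memLp_two_iff_integrable_sq (hX.mul hY).aestronglyMeasurable).2 h1, ?_⟩
  refine h2.trans (le_of_eq ?_)
  norm_num [Nat.factorial]
  ring

lemma chebyshev_gram (S : RegressionSample P Z r K c) (hn : 0 < n) (i0 : Fin n) (j k : Fin p)
    {t : ℝ} (ht : 0 < t) :
    P.real {ω | t ≤ |empGram (fun i => Z i ω) j k - ∫ ω, Z i0 ω j * Z i0 ω k ∂P|} ≤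
      2 * (6 * K ^ 2) ^ 2 / (n * t ^ 2) :=
  chebyshev_average hn (ξ := fun i ω => Z i ω j * Z i ω k)
    (S.indep.comp (fun _ x => x.1 j * x.1 k) (fun _ => by fun_prop))
    (fun i => (product_memLp_two (S.measurable_Zj i j) (S.measurable_Zj i k) S.K_nonneg
      (S.psi_Z i j) (S.psi_Z i k)).1)
    (fun i => S.integral_ZZ_eq i i0 j k)
    (fun i => (product_memLp_two (S.measurable_Zj i j) (S.measurable_Zj i k) S.K_nonneg
      (S.psi_Z i j) (S.psi_Z i k)).2) ht

lemma chebyshev_grad (S : RegressionSample P Z r K c) (hn : 0 < n) (j : Fin p)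
    {t : ℝ} (ht : 0 < t) :
    P.real {ω | t ≤ |empGrad (fun i => Z i ω) (fun i => r i ω) j|} ≤
      2 * (6 * K ^ 2) ^ 2 / (n * t ^ 2) := by
  have h := chebyshev_average hn (ξ := fun i ω => Z i ω j * r i ω) (P := P) (m := 0)
    (S.indep.comp (fun _ x => x.1 j * x.2) (fun _ => by fun_prop))
    (fun i => (product_memLp_two (S.measurable_Zj i j) (S.measurable_r i) S.K_nonneg
      (S.psi_Z i j) (S.psi_r i)).1)
    (fun i => S.orth i j)
    (fun i => (product_memLp_two (S.measurable_Zj i j) (S.measurable_r i) S.K_nonneg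
      (S.psi_Z i j) (S.psi_r i)).2) ht
  simp only [sub_zero] at h
  exact h

lemma noise_level (S : RegressionSample P Z r K c) (hn : 0 < n) :
    P.real {ω | 2 * K ^ 2 + 1 ≤ 1 / (n : ℝ) * ∑ i, r i ω ^ 2} ≤ 16 * K ^ 4 / n := by
  have e : ∀ i ω, (r i ω ^ 2) ^ 2 = r i ω ^ 4 := fun i ω => by ring
  have h := chebyshev_average hn (ξ := fun i ω => r i ω ^ 2) (P := P)
    (m := ∫ ω, r ⟨0, hn⟩ ω ^ 2 ∂P) (V := 16 * K ^ 4)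
    (S.indep.comp (fun _ x => x.2 ^ 2) (fun _ => by fun_prop))
    (fun i => by
      rw [memLp_two_iff_integrable_sq ((S.measurable_r i).pow_const 2).aestronglyMeasurable]
      simp_rw [e]
      exact integrable_pow_of_psi2 (S.measurable_r i).aestronglyMeasurable S.K_nonneg
        (S.psi_r i) 4)
    (fun i => ((S.ident i ⟨0, hn⟩).comp (u := fun x : (Fin p → ℝ) × ℝ => x.2 ^ 2)
      (by fun_prop)).integral_eq)
    (fun i => by simp_rw [e]; exact S.integral_r_four_le i) one_pos
  rw [one_pow, mul_one] at h
  refine (measureReal_mono fun ω hω => ?_).trans h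
  have h1 := S.integral_r_sq_le ⟨0, hn⟩
  rw [Set.mem_ofPred_eq] at hω ⊢
  exact le_abs.2 (Or.inl (by linarith))

/-- The event on which second moments, correlations and the noise level are controlled at the
high-dimensional rate. -/
def HighDimEvent (P : Measure Ω) (Z : Fin n → Ω → Fin p → ℝ) (r : Fin n → Ω → ℝ) (K a : ℝ)
    (ω : Ω) : Prop :=
  (∀ i j k, |empGram (fun i => Z i ω) j k - ∫ ω, Z i ω j * Z i ω k ∂P| ≤
      12 * (6 * K ^ 2) * max a (a ^ 2)) ∧
    (∀ j, |empGrad (fun i => Z i ω) (fun i => r i ω) j| ≤ 12 * (6 * K ^ 2) * max a (a ^ 2)) ∧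
    1 / (n : ℝ) * ∑ i, r i ω ^ 2 ≤ 2 * K ^ 2 + 1

lemma measureReal_not_highDimEvent_le (S : RegressionSample P Z r K c) (hn : 0 < n) (hp : 2 ≤ p)
    {a : ℝ} (ha : a = √(Real.log p / n)) :
    P.real {ω | ¬ HighDimEvent P Z r K a ω} ≤ 4 / p + 16 * K ^ 4 / n := by
  have hn' : (0 : ℝ) < n := by exact_mod_cast hn
  have hp' : (2 : ℝ) ≤ p := by exact_mod_cast hp
  have hlog : 0 ≤ Real.log p := Real.log_nonneg (by linarith)
  have ha0 : 0 ≤ a := by rw [ha]; exact Real.sqrt_nonneg _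
  -- The 3 in the Bernstein exponent yields p⁻³, which survives a union over p² entries.
  have hexp : Real.exp (-(3 * n * a ^ 2)) = ((p : ℝ) ^ 3)⁻¹ := by
    rw [ha, Real.sq_sqrt (by positivity)]
    have : -(3 * (n : ℝ) * (Real.log p / n)) = -Real.log ((p : ℝ) ^ 3) := by
      rw [Real.log_pow]; field_simp; norm_num; ring
    rw [this, Real.exp_neg, Real.exp_log (by positivity)]
  set i0 : Fin n := ⟨0, hn⟩
  set T := 12 * (6 * K ^ 2) * max a (a ^ 2)
  have h1 := measureReal_exists_le P (fun (jk : Fin p × Fin p) ω =>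
    T ≤ |empGram (fun i => Z i ω) jk.1 jk.2 - ∫ ω, Z i0 ω jk.1 * Z i0 ω jk.2 ∂P|)
    (fun jk => S.bernstein_gram hn i0 jk.1 jk.2 ha0)
  have h2 := measureReal_exists_le P (fun (j : Fin p) ω =>
    T ≤ |empGrad (fun i => Z i ω) (fun i => r i ω) j|) (fun j => S.bernstein_grad hn j ha0)
  have h3 := S.noise_level hn
  rw [hexp] at h1 h2
  simp only [Fintype.card_prod, Fintype.card_fin, Nat.cast_mul] at h1 h2
  refine (measureReal_mono (fun ω hω => ?_)).trans ((measureReal_union_le _ _).trans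
    ((add_le_add ((measureReal_union_le _ _).trans (add_le_add h1 h2)) h3).trans ?_))
  · by_contra hcon
    rw [Set.mem_union, Set.mem_union, not_or, not_or] at hcon
    obtain ⟨⟨g1, g2⟩, g3⟩ := hcon
    refine hω ⟨fun i j k => ?_, fun j => ?_, ?_⟩
    · rw [S.integral_ZZ_eq i i0]
      by_contra! h
      exact g1 ⟨(j, k), h.le⟩
    · by_contra! h
      exact g2 ⟨j, h.le⟩
    · by_contra! h
      exact g3 h.le
  · have e1 : (p : ℝ) * p * (2 * ((p : ℝ) ^ 3)⁻¹) = 2 / p := by field_simp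
    have e2 : (p : ℝ) * (2 * ((p : ℝ) ^ 3)⁻¹) ≤ 2 / p := by
      rw [← e1]
      refine mul_le_mul_of_nonneg_right ?_ (by positivity)
      nlinarith
    have e3 : (4 : ℝ) / p = 2 / p + 2 / p := by ring
    rw [e1, e3]
    linarith

/-- Low-dimensional control of second moments and correlations. -/
lemma measureReal_lowDim_le (S : RegressionSample P Z r K c) (hn : 0 < n) {t M : ℝ} (ht : 0 < t)
    (hM : 0 < M) :
    P.real {ω | ¬ ((∀ i j k, |empGram (fun i => Z i ω) j k - ∫ ω, Z i ω j * Z i ω k ∂P| ≤ t) ∧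
      ∀ j, |empGrad (fun i => Z i ω) (fun i => r i ω) j| ≤ M / √(n : ℝ))} ≤
      p * p * (2 * (6 * K ^ 2) ^ 2 / (n * t ^ 2)) + p * (2 * (6 * K ^ 2) ^ 2 / M ^ 2) := by
  have hn' : (0 : ℝ) < n := by exact_mod_cast hn
  set i0 : Fin n := ⟨0, hn⟩
  have h1 := measureReal_exists_le P (fun (jk : Fin p × Fin p) ω =>
    t ≤ |empGram (fun i => Z i ω) jk.1 jk.2 - ∫ ω, Z i0 ω jk.1 * Z i0 ω jk.2 ∂P|)
    (fun jk => S.chebyshev_gram hn i0 jk.1 jk.2 ht)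
  have h2 := measureReal_exists_le P (fun (j : Fin p) ω =>
    M / √(n : ℝ) ≤ |empGrad (fun i => Z i ω) (fun i => r i ω) j|)
    (fun j => S.chebyshev_grad hn j (by positivity))
  have e : (n : ℝ) * (M / √(n : ℝ)) ^ 2 = M ^ 2 := by
    rw [div_pow, Real.sq_sqrt hn'.le]; field_simp
  rw [e] at h2
  simp only [Fintype.card_prod, Fintype.card_fin, Nat.cast_mul] at h1 h2
  refine (measureReal_mono (fun ω hω => ?_)).trans ((measureReal_union_le _ _).trans
    (add_le_add h1 h2))
  by_contra hcon
  rw [Set.mem_union, not_or] at hcon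
  obtain ⟨g1, g2⟩ := hcon
  refine hω ⟨fun i j k => ?_, fun j => ?_⟩
  · rw [S.integral_ZZ_eq i i0]
    by_contra! h
    exact g1 ⟨(j, k), h.le⟩
  · by_contra! h
    exact g2 ⟨j, h.le⟩

/-- Restricted strong convexity from an entrywise bound on the second moment matrix. -/
lemma empQuad_ge_of_gram (S : RegressionSample P Z r K c) (i0 : Fin n) {t : ℝ} {ω : Ω}
    (h : ∀ j k, |empGram (fun i => Z i ω) j k - ∫ ω, Z i0 ω j * Z i0 ω k ∂P| ≤ t)
    (v : Fin p → ℝ) :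
    c * ∑ j, v j ^ 2 - t * (∑ j, |v j|) ^ 2 ≤ empQuad (fun i => Z i ω) v := by
  have h1 := S.coercive i0 v
  rw [S.integral_quad] at h1
  rw [empQuad_eq_empGram]
  have h2 : ∑ j, ∑ k, (∫ ω, Z i0 ω j * Z i0 ω k ∂P) * (v j * v k) - t * (∑ j, |v j|) ^ 2 ≤
      ∑ j, ∑ k, empGram (fun i => Z i ω) j k * (v j * v k) := by
    rw [sq, Finset.sum_mul_sum, Finset.mul_sum, ← Finset.sum_sub_distrib]
    refine Finset.sum_le_sum fun j _ => ?_
    rw [Finset.mul_sum, ← Finset.sum_sub_distrib]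
    refine Finset.sum_le_sum fun k _ => ?_
    have h3 : |(empGram (fun i => Z i ω) j k - ∫ ω, Z i0 ω j * Z i0 ω k ∂P) * (v j * v k)| ≤
        t * (|v j| * |v k|) := by
      rw [abs_mul, abs_mul]
      exact mul_le_mul_of_nonneg_right (h j k) (by positivity)
    have h4 := (abs_le.1 h3).1
    linarith
  linarith

end RegressionSample

/-! ### Restricted strong convexity for sub-Gaussian vectors. -/

namespace RegressionSample

variable {n p : ℕ} {Ω : Type*} [MeasurableSpace Ω] {P : Measure Ω}
  {Z : Fin n → Ω → Fin p → ℝ} {r : Fin n → Ω → ℝ} {K c : ℝ}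

/-- Scaling a sub-Gaussian vector bound from unit vectors to all vectors. -/
lemma psi2_projection (hK : 0 ≤ K) {i : Fin n}
    (hvec : ∀ v : Fin p → ℝ, v ⬝ᵥ v = 1 → psi2Norm P (fun ω => Z i ω ⬝ᵥ v) ≤ ENNReal.ofReal K)
    (v : Fin p → ℝ) :
    psi2Norm P (fun ω => Z i ω ⬝ᵥ v) ≤ ENNReal.ofReal (√(∑ j, v j ^ 2) * K) := by
  set N := √(∑ j, v j ^ 2) with hN
  have hNs : N ^ 2 = ∑ j, v j ^ 2 := Real.sq_sqrt (by positivity)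
  have hvv : v ⬝ᵥ v = ∑ j, v j ^ 2 := by simp [dotProduct, sq]
  rcases (Real.sqrt_nonneg (∑ j, v j ^ 2)).eq_or_lt with h0 | h0
  · have hv : v = 0 := by
      have : v ⬝ᵥ v = 0 := by rw [hvv, ← hNs, hN, ← h0]; simp
      exact dotProduct_self_eq_zero.1 this
    subst hv
    simp only [dotProduct_zero]
    rw [psi2Norm_le_iff (by positivity)]
    intro q _
    simp
  · rw [← hN] at h0
    have h1 := hvec (N⁻¹ • v) (by
      rw [smul_dotProduct, dotProduct_smul, hvv, ← hNs, smul_eq_mul, smul_eq_mul]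
      field_simp)
    have h2 := psi2Norm_const_mul_le hK N h1
    rw [abs_of_pos h0] at h2
    convert h2 using 2
    ext ω
    rw [dotProduct_smul, smul_eq_mul]
    field_simp

lemma empGram_symm (z : Fin n → Fin p → ℝ) (j k : Fin p) : empGram z j k = empGram z k j := by
  unfold empGram
  simp_rw [mul_comm]

variable [IsProbabilityMeasure P]

/-- Lower tail of the empirical second moment in a fixed direction. -/
lemma measureReal_empQuad_lt_le (S : RegressionSample P Z r K c) (hn : 0 < n)
    (hvec : ∀ i, ∀ v : Fin p → ℝ, v ⬝ᵥ v = 1 →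
      psi2Norm P (fun ω => Z i ω ⬝ᵥ v) ≤ ENNReal.ofReal K) (v : Fin p → ℝ) :
    P.real {ω | empQuad (fun i => Z i ω) v < c / 2 * ∑ j, v j ^ 2} ≤
      Real.exp (-(n * (c ^ 2 / (128 * K ^ 4)))) := by
  have hn' : (0 : ℝ) < n := by exact_mod_cast hn
  have hK : 0 < K := zero_lt_one.trans_le S.one_le
  have hc := S.c_pos
  set N := √(∑ j, v j ^ 2) with hN
  have hNs : N ^ 2 = ∑ j, v j ^ 2 := Real.sq_sqrt (by positivity)
  rcases (Real.sqrt_nonneg (∑ j, v j ^ 2)).eq_or_lt with h0 | h0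
  · have : {ω | empQuad (fun i => Z i ω) v < c / 2 * ∑ j, v j ^ 2} = ∅ := by
      ext ω
      simp only [Set.mem_ofPred_eq, Set.mem_empty_iff_false, iff_false, not_lt]
      rw [← hNs, hN, ← h0]
      simpa using empQuad_nonneg _ _
    rw [this]
    simpa using Real.exp_nonneg _
  · rw [← hN] at h0
    have hmeas : ∀ i, Measurable fun ω => Z i ω ⬝ᵥ v := fun i => by
      have : Measurable fun z : Fin p → ℝ => z ⬝ᵥ v := by unfold dotProduct; fun_prop
      exact this.comp (S.measurable_Z i)
    have hpsi := fun i => psi2_projection hK.le (hvec i) v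
    have hNK : 0 ≤ N * K := by positivity
    have e4 : ∀ i ω, ((Z i ω ⬝ᵥ v) ^ 2) ^ 2 = (Z i ω ⬝ᵥ v) ^ 4 := fun i ω => by ring
    have hi : ∀ i k, Integrable (fun ω => (Z i ω ⬝ᵥ v) ^ k) P := fun i k =>
      integrable_pow_of_psi2 (hmeas i).aestronglyMeasurable hNK (hpsi i) k
    have h := lower_tail_average (X := fun i ω => (Z i ω ⬝ᵥ v) ^ 2) (P := P) (m := c * N ^ 2)
      (V := 16 * (N * K) ^ 4)
      (S.indep.comp (fun _ x => (x.1 ⬝ᵥ v) ^ 2) (fun _ => by unfold dotProduct; fun_prop))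
      (fun i => (hmeas i).pow_const 2) (fun i ω => sq_nonneg _) (by positivity) (by positivity)
      (fun i => hi i 2) (fun i => by simp_rw [e4]; exact hi i 4)
      (fun i => by rw [hNs]; exact S.coercive i v)
      (fun i => by
        simp_rw [e4]
        have h := integral_even_pow_le_of_psi2 (hmeas i).aestronglyMeasurable hNK (hpsi i) 2
        norm_num at h
        linarith [h, (by ring : (2 * (N * K) ^ 2) ^ 2 * 4 = 16 * (N * K) ^ 4)])
    refine (measureReal_mono fun ω hω => ?_).trans (h.trans (le_of_eq ?_))
    · rw [Set.mem_ofPred_eq] at hω ⊢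
      rw [empQuad, one_div, inv_mul_lt_iff₀ hn', ← hNs] at hω
      linarith
    · congr 1
      field_simp
      norm_num

/-- Simultaneous lower bound on the empirical second moment over sums of `m` signed basis
vectors. -/
lemma measureReal_signedSum_le (S : RegressionSample P Z r K c) (hn : 0 < n) (hp : 2 ≤ p)
    (hvec : ∀ i, ∀ v : Fin p → ℝ, v ⬝ᵥ v = 1 →
      psi2Norm P (fun ω => Z i ω ⬝ᵥ v) ≤ ENNReal.ofReal K) {c0 a : ℝ}
    (hc0 : c0 = c ^ 2 / (128 * K ^ 4)) (ha : a = √(Real.log p / n)) {m : ℕ}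
    (hm : m * (4 * a ^ 2) ≤ c0) :
    P.real {ω | ∃ J : Fin m → Fin p × Bool, empQuad (fun i => Z i ω) (signedSum J) <
      c / 2 * ∑ j, signedSum J j ^ 2} ≤ Real.exp (-(n * c0 / 2)) := by
  have hn' : (0 : ℝ) < n := by exact_mod_cast hn
  have hp' : (2 : ℝ) ≤ p := by exact_mod_cast hp
  have hlog : 0 ≤ Real.log p := Real.log_nonneg (by linarith)
  have ha2 : a ^ 2 = Real.log p / n := by rw [ha, Real.sq_sqrt (by positivity)]
  have h := measureReal_exists_le P (fun (J : Fin m → Fin p × Bool) ω =>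
    empQuad (fun i => Z i ω) (signedSum J) < c / 2 * ∑ j, signedSum J j ^ 2)
    (fun J => S.measureReal_empQuad_lt_le hn hvec (signedSum J))
  refine h.trans ?_
  rw [← hc0]
  simp only [Fintype.card_fun, Fintype.card_prod, Fintype.card_fin, Fintype.card_bool,
    Nat.cast_pow, Nat.cast_mul, Nat.cast_ofNat]
  -- The number of signed sums is at most p^(2m) since p ≥ 2, and `hm` lets it consume only half of
  -- the exponent n c0.
  have h1 : ((p : ℝ) * 2) ^ m ≤ Real.exp (n * c0 / 2) := by
    calc ((p : ℝ) * 2) ^ m ≤ ((p : ℝ) * p) ^ m := by gcongr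
      _ = Real.exp (m * (2 * Real.log p)) := by
          rw [Real.exp_nat_mul, two_mul, Real.exp_add, Real.exp_log (by linarith)]
      _ ≤ _ := by
          rw [Real.exp_le_exp]
          rw [ha2] at hm
          have : (m : ℝ) * (4 * (Real.log p / n)) * n = 2 * (m * (2 * Real.log p)) := by
            field_simp; ring
          nlinarith
  calc ((p : ℝ) * 2) ^ m * Real.exp (-(n * c0)) ≤
        Real.exp (n * c0 / 2) * Real.exp (-(n * c0)) := by gcongr
    _ = _ := by rw [← Real.exp_add]; congr 1; ring

lemma c_le (S : RegressionSample P Z r K c) (i : Fin n) (j : Fin p) : c ≤ 2 * K ^ 2 := by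
  have h := S.coercive i (Pi.single j 1)
  have h2 := S.integral_Z_sq_le i j
  have e1 : ∑ k, (Pi.single j (1 : ℝ) : Fin p → ℝ) k ^ 2 = 1 := by
    rw [Finset.sum_eq_single j (by intro k _ hk; simp [hk]) (by simp)]
    simp
  have e2 : ∀ ω, (Z i ω ⬝ᵥ Pi.single j 1) ^ 2 = Z i ω j * Z i ω j := by
    intro ω; simp [sq]
  simp_rw [e2] at h
  rw [e1] at h
  linarith

/-- Restricted strong convexity from control on sums of signed basis vectors. -/
lemma empQuad_ge_of_signedSum (S : RegressionSample P Z r K c) (i0 : Fin n) (j0 : Fin p)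
    {c0 a : ℝ} (hc0 : c0 = c ^ 2 / (128 * K ^ 4)) (ha : 0 < a) {m : ℕ}
    (hm : m = ⌊c0 / (4 * a ^ 2)⌋₊) {ω : Ω} (h : HighDimEvent P Z r K a ω)
    (hJ : ∀ J : Fin m → Fin p × Bool, c / 2 * ∑ j, signedSum J j ^ 2 ≤
      empQuad (fun i => Z i ω) (signedSum J)) (v : Fin p → ℝ) :
    c / 2 * ∑ j, v j ^ 2 - 208 * (6 * K ^ 2) / c0 * a ^ 2 * (∑ j, |v j|) ^ 2 ≤
      empQuad (fun i => Z i ω) v := by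
  have hK : 0 < K := zero_lt_one.trans_le S.one_le
  have hK1 : 1 ≤ K ^ 2 := one_le_pow₀ S.one_le
  have hc := S.c_pos
  have hcK := S.c_le i0 j0
  have hc0p : 0 < c0 := by rw [hc0]; positivity
  have hc0l : c0 ≤ 1 := by
    rw [hc0, div_le_one (by positivity)]
    calc c ^ 2 ≤ (2 * K ^ 2) ^ 2 := by gcongr
      _ = 4 * K ^ 4 := by ring
      _ ≤ 128 * K ^ 4 := by gcongr; norm_num
  -- If m < 2 then a² > c0/8, and the defect alone dominates the curvature because ‖v‖₂ ≤ ‖v‖₁.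
  -- Otherwise Maurey's method applies with m of order 1/a².
  rcases lt_or_ge m 2 with hm2 | hm2
  · have h1 : c0 / (4 * a ^ 2) < 2 := by
      have := Nat.lt_floor_add_one (c0 / (4 * a ^ 2))
      rw [← hm] at this
      have h2 : (m : ℝ) + 1 ≤ 2 := by exact_mod_cast hm2
      linarith
    rw [div_lt_iff₀ (by positivity)] at h1
    have h3 : c / 2 ≤ 208 * (6 * K ^ 2) / c0 * a ^ 2 := by
      rw [div_mul_eq_mul_div, le_div_iff₀ hc0p]
      calc c / 2 * c0 ≤ (2 * K ^ 2) / 2 * (2 * (4 * a ^ 2)) := by gcongr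
        _ = 8 * (K ^ 2 * a ^ 2) := by ring
        _ ≤ 1248 * (K ^ 2 * a ^ 2) := by gcongr; norm_num
        _ = _ := by ring
    have h4 := sum_sq_le_sq_sum_abs v
    have h5 := empQuad_nonneg (fun i => Z i ω) v
    have h6 : c / 2 * ∑ j, v j ^ 2 ≤ 208 * (6 * K ^ 2) / c0 * a ^ 2 * (∑ j, |v j|) ^ 2 := by
      gcongr
    linarith
  · have hm2' : (2 : ℝ) ≤ m := by exact_mod_cast hm2
    have hmle : (m : ℝ) ≤ c0 / (4 * a ^ 2) := by
      rw [hm]; exact Nat.floor_le (by positivity)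
    have ha1 : a ^ 2 ≤ 1 := by
      rw [le_div_iff₀ (by positivity)] at hmle
      nlinarith
    have ha1' : a ≤ 1 := by nlinarith
    have hmax : max a (a ^ 2) ≤ 1 := max_le ha1' ha1
    -- Nonnegativity of this form is exactly curvature c/2. Its diagonal is bounded, so the loss
    -- d/(m - 1) in `maurey_transfer` is of order a².
    set A : Matrix (Fin p) (Fin p) ℝ :=
      Matrix.of (empGram (fun i => Z i ω)) - (c / 2) • (1 : Matrix (Fin p) (Fin p) ℝ) with hA
    have hsymm : A.IsSymm := by
      rw [hA]
      refine Matrix.IsSymm.sub ?_ ?_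
      · ext j k; simp only [Matrix.transpose_apply, Matrix.of_apply]; exact empGram_symm _ _ _
      · exact Matrix.isSymm_one.smul _
    have hquad : ∀ x : Fin p → ℝ, x ⬝ᵥ A.mulVec x =
        empQuad (fun i => Z i ω) x - c / 2 * ∑ j, x j ^ 2 := by
      intro x
      rw [hA, Matrix.sub_mulVec, dotProduct_sub, Matrix.smul_mulVec, Matrix.one_mulVec,
        dotProduct_smul, smul_eq_mul, empQuad_eq_empGram]
      congr 1
      · simp only [dotProduct, Matrix.mulVec, Matrix.of_apply, Finset.mul_sum]
        exact Finset.sum_congr rfl fun j _ => Finset.sum_congr rfl fun k _ => by ring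
      · simp [dotProduct, sq]
    have hd : ∀ j, A j j ≤ 13 * (6 * K ^ 2) := by
      intro j
      have g1 := (abs_le.1 (h.1 i0 j j)).2
      have g2 := S.integral_Z_sq_le i0 j
      have g3 : 12 * (6 * K ^ 2) * max a (a ^ 2) ≤ 12 * (6 * K ^ 2) * 1 := by gcongr
      simp only [hA, Matrix.sub_apply, Matrix.of_apply, Matrix.smul_apply, Matrix.one_apply_eq,
        smul_eq_mul, mul_one]
      linarith
    have h1 := maurey_transfer A hsymm hd hm2 (fun J => by rw [hquad]; linarith [hJ J]) v
    rw [hquad] at h1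
    have h2 : 13 * (6 * K ^ 2) / (m - 1) ≤ 208 * (6 * K ^ 2) / c0 * a ^ 2 := by
      rw [div_mul_eq_mul_div, div_le_div_iff₀ (by linarith) hc0p]
      have h3 : c0 / (4 * a ^ 2) < m + 1 := by
        have := Nat.lt_floor_add_one (c0 / (4 * a ^ 2))
        rwa [← hm] at this
      rw [div_lt_iff₀ (by positivity)] at h3
      have h4 : (m : ℝ) + 1 ≤ 3 * (m - 1) := by linarith
      have h5 : c0 ≤ 3 * (m - 1) * (4 * a ^ 2) := h3.le.trans (by gcongr)
      calc 13 * (6 * K ^ 2) * c0 ≤ 13 * (6 * K ^ 2) * (3 * (m - 1) * (4 * a ^ 2)) := by gcongr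
        _ = 156 * (6 * K ^ 2) * a ^ 2 * (m - 1) := by ring
        _ ≤ 208 * (6 * K ^ 2) * a ^ 2 * (m - 1) := by
            gcongr
            · linarith
            · norm_num
    have h3 : 13 * (6 * K ^ 2) / (m - 1) * (∑ j, |v j|) ^ 2 ≤
        208 * (6 * K ^ 2) / c0 * a ^ 2 * (∑ j, |v j|) ^ 2 := by gcongr
    linarith

/-- On the high-dimensional event the correlations are of order `a`, for every size of `a`. -/
lemma empGrad_le_of_highDimEvent (S : RegressionSample P Z r K c) (i0 : Fin n) {a : ℝ}
    (ha : 0 ≤ a) {ω : Ω} (h : HighDimEvent P Z r K a ω) (j : Fin p) :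
    |empGrad (fun i => Z i ω) (fun i => r i ω) j| ≤ 12 * (6 * K ^ 2) * a := by
  have hK1 : 1 ≤ K ^ 2 := one_le_pow₀ S.one_le
  rcases le_total a 1 with h1 | h1
  · have : max a (a ^ 2) = a := max_eq_left (by nlinarith)
    have h2 := h.2.1 j
    rwa [this] at h2
  -- Here Bernstein yields only a². Cauchy-Schwarz with the Gram diagonal, of order a², and the
  -- bounded noise level restores order a. Such a do occur: for γ0 = 0 the sparsity condition does
  -- not limit p.
  · have hmax : max a (a ^ 2) = a ^ 2 := max_eq_right (by nlinarith)
    have g1 := (abs_le.1 (h.1 i0 j j)).2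
    have g2 := S.integral_Z_sq_le i0 j
    rw [hmax] at g1
    have ha2 : 1 ≤ a ^ 2 := one_le_pow₀ h1
    have g3 : empGram (fun i => Z i ω) j j ≤ 13 * (6 * K ^ 2) * a ^ 2 := by nlinarith
    have g4 := h.2.2
    have g5 : empGrad (fun i => Z i ω) (fun i => r i ω) j ^ 2 ≤
        empGram (fun i => Z i ω) j j * (1 / (n : ℝ) * ∑ i, r i ω ^ 2) := by
      unfold empGrad empGram
      have := Finset.sum_mul_sq_le_sq_mul_sq Finset.univ (fun i => Z i ω j) (fun i => r i ω)
      rw [mul_pow]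
      calc (1 / (n : ℝ)) ^ 2 * (∑ i, Z i ω j * r i ω) ^ 2 ≤
          (1 / (n : ℝ)) ^ 2 * ((∑ i, Z i ω j ^ 2) * ∑ i, r i ω ^ 2) := by gcongr
        _ = _ := by simp_rw [sq]; ring
    refine abs_le_of_sq_le_sq ?_ (by positivity)
    have hg0 : 0 ≤ 1 / (n : ℝ) * ∑ i, r i ω ^ 2 := by positivity
    calc empGrad (fun i => Z i ω) (fun i => r i ω) j ^ 2
        ≤ empGram (fun i => Z i ω) j j * (1 / (n : ℝ) * ∑ i, r i ω ^ 2) := g5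
      _ ≤ (13 * (6 * K ^ 2) * a ^ 2) * (2 * K ^ 2 + 1) := by gcongr
      _ ≤ (13 * (6 * K ^ 2) * a ^ 2) * (6 * K ^ 2) := by gcongr; linarith
      _ ≤ (12 * (6 * K ^ 2) * a) ^ 2 := by nlinarith [sq_nonneg (6 * K ^ 2 * a)]

end RegressionSample

/-! ### Error bounds with high probability at one sample size. -/

/-- The conclusion of the estimation error bounds: correlations of order `a`, and errors of the
order of `s` active coordinates. -/
def ErrorBound {n p : ℕ} (z : Fin n → Fin p → ℝ) (r : Fin n → ℝ) (v : Fin p → ℝ)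
    (C s a : ℝ) : Prop :=
  (∀ j, |empGrad z r j| ≤ C * a) ∧ ∑ j, |v j| ≤ C * s * a ∧ empQuad z v ≤ C * s * a ^ 2

lemma ErrorBound.mono {n p : ℕ} {z : Fin n → Fin p → ℝ} {r : Fin n → ℝ} {v : Fin p → ℝ}
    {C C' s a : ℝ} (h : ErrorBound z r v C s a) (hC : C ≤ C') (hs : 0 ≤ s) (ha : 0 ≤ a) :
    ErrorBound z r v C' s a := by
  obtain ⟨h1, h2, h3⟩ := h
  exact ⟨fun j => (h1 j).trans (by gcongr), h2.trans (by gcongr), h3.trans (by gcongr)⟩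

/-- A lower bound on `D L` that makes the tuning parameter `D √(log p / n)` large enough. -/
noncomputable def tuningThreshold (K c μ : ℝ) : ℝ :=
  1 + 16 * (12 * (6 * K ^ 2)) +
    8 * (208 * (6 * K ^ 2) / (c ^ 2 / (128 * K ^ 4))) * (6 * K ^ 2) +
    8 * μ * (208 * (6 * K ^ 2) / (c ^ 2 / (128 * K ^ 4))) * (6 * K ^ 2) / (c / 2) +
    64 * (12 * (6 * K ^ 2)) ^ 2 * μ / (c / 2)

/-- The constant in the high-dimensional error bound. -/
noncomputable def errorConst (K c μ E : ℝ) : ℝ :=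
  12 * (6 * K ^ 2) + (√(128 * μ / (c / 2)) * 16 + 128) * E / (c / 2) + 128 * E ^ 2 / (c / 2) +
    24 * E / c + 18 * E ^ 2 / c

namespace RegressionSample

variable {n p : ℕ} {Ω : Type*} [MeasurableSpace Ω] {P : Measure Ω} [IsProbabilityMeasure P]
  {Z : Fin n → Ω → Fin p → ℝ} {r : Fin n → Ω → ℝ} {K c : ℝ} {ρ : ℝ → ℝ → ℝ} {L μ D a : ℝ}

lemma tuning_pos (hn : 0 < n) (hp : 2 ≤ p) (ha : a = √(Real.log p / n)) : 0 < a := by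
  have hn' : (0 : ℝ) < n := by exact_mod_cast hn
  have hp' : (2 : ℝ) ≤ p := by exact_mod_cast hp
  rw [ha]
  exact Real.sqrt_pos.2 (div_pos (Real.log_pos (by linarith)) hn')

/-- High-dimensional error bound for one sample size. -/
lemma measureReal_highDim_error (S : RegressionSample P Z r K c) (hn : 0 < n) (hp : 2 ≤ p)
    (h : IsAmenablePenalty ρ L μ) (hD : tuningThreshold K c μ ≤ D * L)
    (hcase : IsLassoPenalty ρ L ∨ ∀ i, ∀ v : Fin p → ℝ, v ⬝ᵥ v = 1 →
      psi2Norm P (fun ω => Z i ω ⬝ᵥ v) ≤ ENNReal.ofReal K)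
    (ha : a = √(Real.log p / n)) {γ0 : Fin p → ℝ} {γ : Ω → Fin p → ℝ}
    (hmin : ∀ ω, IsMinOn (penalizedLoss ρ (D * a) (fun i => Z i ω ⬝ᵥ γ0 + r i ω)
      (fun i => Z i ω)) Set.univ (γ ω))
    (hs1 : 32 * (l0Norm γ0 : ℝ) * (12 * (6 * K ^ 2) * max a (a ^ 2)) ≤ c)
    (hs2 : 2 * (D * a * L * (√(l0Norm γ0 : ℝ) * √(∑ j, γ0 j ^ 2))) ≤ 1) :
    P.real {ω | ¬ ErrorBound (fun i => Z i ω) (fun i => r i ω) (γ ω - γ0)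
      (errorConst K c μ (D * L)) (l0Norm γ0) a} ≤
      4 / p + 16 * K ^ 4 / n + Real.exp (-(n * (c ^ 2 / (128 * K ^ 4)) / 2)) := by
  have ha0 := tuning_pos hn hp ha
  have hK1 : 1 ≤ K ^ 2 := one_le_pow₀ S.one_le
  have hK : 0 < K := zero_lt_one.trans_le S.one_le
  have hc := S.c_pos
  have hLp := h.L_pos
  have hμ := h.μ_pos
  set i0 : Fin n := ⟨0, hn⟩
  set j0 : Fin p := ⟨0, by omega⟩
  set c0 := c ^ 2 / (128 * K ^ 4) with hc0
  have hc0p : 0 < c0 := by positivity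
  set C2 := 208 * (6 * K ^ 2) / c0 with hC2
  have hC2p : 0 < C2 := by positivity
  set E := D * L with hE
  -- The summands give in turn E ≥ 1 and the hypotheses `hD2`, `hD3`, `hD1`, `hD4` of
  -- `amenable_rate` with C4 = 6K²; E ≤ E² passes from E to its square where needed.
  have hT : 1 + 16 * (12 * (6 * K ^ 2)) + 8 * C2 * (6 * K ^ 2) +
      8 * μ * C2 * (6 * K ^ 2) / (c / 2) + 64 * (12 * (6 * K ^ 2)) ^ 2 * μ / (c / 2) ≤ E := hD
  have t1 : 0 < 16 * (12 * (6 * K ^ 2)) := by positivity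
  have t2 : 0 < 8 * C2 * (6 * K ^ 2) := by positivity
  have t3 : 0 < 8 * μ * C2 * (6 * K ^ 2) / (c / 2) := by positivity
  have t4 : 0 < 64 * (12 * (6 * K ^ 2)) ^ 2 * μ / (c / 2) := by positivity
  have hE1 : 1 ≤ E := by linarith
  have hE0 : 0 < E := by linarith
  have hEE : E ≤ E ^ 2 := by nlinarith
  have hDp : 0 < D := pos_of_mul_pos_left (by rw [← hE]; exact hE0) hLp.le
  have hl : 0 < D * a := by positivity
  have hsn : (0 : ℝ) ≤ (l0Norm γ0 : ℝ) := Nat.cast_nonneg _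
  have hconst : 12 * (6 * K ^ 2) ≤ errorConst K c μ E := by
    unfold errorConst
    have : 0 ≤ (√(128 * μ / (c / 2)) * 16 + 128) * E / (c / 2) + 128 * E ^ 2 / (c / 2) +
      24 * E / c + 18 * E ^ 2 / c := by positivity
    linarith
  have hA := S.measureReal_not_highDimEvent_le hn hp ha
  rcases hcase with hlasso | hvec
  · refine (measureReal_mono fun ω hω => ?_).trans
      (hA.trans (le_add_of_nonneg_right (Real.exp_nonneg _)))
    intro hev
    refine hω ⟨fun j => (S.empGrad_le_of_highDimEvent i0 ha0.le hev j).trans (by gcongr), ?_⟩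
    -- The entrywise defect is only of order max(a, a²), which suffices for the Lasso thanks to the
    -- cone condition and `hs1`.
    have hre := S.empQuad_ge_of_gram i0 (fun j k => hev.1 i0 j k) (γ ω - γ0)
    have hmax : 0 ≤ max a (a ^ 2) := ha0.le.trans (le_max_left _ _)
    obtain ⟨g1, g2⟩ := lasso_rate h hlasso hl (hmin ω) (fun i => rfl) hc
      (fun j => (S.empGrad_le_of_highDimEvent i0 ha0.le hev j).trans (by
        rw [show D * a * L / 2 = E / 2 * a by rw [hE]; ring]
        gcongr
        linarith)) (by positivity) hs1 hre
    have e : D * a * L = E * a := by rw [hE]; ring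
    rw [e] at g1 g2
    constructor
    · refine g1.trans ?_
      calc 24 * (E * a) * l0Norm γ0 / c = (24 * E / c) * l0Norm γ0 * a := by ring
        _ ≤ _ := by
          gcongr
          unfold errorConst
          have : 0 ≤ 12 * (6 * K ^ 2) + (√(128 * μ / (c / 2)) * 16 + 128) * E / (c / 2) +
            128 * E ^ 2 / (c / 2) + 18 * E ^ 2 / c := by positivity
          linarith
    · refine g2.trans ?_
      calc 18 * (E * a) ^ 2 * l0Norm γ0 / c = (18 * E ^ 2 / c) * l0Norm γ0 * a ^ 2 := by ring
        _ ≤ _ := by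
          gcongr
          unfold errorConst
          have : 0 ≤ 12 * (6 * K ^ 2) + (√(128 * μ / (c / 2)) * 16 + 128) * E / (c / 2) +
            128 * E ^ 2 / (c / 2) + 24 * E / c := by positivity
          linarith
  · set m := ⌊c0 / (4 * a ^ 2)⌋₊ with hm
    have hB := S.measureReal_signedSum_le hn hp hvec hc0 ha (m := m) (by
      rw [← le_div_iff₀ (by positivity)]
      exact Nat.floor_le (by positivity))
    refine (measureReal_mono fun ω hω => ?_).trans ((measureReal_union_le _ _).trans
      (add_le_add hA hB))
    by_contra hcon
    rw [Set.mem_union, not_or] at hcon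
    obtain ⟨hc1, hc2⟩ := hcon
    have hev : HighDimEvent P Z r K a ω := by
      by_contra hh
      exact hc1 hh
    have hJ : ∀ J : Fin m → Fin p × Bool, c / 2 * ∑ j, signedSum J j ^ 2 ≤
        empQuad (fun i => Z i ω) (signedSum J) := fun J => by
      by_contra! hh
      exact hc2 ⟨J, hh⟩
    refine hω ⟨fun j => (S.empGrad_le_of_highDimEvent i0 ha0.le hev j).trans (by gcongr), ?_⟩
    have hre := S.empQuad_ge_of_signedSum i0 j0 hc0 ha0 hm hev hJ (γ ω - γ0)
    have hR := total_penalty_le h hl (hmin ω) (fun i => rfl)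
    have hnl := hev.2.2
    have hB6 : 1 ≤ E := hE1
    obtain ⟨g1, g2⟩ := amenable_rate (C4 := 6 * K ^ 2) (C2 := C2) h hDp ha0 (hmin ω) (fun i => rfl)
      (by positivity : 0 < c / 2) (by positivity)
      hC2p.le (fun j => S.empGrad_le_of_highDimEvent i0 ha0.le hev j) hre (by linarith)
      (by
        have : 8 * μ * C2 * (6 * K ^ 2) / (c / 2) ≤ E ^ 2 := by linarith
        rw [div_le_iff₀ (by positivity)] at this
        linarith) (by linarith) (by linarith) (by
        have : 64 * (12 * (6 * K ^ 2)) ^ 2 * μ / (c / 2) ≤ E ^ 2 := by linarith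
        rw [div_le_iff₀ (by positivity)] at this
        linarith)
    constructor
    · refine g1.trans ?_
      calc (√(128 * μ / (c / 2)) * 16 + 128) * (D * L * a) * l0Norm γ0 / (c / 2) =
            ((√(128 * μ / (c / 2)) * 16 + 128) * E / (c / 2)) * l0Norm γ0 * a := by rw [hE]; ring
        _ ≤ _ := by
          gcongr
          unfold errorConst
          have : 0 ≤ 12 * (6 * K ^ 2) +
            128 * E ^ 2 / (c / 2) + 24 * E / c + 18 * E ^ 2 / c := by positivity
          linarith
    · refine g2.trans ?_
      calc 128 * (D * L * a) ^ 2 * l0Norm γ0 / (c / 2) =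
            (128 * E ^ 2 / (c / 2)) * l0Norm γ0 * a ^ 2 := by rw [hE]; ring
        _ ≤ _ := by
          gcongr
          unfold errorConst
          have : 0 ≤ 12 * (6 * K ^ 2) + (√(128 * μ / (c / 2)) * 16 + 128) * E / (c / 2) +
            24 * E / c + 18 * E ^ 2 / c := by positivity
          linarith

/-- Low-dimensional error bound for one sample size. -/
lemma measureReal_lowDim_error (S : RegressionSample P Z r K c) (hn : 0 < n) (hp : 2 ≤ p)
    (h : IsAmenablePenalty ρ L μ) (hD : 0 < D) (ha : a = √(Real.log p / n)) {γ0 : Fin p → ℝ}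
    {γ : Ω → Fin p → ℝ}
    (hmin : ∀ ω, IsMinOn (penalizedLoss ρ (D * a) (fun i => Z i ω ⬝ᵥ γ0 + r i ω)
      (fun i => Z i ω)) Set.univ (γ ω)) {M : ℝ} (hM : 0 < M) :
    P.real {ω | ¬ ErrorBound (fun i => Z i ω) (fun i => r i ω) (γ ω - γ0)
      ((2 * M + D * L) + 8 * (2 * M + D * L) / c + 32 * (2 * M + D * L) ^ 2 / c) p a} ≤
      p * p * (2 * (6 * K ^ 2) ^ 2 / (n * (c / (2 * p)) ^ 2)) +
        p * (2 * (6 * K ^ 2) ^ 2 / M ^ 2) := by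
  have hn' : (0 : ℝ) < n := by exact_mod_cast hn
  have hp' : (2 : ℝ) ≤ p := by exact_mod_cast hp
  have ha0 := tuning_pos hn hp ha
  have hc := S.c_pos
  have hLp := h.L_pos
  set b := 2 * M + D * L with hb
  have hb0 : 0 < b := by positivity
  set i0 : Fin n := ⟨0, hn⟩
  -- Since p ≥ 2, √(log p) ≥ 1/2, so the parametric rate 1/√n is at most 2a.
  have hMa : M / √(n : ℝ) ≤ 2 * M * a := by
    have h1 : 1 / 2 ≤ √(Real.log p) := by
      refine Real.le_sqrt_of_sq_le ?_
      have := Real.log_le_log (by norm_num) hp'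
      linarith [Real.log_two_gt_d9]
    rw [ha, Real.sqrt_div (Real.log_nonneg (by linarith)), ← mul_div_assoc]
    gcongr
    nlinarith
  -- Entrywise accuracy c/(2p) suffices: ‖v‖₁² ≤ p‖v‖₂², so the defect is at most half of the
  -- curvature.
  refine (measureReal_mono fun ω hω => ?_).trans
    (S.measureReal_lowDim_le hn (by positivity : 0 < c / (2 * p)) hM)
  intro hev
  have hg : ∀ j, |empGrad (fun i => Z i ω) (fun i => r i ω) j| ≤ b * a := fun j =>
    (hev.2 j).trans (hMa.trans (by gcongr; rw [hb]; linarith [mul_pos hD hLp]))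
  have hre := S.empQuad_ge_of_gram i0 (fun j k => hev.1 i0 j k) (γ ω - γ0)
  have hcs : (∑ j, |(γ ω - γ0) j|) ^ 2 ≤ p * ∑ j, (γ ω - γ0) j ^ 2 := by
    have := sq_sum_le_card_mul_sum_sq (s := Finset.univ) (f := fun j => |(γ ω - γ0) j|)
    simpa using this
  have hre' : c / 2 * ∑ j, (γ ω - γ0) j ^ 2 ≤ empQuad (fun i => Z i ω) (γ ω - γ0) := by
    have : c / (2 * p) * (∑ j, |(γ ω - γ0) j|) ^ 2 ≤ c / 2 * ∑ j, (γ ω - γ0) j ^ 2 := by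
      calc c / (2 * p) * (∑ j, |(γ ω - γ0) j|) ^ 2 ≤
            c / (2 * p) * (p * ∑ j, (γ ω - γ0) j ^ 2) := by gcongr
        _ = _ := by field_simp
    linarith
  obtain ⟨g1, g2⟩ := lowdim_rate h (by positivity : 0 < D * a) (hmin ω) (fun i => rfl)
    (by positivity : 0 < c / 2) (b := b * a) (by
      rw [hb]
      nlinarith [mul_pos hM ha0]) hg hre'
  refine hω ⟨fun j => (hg j).trans ?_, g1.trans ?_, g2.trans ?_⟩
  · gcongr
    have : 0 ≤ 8 * b / c + 32 * b ^ 2 / c := by positivity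
    linarith
  · calc 4 * (b * a) * p / (c / 2) = (8 * b / c) * p * a := by field_simp; ring
      _ ≤ _ := by
        gcongr
        have : 0 ≤ b + 32 * b ^ 2 / c := by positivity
        linarith
  · calc 16 * (b * a) ^ 2 * p / (c / 2) = (32 * b ^ 2 / c) * p * a ^ 2 := by field_simp; ring
      _ ≤ _ := by
        gcongr
        have : 0 ≤ b + 8 * b / c := by positivity
        linarith

end RegressionSample

lemma tendsto_zero_of_eventually_le {f : ℕ → ℝ} (h0 : ∀ n, 0 ≤ f n)
    (h : ∀ δ > 0, ∀ᶠ n in atTop, f n ≤ δ) : Tendsto f atTop (𝓝 0) := by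
  rw [tendsto_order]
  refine ⟨fun b hb => Eventually.of_forall fun n => hb.trans_le (h0 n), fun b hb => ?_⟩
  filter_upwards [h (b / 2) (by linarith)] with n hn
  linarith

/-! ### Sparsity rates and error bounds uniform in the dimension. -/

section Rates

variable {p s : ℕ → ℕ}

lemma tendsto_sparsity
    (h : (fun n => (s n : ℝ)) =o[atTop] fun n : ℕ => √(n : ℝ) / Real.log (p n)) :
    Tendsto (fun n : ℕ => (s n : ℝ) * Real.log (p n) / √(n : ℝ)) atTop (𝓝 0) := by
  refine h.tendsto_div_nhds_zero.congr fun n => ?_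
  rw [div_div_eq_mul_div]

/-- For p ≥ 2 and n ≥ 1 both a and a² are at most 2 log p / √n. The sparsity assumption thus also
makes s a small, as the Lasso bound requires. -/
lemma sparsity_mul_max_le (hp : ∀ n, 2 ≤ p n) {n : ℕ} (hn : 0 < n) :
    (s n : ℝ) * max √(Real.log (p n) / n) (√(Real.log (p n) / n) ^ 2) ≤
      2 * ((s n : ℝ) * Real.log (p n) / √(n : ℝ)) := by
  have hn' : (1 : ℝ) ≤ n := by exact_mod_cast hn
  have hp' : (2 : ℝ) ≤ p n := by exact_mod_cast hp n
  have hl : 1 / 2 ≤ Real.log (p n) := by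
    have := Real.log_le_log (by norm_num) hp'
    linarith [Real.log_two_gt_d9]
  have hs : 1 ≤ √(n : ℝ) := Real.one_le_sqrt.2 hn'
  have hsq : √(n : ℝ) ^ 2 = n := Real.sq_sqrt (by linarith)
  have h1 : max √(Real.log (p n) / n) (√(Real.log (p n) / n) ^ 2) ≤
      2 * (Real.log (p n) / √(n : ℝ)) := by
    refine max_le ?_ ?_
    · rw [Real.sqrt_div (by linarith), ← mul_div_assoc]
      gcongr
      rw [Real.sqrt_le_left (by linarith)]
      nlinarith
    · rw [Real.sq_sqrt (by positivity)]
      have h2 : Real.log (p n) / n ≤ Real.log (p n) / √(n : ℝ) := by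
        gcongr
        nlinarith
      have : 0 ≤ Real.log (p n) / √(n : ℝ) := by positivity
      linarith
  calc (s n : ℝ) * max √(Real.log (p n) / n) (√(Real.log (p n) / n) ^ 2) ≤
        (s n : ℝ) * (2 * (Real.log (p n) / √(n : ℝ))) := by gcongr
    _ = _ := by ring

lemma sqrt_mul_sparsity (hp : ∀ n, 2 ≤ p n) {n : ℕ} (hn : 0 < n) (x : ℝ) :
    √(n : ℝ) * (x * √(Real.log (p n) / n) ^ 2) = x * Real.log (p n) / √(n : ℝ) := by
  have hn' : (0 : ℝ) < n := by exact_mod_cast hn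
  have hp' : (2 : ℝ) ≤ p n := by exact_mod_cast hp n
  have hl : 0 ≤ Real.log (p n) := Real.log_nonneg (by linarith)
  have hs : 0 < √(n : ℝ) := Real.sqrt_pos.2 hn'
  rw [Real.sq_sqrt (by positivity)]
  have hsq : √(n : ℝ) ^ 2 = n := Real.sq_sqrt hn'.le
  rw [eq_div_iff hs.ne']
  calc √(n : ℝ) * (x * (Real.log (p n) / n)) * √(n : ℝ) =
        √(n : ℝ) ^ 2 * (x * (Real.log (p n) / n)) := by ring
    _ = _ := by rw [hsq]; field_simp

/-- The number of active coordinates: all of them when the dimension is below `p1`. -/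
def activeCount (p1 p s : ℕ) : ℕ := if p < p1 then p1 else s

/-- Rows with p < p1 contribute at most p1 log p1 / √n, the others s log p / √n. The sum of both
bounds covers sequences that alternate between the cases. -/
lemma tendsto_activeCount (hp : ∀ n, 2 ≤ p n) (p1 : ℕ)
    (h : (fun n => (s n : ℝ)) =o[atTop] fun n : ℕ => √(n : ℝ) / Real.log (p n)) :
    Tendsto (fun n : ℕ => √(n : ℝ) *
      ((activeCount p1 (p n) (s n) : ℝ) * √(Real.log (p n) / n) ^ 2)) atTop (𝓝 0) := by
  have h1 := tendsto_sparsity h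
  have h2 : Tendsto (fun n : ℕ => ((p1 : ℝ) * Real.log p1) / √(n : ℝ)) atTop (𝓝 0) :=
    Tendsto.div_atTop tendsto_const_nhds
      (Real.tendsto_sqrt_atTop.comp tendsto_natCast_atTop_atTop)
  have h3 := h1.add h2
  rw [add_zero] at h3
  refine squeeze_zero' (Eventually.of_forall fun n => by positivity) ?_ h3
  filter_upwards [eventually_gt_atTop 0] with n hn
  rw [sqrt_mul_sparsity hp hn]
  have hp' : (2 : ℝ) ≤ p n := by exact_mod_cast hp n
  have hl : 0 ≤ Real.log (p n) := Real.log_nonneg (by linarith)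
  have hl1 : 0 ≤ Real.log p1 := by
    rcases Nat.eq_zero_or_pos p1 with h0 | h0
    · simp [h0]
    · exact Real.log_nonneg (by exact_mod_cast h0)
  unfold activeCount
  split_ifs with hlt
  · have h4 : Real.log (p n) ≤ Real.log p1 :=
      Real.log_le_log (by linarith) (by exact_mod_cast hlt.le)
    refine le_add_of_nonneg_of_le (by positivity) ?_
    gcongr
  · exact le_add_of_nonneg_right (by positivity)

end Rates

namespace RegressionSample

/-- Estimation error bound for a sequence of samples, with probability close to one. -/
theorem eventually_errorBound {p : ℕ → ℕ} {Ω : ℕ → Type u} [∀ n, MeasurableSpace (Ω n)]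
    {P : ∀ n, Measure (Ω n)} [∀ n, IsProbabilityMeasure (P n)]
    {Z : ∀ n, Fin n → Ω n → Fin (p n) → ℝ} {r : ∀ n, Fin n → Ω n → ℝ} {K c : ℝ}
    {ρ : ℝ → ℝ → ℝ} {L μ D : ℝ} (hp : ∀ n, 2 ≤ p n)
    (S : ∀ n, RegressionSample (P n) (Z n) (r n) K c)
    (h : IsAmenablePenalty ρ L μ) (hD : tuningThreshold K c μ ≤ D * L) (hD0 : 0 < D)
    (hcase : IsLassoPenalty ρ L ∨ ∀ n i, ∀ v : Fin (p n) → ℝ, v ⬝ᵥ v = 1 →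
      psi2Norm (P n) (fun ω => Z n i ω ⬝ᵥ v) ≤ ENNReal.ofReal K)
    {γ0 : ∀ n, Fin (p n) → ℝ} {γ : ∀ n, Ω n → Fin (p n) → ℝ}
    (hγ0 : ∀ n i, psi2Norm (P n) (fun ω => Z n i ω ⬝ᵥ γ0 n) ≤ ENNReal.ofReal K)
    (hsparse : (fun n => (l0Norm (γ0 n) : ℝ)) =o[atTop] fun n : ℕ => √(n : ℝ) / Real.log (p n))
    (hmin : ∀ n, 1 ≤ n → ∀ ω, IsMinOn (penalizedLoss ρ (D * √(Real.log (p n) / n))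
      (fun i => Z n i ω ⬝ᵥ γ0 n + r n i ω) (fun i => Z n i ω)) Set.univ (γ n ω))
    {δ : ℝ} (hδ : 0 < δ) :
    ∃ p0 : ℕ, ∀ p1, p0 ≤ p1 → ∃ C : ℝ, ∀ᶠ n : ℕ in atTop,
      (P n).real {ω | ¬ ErrorBound (fun i => Z n i ω) (fun i => r n i ω) (γ n ω - γ0 n) C
        (activeCount p1 (p n) (l0Norm (γ0 n))) √(Real.log (p n) / n)} ≤ δ := by
  have S1 := S 1
  have hc := S1.c_pos
  have hK : 0 < K := zero_lt_one.trans_le S1.one_le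
  have hLp := h.L_pos
  have hμ := h.μ_pos
  -- Makes 4/p ≤ δ/3 in the high-dimensional case. Every larger threshold works as well, so two
  -- estimators can later share one.
  obtain ⟨p0, hp0⟩ := exists_nat_gt (12 / δ)
  refine ⟨p0, fun p1 hp1 => ?_⟩
  have hp1' : 12 / δ < p1 := hp0.trans_le (by exact_mod_cast hp1)
  have hp1p : (0 : ℝ) < p1 := lt_trans (by positivity) hp1'
  set B := 6 * K ^ 2 with hB
  -- Chosen so that p · 2B²/M² ≤ δ/2 whenever p < p1. The dependence on δ enters the error constant
  -- only, not D.
  set M := 1 + 4 * p1 * B ^ 2 / δ with hM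
  have hM0 : 0 ≤ 4 * p1 * B ^ 2 / δ := by positivity
  set b := 2 * M + D * L with hb
  set Clow := b + 8 * b / c + 32 * b ^ 2 / c with hClow
  -- Coercivity and the moment bound on Zᵀγ0 bound ‖γ0‖₂; with sparsity this makes the penalty of
  -- `γ0` small, as the a priori bound on R needs.
  have hγ2 : ∀ n, 0 < n → ∑ j, γ0 n j ^ 2 ≤ 2 * K ^ 2 / c := by
    intro n hn
    set i0 : Fin n := ⟨0, hn⟩
    have hm : Measurable fun ω => Z n i0 ω ⬝ᵥ γ0 n := by
      have : Measurable fun z : Fin (p n) → ℝ => z ⬝ᵥ γ0 n := by unfold dotProduct; fun_prop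
      exact this.comp ((S n).measurable_Z i0)
    have h1 := integral_even_pow_le_of_psi2 hm.aestronglyMeasurable hK.le (hγ0 n i0) 1
    simp only [mul_one, pow_one, Nat.cast_one] at h1
    have h2 := (S n).coercive i0 (γ0 n)
    rw [le_div_iff₀ hc]
    linarith
  have hrate := tendsto_sparsity hsparse
  set hh : ℕ → ℝ := fun n => (l0Norm (γ0 n) : ℝ) * Real.log (p n) / √(n : ℝ) with hhdef
  have ev1 : ∀ᶠ n in atTop, 32 * (12 * B) * (2 * hh n) < c := by
    have : Tendsto (fun n => 32 * (12 * B) * (2 * hh n)) atTop (𝓝 (32 * (12 * B) * (2 * 0))) :=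
      (hrate.const_mul 2).const_mul _
    rw [mul_zero, mul_zero] at this
    exact this.eventually (gt_mem_nhds hc)
  have ev2 : ∀ᶠ n in atTop, 2 * (D * L * (√(2 * hh n) * √(2 * K ^ 2 / c))) < 1 := by
    have h1 : Tendsto (fun n => √(2 * hh n)) atTop (𝓝 √(2 * 0)) := (hrate.const_mul 2).sqrt
    rw [mul_zero, Real.sqrt_zero] at h1
    have : Tendsto (fun n => 2 * (D * L * (√(2 * hh n) * √(2 * K ^ 2 / c)))) atTop
        (𝓝 (2 * (D * L * (0 * √(2 * K ^ 2 / c))))) :=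
      ((h1.mul_const _).const_mul _).const_mul _
    rw [zero_mul, mul_zero, mul_zero] at this
    exact this.eventually (gt_mem_nhds one_pos)
  have hnat : Tendsto (fun n : ℕ => (n : ℝ)) atTop atTop := tendsto_natCast_atTop_atTop
  have ev3 : ∀ᶠ n : ℕ in atTop, 16 * K ^ 4 / (n : ℝ) < δ / 3 :=
    (Tendsto.div_atTop tendsto_const_nhds hnat).eventually (gt_mem_nhds (by positivity))
  have ev4 : ∀ᶠ n : ℕ in atTop, Real.exp (-(n * (c ^ 2 / (128 * K ^ 4)) / 2)) < δ / 3 := by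
    have : Tendsto (fun n : ℕ => (n : ℝ) * (c ^ 2 / (128 * K ^ 4)) / 2) atTop atTop :=
      (hnat.atTop_mul_const (by positivity)).atTop_div_const (by norm_num)
    exact (Real.tendsto_exp_neg_atTop_nhds_zero.comp this).eventually
      (gt_mem_nhds (by positivity))
  have ev5 : ∀ᶠ n : ℕ in atTop, (8 * p1 ^ 4 * B ^ 2 / c ^ 2) / (n : ℝ) < δ / 2 :=
    (Tendsto.div_atTop tendsto_const_nhds hnat).eventually (gt_mem_nhds (by positivity))
  refine ⟨max (errorConst K c μ (D * L)) Clow, ?_⟩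
  filter_upwards [ev1, ev2, ev3, ev4, ev5, eventually_gt_atTop 0] with n hn1 hn2 hn3 hn4 hn5 hn
  have hn' : (0 : ℝ) < n := by exact_mod_cast hn
  set a := √(Real.log (p n) / n) with ha
  have ha0 : 0 < a := tuning_pos hn (hp n) ha
  have hp' : (2 : ℝ) ≤ p n := by exact_mod_cast hp n
  unfold activeCount
  split_ifs with hlt
  · have hlt' : (p n : ℝ) ≤ p1 := by exact_mod_cast hlt.le
    have h1 := (S n).measureReal_lowDim_error hn (hp n) h hD0 ha (hmin n hn)
      (by positivity : 0 < M)
    refine (measureReal_mono fun ω hω => ?_).trans (h1.trans ?_)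
    · intro hE
      refine hω ?_
      obtain ⟨g1, g2, g3⟩ := hE.mono (le_max_right (errorConst K c μ (D * L)) Clow)
        (by positivity) ha0.le
      have hC0 : 0 ≤ max (errorConst K c μ (D * L)) Clow :=
        le_trans (by positivity) (le_max_right _ _)
      exact ⟨g1, g2.trans (by gcongr), g3.trans (by gcongr)⟩
    · have e1 : (p n : ℝ) * p n * (2 * B ^ 2 / (n * (c / (2 * p n)) ^ 2)) =
          (8 * (p n : ℝ) ^ 4 * B ^ 2 / c ^ 2) / n := by field_simp; ring
      have e2 : (8 * (p n : ℝ) ^ 4 * B ^ 2 / c ^ 2) / n ≤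
          (8 * (p1 : ℝ) ^ 4 * B ^ 2 / c ^ 2) / n := by gcongr
      have e3 : (p n : ℝ) * (2 * B ^ 2 / M ^ 2) ≤ δ / 2 := by
        rw [← mul_div_assoc, div_le_iff₀ (by positivity)]
        have f1 : 4 * p1 * B ^ 2 / δ ≤ M ^ 2 := by nlinarith
        rw [div_le_iff₀ hδ] at f1
        have f2 : (p n : ℝ) * (2 * B ^ 2) ≤ p1 * (2 * B ^ 2) := by gcongr
        linarith
      rw [e1]
      linarith
  · have hge : (p1 : ℝ) ≤ p n := by exact_mod_cast not_lt.1 hlt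
    have hsm := sparsity_mul_max_le (s := fun n => l0Norm (γ0 n)) hp hn
    have h1 := (S n).measureReal_highDim_error hn (hp n) h hD
      (hcase.imp_right fun hv => hv n) ha (hmin n hn) (by
        refine le_trans (le_of_eq ?_) ((mul_le_mul_of_nonneg_left hsm
          (by positivity : 0 ≤ 32 * (12 * B))).trans hn1.le)
        ring) (by
        refine le_trans ?_ hn2.le
        calc 2 * (D * a * L * (√(l0Norm (γ0 n) : ℝ) * √(∑ j, γ0 n j ^ 2))) =
              2 * (D * L * (√((l0Norm (γ0 n) : ℝ) * a ^ 2) * √(∑ j, γ0 n j ^ 2))) := by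
              rw [Real.sqrt_mul (by positivity), Real.sqrt_sq ha0.le]
              ring
          _ ≤ _ := by
              have hmid : (l0Norm (γ0 n) : ℝ) * a ^ 2 ≤ 2 * hh n :=
                le_trans (mul_le_mul_of_nonneg_left (le_max_right _ _) (Nat.cast_nonneg _)) hsm
              have h3 := mul_le_mul (Real.sqrt_le_sqrt hmid) (Real.sqrt_le_sqrt (hγ2 n hn))
                (Real.sqrt_nonneg _) (Real.sqrt_nonneg _)
              exact mul_le_mul_of_nonneg_left
                (mul_le_mul_of_nonneg_left h3 (by positivity)) (by norm_num))
    refine (measureReal_mono fun ω hω => ?_).trans (h1.trans ?_)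
    · intro hE
      refine hω ?_
      exact hE.mono (le_max_left _ _) (by positivity) ha0.le
    · have : 4 / (p n : ℝ) ≤ δ / 3 := by
        rw [div_le_iff₀ (by linarith)]
        rw [div_lt_iff₀ hδ] at hp1'
        nlinarith
      linarith

end RegressionSample

/-! ### Effect of the estimation errors on the score. -/

section ScoreDeterministic

variable {n p : ℕ}

/-- Cauchy-Schwarz, then the ℓ² norm of the squares is bounded by their ℓ¹ norm. The lost factor √n
is affordable, as √n times the prediction error tends to zero. -/
lemma average_sq_mul_sq_le (x : Fin n → ℝ) (z : Fin n → Fin p → ℝ) (v : Fin p → ℝ) {b : ℝ}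
    (hb : 1 / (n : ℝ) * ∑ i, x i ^ 4 ≤ b) :
    1 / (n : ℝ) * ∑ i, x i ^ 2 * (z i ⬝ᵥ v) ^ 2 ≤ √b * (√(n : ℝ) * empQuad z v) := by
  rcases Nat.eq_zero_or_pos n with rfl | hn
  · simp [empQuad]
  have hn' : (0 : ℝ) < n := by exact_mod_cast hn
  have h1 := Finset.sum_mul_sq_le_sq_mul_sq Finset.univ (fun i => x i ^ 2)
    (fun i => (z i ⬝ᵥ v) ^ 2)
  have h2 : ∑ i, ((z i ⬝ᵥ v) ^ 2) ^ 2 ≤ (∑ i, (z i ⬝ᵥ v) ^ 2) ^ 2 :=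
    Finset.sum_sq_le_sq_sum_of_nonneg fun i _ => sq_nonneg _
  have e : ∀ i, (x i ^ 2) ^ 2 = x i ^ 4 := fun i => by ring
  simp_rw [e] at h1
  have hx : 0 ≤ ∑ i, x i ^ 4 := Finset.sum_nonneg fun i _ => by positivity
  have hb0 : 0 ≤ b := le_trans (by positivity) hb
  have h3 : ∑ i, x i ^ 4 ≤ n * b := by
    rwa [one_div, inv_mul_le_iff₀ hn'] at hb
  have h4 : ∑ i, x i ^ 2 * (z i ⬝ᵥ v) ^ 2 ≤ √(n * b) * ∑ i, (z i ⬝ᵥ v) ^ 2 := by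
    refine abs_le_of_sq_le_sq' ?_ (by positivity) |>.2
    rw [mul_pow, Real.sq_sqrt (by positivity)]
    exact h1.trans (by gcongr)
  rw [empQuad, Real.sqrt_mul hn'.le] at *
  calc 1 / (n : ℝ) * ∑ i, x i ^ 2 * (z i ⬝ᵥ v) ^ 2 ≤
        1 / (n : ℝ) * (√n * √b * ∑ i, (z i ⬝ᵥ v) ^ 2) := by gcongr
    _ = _ := by ring

lemma average_sq_mul_sq_quad_le (z : Fin n → Fin p → ℝ) (u v : Fin p → ℝ) :
    1 / (n : ℝ) * ∑ i, (z i ⬝ᵥ u) ^ 2 * (z i ⬝ᵥ v) ^ 2 ≤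
      (√(n : ℝ) * empQuad z u) * (√(n : ℝ) * empQuad z v) := by
  rcases Nat.eq_zero_or_pos n with rfl | hn
  · simp [empQuad]
  have hn' : (0 : ℝ) < n := by exact_mod_cast hn
  have h1 : ∑ i, (z i ⬝ᵥ u) ^ 2 * (z i ⬝ᵥ v) ^ 2 ≤
      (∑ i, (z i ⬝ᵥ u) ^ 2) * ∑ i, (z i ⬝ᵥ v) ^ 2 := by
    rw [Finset.sum_mul]
    exact Finset.sum_le_sum fun i hi => mul_le_mul_of_nonneg_left
      (Finset.single_le_sum (f := fun i => (z i ⬝ᵥ v) ^ 2) (fun j _ => sq_nonneg _) hi)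
      (sq_nonneg _)
  have hs : √(n : ℝ) * √(n : ℝ) = n := Real.mul_self_sqrt hn'.le
  calc 1 / (n : ℝ) * ∑ i, (z i ⬝ᵥ u) ^ 2 * (z i ⬝ᵥ v) ^ 2 ≤
        1 / (n : ℝ) * ((∑ i, (z i ⬝ᵥ u) ^ 2) * ∑ i, (z i ⬝ᵥ v) ^ 2) := by gcongr
    _ = (√(n : ℝ) * √(n : ℝ)) * (empQuad z u * empQuad z v) := by
        rw [hs]; unfold empQuad; field_simp
    _ = _ := by ring

lemma abs_average_cross_le (z : Fin n → Fin p → ℝ) (u v : Fin p → ℝ) :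
    |1 / (n : ℝ) * ∑ i, (z i ⬝ᵥ u) * (z i ⬝ᵥ v)| ≤ (empQuad z u + empQuad z v) / 2 := by
  rw [abs_mul, abs_of_nonneg (by positivity)]
  have h1 : |∑ i, (z i ⬝ᵥ u) * (z i ⬝ᵥ v)| ≤
      ∑ i, ((z i ⬝ᵥ u) ^ 2 + (z i ⬝ᵥ v) ^ 2) / 2 := by
    refine (Finset.abs_sum_le_sum_abs _ _).trans (Finset.sum_le_sum fun i _ => ?_)
    rw [abs_le]
    constructor <;> nlinarith [sq_nonneg (z i ⬝ᵥ u - z i ⬝ᵥ v), sq_nonneg (z i ⬝ᵥ u + z i ⬝ᵥ v)]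
  rw [← Finset.sum_div, Finset.sum_add_distrib] at h1
  calc 1 / (n : ℝ) * |∑ i, (z i ⬝ᵥ u) * (z i ⬝ᵥ v)| ≤
        1 / (n : ℝ) * ((∑ i, (z i ⬝ᵥ u) ^ 2 + ∑ i, (z i ⬝ᵥ v) ^ 2) / 2) := by gcongr
    _ = _ := by unfold empQuad; ring

/-- Hölder: small correlations times a small ℓ¹ error. The first-order effect of estimating a
nuisance parameter thus becomes of second order. -/
lemma abs_average_linear_le {z : Fin n → Fin p → ℝ} {r : Fin n → ℝ} {u : Fin p → ℝ}
    {C s a b : ℝ} (ha : 0 ≤ a) (hC : 0 ≤ C) (hg : ∀ j, |empGrad z r j| ≤ C * a)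
    (hu : ∑ j, |u j| ≤ C * s * a) (hb : C ^ 2 * (s * a ^ 2) ≤ b) :
    |1 / (n : ℝ) * ∑ i, r i * (z i ⬝ᵥ u)| ≤ b := by
  rw [sum_mul_dotProduct_eq]
  refine (abs_sum_mul_le Finset.univ hg).trans (le_trans ?_ hb)
  calc C * a * ∑ j, |u j| ≤ C * a * (C * s * a) := by gcongr
    _ = _ := by ring

/-- The effect of the estimation errors `u`, `v` on the sum and the sum of squares of the score,
in terms of a rate `w`. -/
lemma score_perturbation_bound {z : Fin n → Fin p → ℝ} {q r S ξ : Fin n → ℝ} {u v : Fin p → ℝ}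
    {C su sv a b w : ℝ} (hn : 0 < n) (ha : 0 ≤ a) (hC : 1 ≤ C) (hsu : 0 ≤ su) (hsv : 0 ≤ sv)
    (hS : ∀ i, S i - ξ i = -(r i * (z i ⬝ᵥ u)) - q i * (z i ⬝ᵥ v) + (z i ⬝ᵥ u) * (z i ⬝ᵥ v))
    (hu : ErrorBound z q u C su a) (hv : ErrorBound z r v C sv a)
    (hq : 1 / (n : ℝ) * ∑ i, q i ^ 4 ≤ b) (hr : 1 / (n : ℝ) * ∑ i, r i ^ 4 ≤ b)
    (hw : √(n : ℝ) * (C ^ 2 * ((su + sv) * a ^ 2)) ≤ w) :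
    |1 / √(n : ℝ) * ∑ i, S i - 1 / √(n : ℝ) * ∑ i, ξ i| ≤ 3 * w ∧
      1 / (n : ℝ) * ∑ i, (S i - ξ i) ^ 2 ≤ 3 * (2 * (√b * w) + w ^ 2) := by
  have hn' : (0 : ℝ) < n := by exact_mod_cast hn
  have hs : 0 < √(n : ℝ) := Real.sqrt_pos.2 hn'
  obtain ⟨u1, u2, u3⟩ := hu
  obtain ⟨v1, v2, v3⟩ := hv
  have hC0 : 0 ≤ C := by linarith
  have hCC : C ≤ C ^ 2 := by nlinarith
  set t := C ^ 2 * ((su + sv) * a ^ 2) with ht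
  have k1 : C ^ 2 * (su * a ^ 2) ≤ t := by rw [ht]; gcongr; linarith
  have k2 : C ^ 2 * (sv * a ^ 2) ≤ t := by rw [ht]; gcongr; linarith
  have l1 := abs_average_linear_le ha hC0 v1 u2 k1
  have l2 := abs_average_linear_le ha hC0 u1 v2 k2
  have l3 := abs_average_cross_le z u v
  have q1 : empQuad z u ≤ t := u3.trans (le_trans (by rw [mul_assoc]; gcongr) k1)
  have q2 : empQuad z v ≤ t := v3.trans (le_trans (by rw [mul_assoc]; gcongr) k2)
  have Q1 := empQuad_nonneg z u
  have Q2 := empQuad_nonneg z v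
  have w1 : √(n : ℝ) * empQuad z u ≤ w := le_trans (by gcongr) hw
  have w2 : √(n : ℝ) * empQuad z v ≤ w := le_trans (by gcongr) hw
  have hw0 : 0 ≤ w := le_trans (by positivity) w1
  constructor
  · have e1 : 1 / √(n : ℝ) * ∑ i, S i - 1 / √(n : ℝ) * ∑ i, ξ i =
        √(n : ℝ) * (-(1 / (n : ℝ) * ∑ i, r i * (z i ⬝ᵥ u)) - 1 / (n : ℝ) * ∑ i, q i * (z i ⬝ᵥ v) +
          1 / (n : ℝ) * ∑ i, (z i ⬝ᵥ u) * (z i ⬝ᵥ v)) := by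
      have e2 : 1 / √(n : ℝ) = √(n : ℝ) * (1 / n) := by
        have := Real.sq_sqrt hn'.le
        field_simp
        linarith
      rw [← mul_sub, ← Finset.sum_sub_distrib, e2]
      simp_rw [hS]
      rw [Finset.sum_add_distrib, Finset.sum_sub_distrib, Finset.sum_neg_distrib]
      ring
    rw [e1, abs_mul, abs_of_pos hs]
    have e3 : |-(1 / (n : ℝ) * ∑ i, r i * (z i ⬝ᵥ u)) - 1 / (n : ℝ) * ∑ i, q i * (z i ⬝ᵥ v) +
          1 / (n : ℝ) * ∑ i, (z i ⬝ᵥ u) * (z i ⬝ᵥ v)| ≤ 3 * t := by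
      rw [abs_le] at l1 l2 l3 ⊢
      constructor <;> linarith [l1.1, l1.2, l2.1, l2.2, l3.1, l3.2]
    calc √(n : ℝ) * _ ≤ √(n : ℝ) * (3 * t) := by gcongr
      _ = 3 * (√(n : ℝ) * t) := by ring
      _ ≤ _ := by gcongr
  · have m1 := average_sq_mul_sq_le r z u hr
    have m2 := average_sq_mul_sq_le q z v hq
    have m3 := average_sq_mul_sq_quad_le z u v
    have m0 : ∑ i, (S i - ξ i) ^ 2 ≤ ∑ i, 3 * (r i ^ 2 * (z i ⬝ᵥ u) ^ 2 +
        q i ^ 2 * (z i ⬝ᵥ v) ^ 2 + (z i ⬝ᵥ u) ^ 2 * (z i ⬝ᵥ v) ^ 2) := by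
      refine Finset.sum_le_sum fun i _ => ?_
      rw [hS]
      nlinarith [sq_nonneg (r i * (z i ⬝ᵥ u) - q i * (z i ⬝ᵥ v)),
        sq_nonneg (r i * (z i ⬝ᵥ u) + (z i ⬝ᵥ u) * (z i ⬝ᵥ v)),
        sq_nonneg (q i * (z i ⬝ᵥ v) + (z i ⬝ᵥ u) * (z i ⬝ᵥ v))]
    rw [← Finset.mul_sum, Finset.sum_add_distrib, Finset.sum_add_distrib] at m0
    have m4 : √b * (√(n : ℝ) * empQuad z u) ≤ √b * w := by gcongr
    have m5 : √b * (√(n : ℝ) * empQuad z v) ≤ √b * w := by gcongr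
    have m6 : (√(n : ℝ) * empQuad z u) * (√(n : ℝ) * empQuad z v) ≤ w ^ 2 := by
      rw [sq]; gcongr
    calc 1 / (n : ℝ) * ∑ i, (S i - ξ i) ^ 2 ≤ 1 / (n : ℝ) * (3 * (∑ i, r i ^ 2 * (z i ⬝ᵥ u) ^ 2 +
        ∑ i, q i ^ 2 * (z i ⬝ᵥ v) ^ 2 + ∑ i, (z i ⬝ᵥ u) ^ 2 * (z i ⬝ᵥ v) ^ 2)) := by gcongr
      _ = 3 * (1 / (n : ℝ) * ∑ i, r i ^ 2 * (z i ⬝ᵥ u) ^ 2 +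
          1 / (n : ℝ) * ∑ i, q i ^ 2 * (z i ⬝ᵥ v) ^ 2 +
          1 / (n : ℝ) * ∑ i, (z i ⬝ᵥ u) ^ 2 * (z i ⬝ᵥ v) ^ 2) := by ring
      _ ≤ _ := by linarith

end ScoreDeterministic

namespace RegressionSample

/-- Chebyshev for the fourth powers, with the eighth moment as second moment. It supplies the bounds
`hq` and `hr` of `score_perturbation_bound`. -/
lemma fourth_moment_level {n p : ℕ} {Ω : Type*} [MeasurableSpace Ω] {P : Measure Ω}
    [IsProbabilityMeasure P] {Z : Fin n → Ω → Fin p → ℝ} {r : Fin n → Ω → ℝ} {K c : ℝ}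
    (S : RegressionSample P Z r K c) (hn : 0 < n) :
    P.real {ω | ¬ 1 / (n : ℝ) * ∑ i, r i ω ^ 4 ≤ 16 * K ^ 4 + 1} ≤ 4096 * K ^ 8 / n := by
  have e : ∀ i ω, (r i ω ^ 4) ^ 2 = r i ω ^ 8 := fun i ω => by ring
  have hi : ∀ i k, Integrable (fun ω => r i ω ^ k) P := fun i k =>
    integrable_pow_of_psi2 (S.measurable_r i).aestronglyMeasurable S.K_nonneg (S.psi_r i) k
  have h := chebyshev_average hn (ξ := fun i ω => r i ω ^ 4) (P := P)
    (m := ∫ ω, r ⟨0, hn⟩ ω ^ 4 ∂P) (V := 4096 * K ^ 8)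
    (S.indep.comp (fun _ x => x.2 ^ 4) (fun _ => by fun_prop))
    (fun i => by
      rw [memLp_two_iff_integrable_sq ((S.measurable_r i).pow_const 4).aestronglyMeasurable]
      simp_rw [e]
      exact hi i 8)
    (fun i => ((S.ident i ⟨0, hn⟩).comp (u := fun x : (Fin p → ℝ) × ℝ => x.2 ^ 4)
      (by fun_prop)).integral_eq)
    (fun i => by
      simp_rw [e]
      have h := integral_even_pow_le_of_psi2 (S.measurable_r i).aestronglyMeasurable S.K_nonneg
        (S.psi_r i) 4
      norm_num at h
      linarith [h, (by ring : (2 * K ^ 2) ^ 4 * 256 = 4096 * K ^ 8)]) one_pos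
  rw [one_pow, mul_one] at h
  refine (measureReal_mono fun ω hω => ?_).trans h
  have h1 := S.integral_r_four_le ⟨0, hn⟩
  rw [Set.mem_ofPred_eq, not_le] at hω
  rw [Set.mem_ofPred_eq]
  exact le_abs.2 (Or.inl (by linarith))

/-- The estimated score is asymptotically equivalent to the score at the true parameters. -/
theorem tendsto_score_perturbation {p : ℕ → ℕ} {Ω : ℕ → Type u} [∀ n, MeasurableSpace (Ω n)]
    {P : ∀ n, Measure (Ω n)} [∀ n, IsProbabilityMeasure (P n)]
    {Z : ∀ n, Fin n → Ω n → Fin (p n) → ℝ} {q r S ξ : ∀ n, Fin n → Ω n → ℝ} {K c : ℝ}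
    (hp : ∀ n, 2 ≤ p n)
    (Sq : ∀ n, RegressionSample (P n) (Z n) (q n) K c)
    (Sr : ∀ n, RegressionSample (P n) (Z n) (r n) K c)
    {u v : ∀ n, Ω n → Fin (p n) → ℝ} {su sv : ℕ → ℕ}
    (hsu : (fun n => (su n : ℝ)) =o[atTop] fun n : ℕ => √(n : ℝ) / Real.log (p n))
    (hsv : (fun n => (sv n : ℝ)) =o[atTop] fun n : ℕ => √(n : ℝ) / Real.log (p n))
    (hu : ∀ δ > 0, ∃ p0 : ℕ, ∀ p1, p0 ≤ p1 → ∃ C : ℝ, ∀ᶠ n : ℕ in atTop,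
      (P n).real {ω | ¬ ErrorBound (fun i => Z n i ω) (fun i => q n i ω) (u n ω) C
        (activeCount p1 (p n) (su n)) √(Real.log (p n) / n)} ≤ δ)
    (hv : ∀ δ > 0, ∃ p0 : ℕ, ∀ p1, p0 ≤ p1 → ∃ C : ℝ, ∀ᶠ n : ℕ in atTop,
      (P n).real {ω | ¬ ErrorBound (fun i => Z n i ω) (fun i => r n i ω) (v n ω) C
        (activeCount p1 (p n) (sv n)) √(Real.log (p n) / n)} ≤ δ)
    (hS : ∀ n i ω, S n i ω - ξ n i ω = -(r n i ω * (Z n i ω ⬝ᵥ u n ω)) -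
      q n i ω * (Z n i ω ⬝ᵥ v n ω) + (Z n i ω ⬝ᵥ u n ω) * (Z n i ω ⬝ᵥ v n ω))
    {κ : ℝ} (hκ : 0 < κ) :
    Tendsto (fun n => (P n).real
      {ω | κ < |1 / √(n : ℝ) * ∑ i, S n i ω - 1 / √(n : ℝ) * ∑ i, ξ n i ω|}) atTop (𝓝 0) ∧
    Tendsto (fun n => (P n).real
      {ω | κ < 1 / (n : ℝ) * ∑ i, (S n i ω - ξ n i ω) ^ 2}) atTop (𝓝 0) := by
  have key : ∀ δ > 0, ∀ᶠ n : ℕ in atTop, (P n).real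
      {ω | ¬ (|1 / √(n : ℝ) * ∑ i, S n i ω - 1 / √(n : ℝ) * ∑ i, ξ n i ω| ≤ κ ∧
        1 / (n : ℝ) * ∑ i, (S n i ω - ξ n i ω) ^ 2 ≤ κ)} ≤ δ := by
    intro δ hδ
    obtain ⟨pu, hpu⟩ := hu (δ / 4) (by positivity)
    obtain ⟨pv, hpv⟩ := hv (δ / 4) (by positivity)
    -- Both estimators must be split at the same dimension; the failure probability δ is shared by
    -- two error bounds and two fourth-moment bounds.
    obtain ⟨Cu, hCu⟩ := hpu (max pu pv) (le_max_left _ _)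
    obtain ⟨Cv, hCv⟩ := hpv (max pu pv) (le_max_right _ _)
    set p1 := max pu pv
    set C := max 1 (max Cu Cv) with hC
    have hC1 : 1 ≤ C := le_max_left _ _
    set b := 16 * K ^ 4 + 1
    set w : ℕ → ℝ := fun n => √(n : ℝ) * (C ^ 2 * (((activeCount p1 (p n) (su n) : ℝ) +
      activeCount p1 (p n) (sv n)) * √(Real.log (p n) / n) ^ 2)) with hw
    have hwlim : Tendsto w atTop (𝓝 0) := by
      have h1 := ((tendsto_activeCount hp p1 hsu).add (tendsto_activeCount hp p1 hsv)).const_mul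
        (C ^ 2)
      rw [add_zero, mul_zero] at h1
      refine h1.congr fun n => ?_
      rw [hw]; ring
    have hlim1 : Tendsto (fun n => 3 * w n) atTop (𝓝 (3 * 0)) := hwlim.const_mul 3
    have hlim2 : Tendsto (fun n => 3 * (2 * (√b * w n) + w n ^ 2)) atTop
        (𝓝 (3 * (2 * (√b * 0) + 0 ^ 2))) :=
      (((hwlim.const_mul _).const_mul 2).add (hwlim.pow 2)).const_mul 3
    simp only [mul_zero, ne_eq, OfNat.ofNat_ne_zero, not_false_eq_true, zero_pow, add_zero]
      at hlim1 hlim2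
    have hlim3 : Tendsto (fun n : ℕ => 4096 * K ^ 8 / (n : ℝ)) atTop (𝓝 0) :=
      Tendsto.div_atTop tendsto_const_nhds tendsto_natCast_atTop_atTop
    filter_upwards [hCu, hCv, hlim1.eventually (gt_mem_nhds hκ), hlim2.eventually (gt_mem_nhds hκ),
      hlim3.eventually (gt_mem_nhds (by positivity : (0 : ℝ) < δ / 4)), eventually_gt_atTop 0]
      with n h1 h2 h3 h4 h5 hn
    have h6 := (Sq n).fourth_moment_level hn
    have h7 := (Sr n).fourth_moment_level hn
    refine (measureReal_mono fun ω hω => ?_).trans ((measureReal_union_le _ _).trans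
      ((add_le_add ((measureReal_union_le _ _).trans (add_le_add h1 h2))
        ((measureReal_union_le _ _).trans (add_le_add h6 h7))).trans (by linarith)))
    by_contra hcon
    rw [Set.mem_union, Set.mem_union, Set.mem_union, not_or, not_or, not_or] at hcon
    obtain ⟨⟨g1, g2⟩, g3, g4⟩ := hcon
    rw [Set.mem_ofPred_eq, not_not] at g1 g2 g3 g4
    refine hω ?_
    have ha := Real.sqrt_nonneg (Real.log (p n) / n)
    have g := score_perturbation_bound hn ha hC1 (Nat.cast_nonneg _) (Nat.cast_nonneg _)
      (fun i => hS n i ω)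
      (g1.mono ((le_max_left _ _).trans (le_max_right _ _)) (Nat.cast_nonneg _) ha)
      (g2.mono ((le_max_right _ _).trans (le_max_right _ _)) (Nat.cast_nonneg _) ha) g3 g4
      (le_refl (w n))
    exact ⟨g.1.trans h3.le, g.2.trans h4.le⟩
  constructor
  · refine tendsto_zero_of_eventually_le (fun n => measureReal_nonneg) fun δ hδ => ?_
    filter_upwards [key δ hδ] with n hn
    refine (measureReal_mono fun ω hω => ?_).trans hn
    exact fun h => absurd h.1 (not_le.2 hω)
  · refine tendsto_zero_of_eventually_le (fun n => measureReal_nonneg) fun δ hδ => ?_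
    filter_upwards [key δ hδ] with n hn
    refine (measureReal_mono fun ω hω => ?_).trans hn
    exact fun h => absurd h.2 (not_le.2 hω)

end RegressionSample

/-! ### Population normal equations and quadratic forms. -/

section SecondOrder

variable {p : ℕ} {Ω : Type*} [MeasurableSpace Ω] {P : Measure Ω}

lemma measurable_dotProduct_const (v : Fin p → ℝ) : Measurable fun z : Fin p → ℝ => z ⬝ᵥ v := by
  unfold dotProduct
  fun_prop

/-- The normal equations of the population least squares problem. -/
lemma integral_mul_residual_eq_zero {x : Ω → ℝ} {z : Ω → Fin p → ℝ} {θ : Fin p → ℝ}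
    (hx : MemLp (fun ω => x ω - z ω ⬝ᵥ θ) 2 P) (hz : ∀ j, MemLp (fun ω => z ω j) 2 P)
    (h : IsMinOn (fun θ : Fin p → ℝ => ∫ ω, (x ω - z ω ⬝ᵥ θ) ^ 2 ∂P) Set.univ θ) (j : Fin p) :
    ∫ ω, z ω j * (x ω - z ω ⬝ᵥ θ) ∂P = 0 := by
  set A := ∫ ω, z ω j * (x ω - z ω ⬝ᵥ θ) ∂P with hA
  set B := ∫ ω, z ω j ^ 2 ∂P with hB
  have hB0 : 0 ≤ B := integral_nonneg fun ω => sq_nonneg _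
  have i1 := hx.integrable_sq
  have i2 : Integrable (fun ω => z ω j * (x ω - z ω ⬝ᵥ θ)) P := (hz j).integrable_mul hx
  have i3 := (hz j).integrable_sq
  -- Minimality against θ + t e_j.
  have key : ∀ t : ℝ, 0 ≤ -(2 * t * A) + t ^ 2 * B := by
    intro t
    have h1 := isMinOn_univ_iff.1 h (θ + t • Pi.single j 1)
    have e : ∀ ω, (x ω - z ω ⬝ᵥ (θ + t • Pi.single j 1)) ^ 2 = (x ω - z ω ⬝ᵥ θ) ^ 2 -
        (2 * t) * (z ω j * (x ω - z ω ⬝ᵥ θ)) + t ^ 2 * z ω j ^ 2 := by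
      intro ω
      rw [dotProduct_add, dotProduct_smul, dotProduct_single_one, smul_eq_mul]
      ring
    simp_rw [e] at h1
    rw [integral_add (by exact i1.sub (i2.const_mul _)) (i3.const_mul _),
      integral_sub i1 (i2.const_mul _), integral_const_mul, integral_const_mul] at h1
    linarith
  -- B + 1 replaces B in the optimal t because B may vanish.
  have h1 := key (A / (B + 1))
  have h2 : -(2 * (A / (B + 1)) * A) + (A / (B + 1)) ^ 2 * B =
      -(A ^ 2 * (B + 2) / (B + 1) ^ 2) := by
    field_simp
    ring
  rw [h2] at h1
  have h3 : A ^ 2 * (B + 2) / (B + 1) ^ 2 ≤ 0 := by linarith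
  rw [div_le_iff₀ (by positivity), zero_mul] at h3
  nlinarith [sq_nonneg A]

lemma integral_mul_eq_zero_of_indepFun {x y : Ω → ℝ} (h : IndepFun x y P) (hx : Measurable x)
    (hy : Measurable y) (h0 : ∫ ω, x ω ∂P = 0) : ∫ ω, x ω * y ω ∂P = 0 := by
  rw [h.integral_fun_mul_eq_mul_integral hx.aestronglyMeasurable hy.aestronglyMeasurable, h0,
    zero_mul]

/-- Subtracting c times the identity shifts the spectrum by c, so the difference is positive
semidefinite. -/
lemma Matrix.IsHermitian.quadraticForm_ge {m : ℕ} {A : Matrix (Fin m) (Fin m) ℝ}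
    (hA : A.IsHermitian) {c : ℝ} (h : ∀ κ ∈ spectrum ℝ A, c ≤ κ) (x : Fin m → ℝ) :
    c * (x ⬝ᵥ x) ≤ x ⬝ᵥ A.mulVec x := by
  have h1 : (A - algebraMap ℝ _ c).PosSemidef := by
    rw [Matrix.posSemidef_iff_isHermitian_and_spectrum_nonneg]
    refine ⟨hA.sub ?_, fun κ hκ => ?_⟩
    · rw [Algebra.algebraMap_eq_smul_one]
      exact Matrix.isHermitian_one.smul (by simp [IsSelfAdjoint])
    · rw [← spectrum.sub_singleton_eq] at hκ
      obtain ⟨k, hk, rfl⟩ := by simpa using hκ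
      simpa using h k hk
  have h2 := h1.dotProduct_mulVec_nonneg x
  rw [Matrix.sub_mulVec, Algebra.algebraMap_eq_smul_one, Matrix.smul_mulVec, Matrix.one_mulVec,
    dotProduct_sub, dotProduct_smul, smul_eq_mul] at h2
  simp only [star_trivial] at h2
  linarith

lemma integral_dotProduct_sq {z : Ω → Fin p → ℝ} (hz : ∀ j, MemLp (fun ω => z ω j) 2 P)
    (v : Fin p → ℝ) :
    ∫ ω, (z ω ⬝ᵥ v) ^ 2 ∂P = ∑ j, ∑ k, v j * ((∫ ω, z ω j * z ω k ∂P) * v k) := by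
  have e : ∀ ω, (z ω ⬝ᵥ v) ^ 2 = ∑ j, ∑ k, v j * (z ω j * z ω k * v k) := by
    intro ω
    rw [sq, dotProduct, Finset.sum_mul_sum]
    exact Finset.sum_congr rfl fun j _ => Finset.sum_congr rfl fun k _ => by ring
  have hi : ∀ j k, Integrable (fun ω => v j * (z ω j * z ω k * v k)) P := fun j k =>
    (((hz j).integrable_mul (hz k)).mul_const _).const_mul _
  simp_rw [e]
  rw [integral_finsetSum _ fun j _ => integrable_finsetSum _ fun k _ => hi j k]
  refine Finset.sum_congr rfl fun j _ => ?_
  rw [integral_finsetSum _ fun k _ => hi j k]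
  refine Finset.sum_congr rfl fun k _ => ?_
  rw [integral_const_mul, integral_mul_const]

end SecondOrder

/-! ### Residuals and score of the measurement error model. -/

namespace MEModel

variable {n p : ℕ} {Ω : Type*} {M : MEModel n p Ω} {β0 : ℝ} {θ0 γ0 : Fin p → ℝ}

/-- The residual `W_i - Z_iᵀ θ0`. -/
def residualW (M : MEModel n p Ω) (θ0 : Fin p → ℝ) (i : Fin n) (ω : Ω) : ℝ :=
  M.W i ω - M.Z i ω ⬝ᵥ θ0

/-- The residual `Y_i - W_i β₀ - Z_iᵀ γ0`. -/
def residualY (M : MEModel n p Ω) (β0 : ℝ) (γ0 : Fin p → ℝ) (i : Fin n) (ω : Ω) : ℝ :=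
  M.Y β0 i ω - M.W i ω * β0 - M.Z i ω ⬝ᵥ γ0

/-- The score at the true parameters. -/
def score (M : MEModel n p Ω) (β0 : ℝ) (θ0 γ0 : Fin p → ℝ) (i : Fin n) (ω : Ω) : ℝ :=
  M.residualW θ0 i ω * M.residualY β0 γ0 i ω + M.sigmaU ^ 2 * β0

lemma residualW_eq (i : Fin n) (ω : Ω) :
    M.residualW θ0 i ω = M.X i ω - M.Z i ω ⬝ᵥ θ0 + M.U i ω := by
  simp only [residualW, W]; ring

lemma residualY_eq (i : Fin n) (ω : Ω) : M.residualY β0 γ0 i ω =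
    M.ε i ω - β0 * M.U i ω + (M.g (M.Z i ω) - M.Z i ω ⬝ᵥ γ0) := by
  simp only [residualY, W, Y]; ring

variable [MeasurableSpace Ω] {P : Measure Ω}

lemma SubGaussianBound.mono {K K' : ℝ} (h : M.SubGaussianBound P θ0 γ0 K) (hK : K ≤ K') :
    M.SubGaussianBound P θ0 γ0 K' where
  ε i := psi2Norm_mono (h.ε i) hK
  U i := psi2Norm_mono (h.U i) hK
  η i := psi2Norm_mono (h.η i) hK
  Z i j := psi2Norm_mono (h.Z i j) hK
  X i := psi2Norm_mono (h.X i) hK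
  Zθ0 i := psi2Norm_mono (h.Zθ0 i) hK
  Zγ0 i := psi2Norm_mono (h.Zγ0 i) hK

namespace Standing

lemma measurable_X (S : M.Standing P) (i : Fin n) : Measurable (M.X i) :=
  (S.measurable_f.comp (S.measurable_Z i)).add (S.measurable_η i)

lemma measurable_W (S : M.Standing P) (i : Fin n) : Measurable (M.W i) :=
  (S.measurable_X i).add (S.measurable_U i)

lemma measurable_Y (S : M.Standing P) (β0 : ℝ) (i : Fin n) : Measurable (M.Y β0 i) :=
  (((S.measurable_X i).mul_const β0).add (S.measurable_g.comp (S.measurable_Z i))).add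
    (S.measurable_ε i)

lemma measurable_Z_dotProduct (S : M.Standing P) (i : Fin n) (v : Fin p → ℝ) :
    Measurable fun ω => M.Z i ω ⬝ᵥ v :=
  (measurable_dotProduct_const v).comp (S.measurable_Z i)

lemma measurable_residualW (S : M.Standing P) (θ0 : Fin p → ℝ) (i : Fin n) :
    Measurable (M.residualW θ0 i) :=
  (S.measurable_W i).sub (S.measurable_Z_dotProduct i θ0)

lemma measurable_residualY (S : M.Standing P) (β0 : ℝ) (γ0 : Fin p → ℝ) (i : Fin n) :
    Measurable (M.residualY β0 γ0 i) :=
  ((S.measurable_Y β0 i).sub ((S.measurable_W i).mul_const β0)).sub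
    (S.measurable_Z_dotProduct i γ0)

/-- Covariates and residuals are the image of the primitive variables under a measurable map. -/
lemma exists_residual_map (S : M.Standing P) (β0 : ℝ) (θ0 γ0 : Fin p → ℝ) :
    ∃ φ : (Fin p → ℝ) × ℝ × ℝ × ℝ → (Fin p → ℝ) × ℝ × ℝ, Measurable φ ∧
      ∀ i ω, φ (M.Z i ω, M.η i ω, M.ε i ω, M.U i ω) =
        (M.Z i ω, M.residualW θ0 i ω, M.residualY β0 γ0 i ω) := by
  have hf := S.measurable_f
  have hg := S.measurable_g
  have h1 := measurable_dotProduct_const θ0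
  have h2 := measurable_dotProduct_const γ0
  refine ⟨fun x => (x.1, M.f x.1 + x.2.1 + x.2.2.2 - x.1 ⬝ᵥ θ0,
    (M.f x.1 + x.2.1) * β0 + M.g x.1 + x.2.2.1 - (M.f x.1 + x.2.1 + x.2.2.2) * β0 - x.1 ⬝ᵥ γ0),
    ?_, fun i ω => rfl⟩
  have k1 : Measurable fun x : (Fin p → ℝ) × ℝ × ℝ × ℝ => M.f x.1 := hf.comp measurable_fst
  have k2 : Measurable fun x : (Fin p → ℝ) × ℝ × ℝ × ℝ => M.g x.1 := hg.comp measurable_fst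
  have k3 : Measurable fun x : (Fin p → ℝ) × ℝ × ℝ × ℝ => x.1 ⬝ᵥ θ0 := h1.comp measurable_fst
  have k4 : Measurable fun x : (Fin p → ℝ) × ℝ × ℝ × ℝ => x.1 ⬝ᵥ γ0 := h2.comp measurable_fst
  fun_prop

lemma indep_residual (S : M.Standing P) (β0 : ℝ) (θ0 γ0 : Fin p → ℝ) :
    iIndepFun (fun i ω => (M.Z i ω, M.residualW θ0 i ω, M.residualY β0 γ0 i ω)) P := by
  obtain ⟨φ, hφ, he⟩ := S.exists_residual_map β0 θ0 γ0
  have h := S.indep.comp (fun _ => φ) fun _ => hφ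
  convert h using 2 with i
  ext1 ω
  exact (he i ω).symm

lemma ident_residual (S : M.Standing P) (β0 : ℝ) (θ0 γ0 : Fin p → ℝ) (i j : Fin n) :
    IdentDistrib (fun ω => (M.Z i ω, M.residualW θ0 i ω, M.residualY β0 γ0 i ω))
      (fun ω => (M.Z j ω, M.residualW θ0 j ω, M.residualY β0 γ0 j ω)) P P := by
  obtain ⟨φ, hφ, he⟩ := S.exists_residual_map β0 θ0 γ0
  have h := (S.identDistrib i j).comp hφ
  simpa only [Function.comp_def, he] using h

variable {A c : ℝ}

lemma psi2Norm_residualW_le (S : M.Standing P) (hB : M.SubGaussianBound P θ0 γ0 A) (hA : 0 ≤ A)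
    (i : Fin n) : psi2Norm P (M.residualW θ0 i) ≤ ENNReal.ofReal (3 * A) := by
  have m1 := (S.measurable_X i).aestronglyMeasurable (μ := P)
  have m2 := (S.measurable_Z_dotProduct i θ0).aestronglyMeasurable (μ := P)
  have h1 := psi2Norm_const_mul_le hA (-1) (hB.Zθ0 i)
  have h2 := psi2Norm_add_le m1 (m2.const_mul (-1)) hA (by positivity) (hB.X i) h1
  have h3 := psi2Norm_add_le (m1.add (m2.const_mul (-1)))
    (S.measurable_U i).aestronglyMeasurable (by positivity) hA h2 (hB.U i)
  have e : (A + |(-1 : ℝ)| * A + A) = 3 * A := by norm_num; ring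
  rw [e] at h3
  convert h3 using 2
  ext ω
  rw [residualW_eq]
  simp only [Pi.add_apply]
  ring

lemma psi2Norm_residualY_le (S : M.Standing P) (hB : M.SubGaussianBound P θ0 γ0 A) (hA : 0 ≤ A)
    (hg : ∀ i, psi2Norm P (fun ω => M.g (M.Z i ω)) ≤ ENNReal.ofReal A)
    (i : Fin n) : psi2Norm P (M.residualY β0 γ0 i) ≤ ENNReal.ofReal ((3 + |β0|) * A) := by
  have m1 := (S.measurable_ε i).aestronglyMeasurable (μ := P)
  have m2 := (S.measurable_U i).aestronglyMeasurable (μ := P)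
  have m3 := (S.measurable_g.comp (S.measurable_Z i)).aestronglyMeasurable (μ := P)
  have m4 := (S.measurable_Z_dotProduct i γ0).aestronglyMeasurable (μ := P)
  have h1 := psi2Norm_add_le m1 (m2.const_mul (-β0)) hA (by positivity) (hB.ε i)
    (psi2Norm_const_mul_le hA (-β0) (hB.U i))
  have h2 := psi2Norm_add_le m3 (m4.const_mul (-1)) hA (by positivity) (hg i)
    (psi2Norm_const_mul_le hA (-1) (hB.Zγ0 i))
  have h3 := psi2Norm_add_le (m1.add (m2.const_mul (-β0))) (m3.add (m4.const_mul (-1)))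
    (by positivity) (by positivity) h1 h2
  have e : (A + |-β0| * A + (A + |(-1 : ℝ)| * A)) = (3 + |β0|) * A := by
    rw [abs_neg, abs_neg, abs_one]; ring
  rw [e] at h3
  convert h3 using 2
  ext ω
  rw [residualY_eq]
  simp only [Pi.add_apply, Function.comp_apply]
  ring

lemma integral_Z_mul_U (S : M.Standing P) (i : Fin n) (j : Fin p) :
    ∫ ω, M.Z i ω j * M.U i ω ∂P = 0 := by
  simp_rw [mul_comm (M.Z i _ j)]
  exact integral_mul_eq_zero_of_indepFun ((S.indep_U i).comp (φ := id)
    (ψ := fun x : ℝ × (Fin p → ℝ) × ℝ => x.2.1 j) measurable_id (by fun_prop))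
    (S.measurable_U i) ((measurable_pi_apply j).comp (S.measurable_Z i)) (S.mean_U i)

lemma measurable_score (S : M.Standing P) (β0 : ℝ) (θ0 γ0 : Fin p → ℝ) (i : Fin n) :
    Measurable (M.score β0 θ0 γ0 i) :=
  ((S.measurable_residualW θ0 i).mul (S.measurable_residualY β0 γ0 i)).add_const _

lemma indep_score (S : M.Standing P) (β0 : ℝ) (θ0 γ0 : Fin p → ℝ) :
    iIndepFun (M.score β0 θ0 γ0) P :=
  (S.indep_residual β0 θ0 γ0).comp (fun _ x => x.2.1 * x.2.2 + M.sigmaU ^ 2 * β0)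
    fun _ => by fun_prop

lemma ident_score (S : M.Standing P) (β0 : ℝ) (θ0 γ0 : Fin p → ℝ) (i j : Fin n) :
    IdentDistrib (M.score β0 θ0 γ0 i) (M.score β0 θ0 γ0 j) P P :=
  (S.ident_residual β0 θ0 γ0 i j).comp
    (u := fun x : (Fin p → ℝ) × ℝ × ℝ => x.2.1 * x.2.2 + M.sigmaU ^ 2 * β0) (by fun_prop)

variable [IsProbabilityMeasure P]

lemma memLp_two_of_psi2 {x : Ω → ℝ} (hx : Measurable x) (hA : 0 ≤ A)
    (h : psi2Norm P x ≤ ENNReal.ofReal A) : MemLp x 2 P := by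
  simpa using memLp_of_psi2 hx.aestronglyMeasurable hA h 2

lemma memLp_Z (S : M.Standing P) (hB : M.SubGaussianBound P θ0 γ0 A) (hA : 0 ≤ A)
    (i : Fin n) (j : Fin p) : MemLp (fun ω => M.Z i ω j) 2 P :=
  memLp_two_of_psi2 ((measurable_pi_apply j).comp (S.measurable_Z i)) hA (hB.Z i j)

/-- The eigenvalue bound for the joint matrix is tested on (0, v), which sees only the covariate
block. -/
lemma coercive (S : M.Standing P) (hB : M.SubGaussianBound P θ0 γ0 A) (hA : 0 ≤ A)
    (hc : ∀ i, ∀ κ ∈ spectrum ℝ (M.secondMoment P i), c ≤ κ) (i : Fin n) (v : Fin p → ℝ) :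
    c * ∑ j, v j ^ 2 ≤ ∫ ω, (M.Z i ω ⬝ᵥ v) ^ 2 ∂P := by
  have hH : (M.secondMoment P i).IsHermitian := by
    ext a b
    simp only [secondMoment, Matrix.conjTranspose_apply, Matrix.of_apply, star_trivial]
    exact integral_congr_ae (ae_of_all _ fun ω => mul_comm _ _)
  have h := hH.quadraticForm_ge (hc i) (Matrix.vecCons 0 v)
  rw [integral_dotProduct_sq (S.memLp_Z hB hA i)]
  convert h using 1
  · simp [dotProduct, Fin.sum_univ_succ, sq]
  · simp [dotProduct, Matrix.mulVec, Fin.sum_univ_succ, secondMoment, Finset.mul_sum]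

/-- Orthogonality needs no linearity of f: it combines the normal equations for X - Zᵀθ0 with the
independence of U and Z. The factor 3 + |β0| lets both residuals share one constant. -/
lemma regressionSample_residualW (S : M.Standing P) (hB : M.SubGaussianBound P θ0 γ0 A)
    (hA : 1 ≤ A) (hc0 : 0 < c) (hc : ∀ i, ∀ κ ∈ spectrum ℝ (M.secondMoment P i), c ≤ κ)
    (hθ : M.IsThetaZero P θ0) :
    RegressionSample P M.Z (M.residualW θ0) ((3 + |β0|) * A) c where
  measurable_Z := S.measurable_Z
  measurable_r := S.measurable_residualW θ0
  indep := (S.indep_residual β0 θ0 γ0).comp (fun _ x => (x.1, x.2.1)) fun _ => by fun_prop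
  ident i j := (S.ident_residual β0 θ0 γ0 i j).comp
    (u := fun x : (Fin p → ℝ) × ℝ × ℝ => (x.1, x.2.1)) (by fun_prop)
  one_le := by nlinarith [abs_nonneg β0]
  c_pos := hc0
  psi_Z i j := psi2Norm_mono (hB.Z i j) (by nlinarith [abs_nonneg β0])
  psi_r i := psi2Norm_mono (S.psi2Norm_residualW_le hB (by linarith) i)
    (by nlinarith [abs_nonneg β0])
  orth i j := by
    have hA0 : 0 ≤ A := by linarith
    have hU := memLp_two_of_psi2 (S.measurable_U i) hA0 (hB.U i)
    have hX : MemLp (fun ω => M.X i ω - M.Z i ω ⬝ᵥ θ0) 2 P :=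
      (memLp_two_of_psi2 (S.measurable_X i) hA0 (hB.X i)).sub
        (memLp_two_of_psi2 (S.measurable_Z_dotProduct i θ0) hA0 (hB.Zθ0 i))
    have hZ := S.memLp_Z hB hA0 i
    have h1 := integral_mul_residual_eq_zero hX hZ (hθ i) j
    have i1 : Integrable (fun ω => M.Z i ω j * (M.X i ω - M.Z i ω ⬝ᵥ θ0)) P :=
      (hZ j).integrable_mul hX
    have i2 : Integrable (fun ω => M.Z i ω j * M.U i ω) P := (hZ j).integrable_mul hU
    simp_rw [residualW_eq, mul_add]
    rw [integral_add i1 i2, h1, S.integral_Z_mul_U, add_zero]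
  coercive := S.coercive hB (by linarith) hc

lemma regressionSample_residualY (S : M.Standing P) (hB : M.SubGaussianBound P θ0 γ0 A)
    (hA : 1 ≤ A) (hg : ∀ i, psi2Norm P (fun ω => M.g (M.Z i ω)) ≤ ENNReal.ofReal A)
    (hc0 : 0 < c) (hc : ∀ i, ∀ κ ∈ spectrum ℝ (M.secondMoment P i), c ≤ κ)
    (hγ : M.IsGammaZero P β0 γ0) :
    RegressionSample P M.Z (M.residualY β0 γ0) ((3 + |β0|) * A) c where
  measurable_Z := S.measurable_Z
  measurable_r := S.measurable_residualY β0 γ0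
  indep := (S.indep_residual β0 θ0 γ0).comp (fun _ x => (x.1, x.2.2)) fun _ => by fun_prop
  ident i j := (S.ident_residual β0 θ0 γ0 i j).comp
    (u := fun x : (Fin p → ℝ) × ℝ × ℝ => (x.1, x.2.2)) (by fun_prop)
  one_le := by nlinarith [abs_nonneg β0]
  c_pos := hc0
  psi_Z i j := psi2Norm_mono (hB.Z i j) (by nlinarith [abs_nonneg β0])
  psi_r i := S.psi2Norm_residualY_le hB (by linarith) hg i
  orth i j := by
    have hA0 : 0 ≤ A := by linarith
    have hU := memLp_two_of_psi2 (S.measurable_U i) hA0 (hB.U i)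
    have hX : MemLp (fun ω => M.Y β0 i ω - M.X i ω * β0 - M.Z i ω ⬝ᵥ γ0) 2 P := by
      have h := ((memLp_two_of_psi2 (S.measurable_ε i) hA0 (hB.ε i)).add
        (memLp_two_of_psi2 (S.measurable_g.comp (S.measurable_Z i)) hA0 (hg i))).sub
        (memLp_two_of_psi2 (S.measurable_Z_dotProduct i γ0) hA0 (hB.Zγ0 i))
      convert h using 1
      ext ω
      simp only [Y, Pi.add_apply, Pi.sub_apply, Function.comp_apply]
      ring
    have hZ := S.memLp_Z hB hA0 i
    have h1 := integral_mul_residual_eq_zero hX hZ (hγ i) j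
    have e : ∀ ω, M.Z i ω j * M.residualY β0 γ0 i ω =
        M.Z i ω j * (M.Y β0 i ω - M.X i ω * β0 - M.Z i ω ⬝ᵥ γ0) -
          β0 * (M.Z i ω j * M.U i ω) := fun ω => by
      simp only [residualY, W]; ring
    have i1 : Integrable (fun ω => M.Z i ω j *
      (M.Y β0 i ω - M.X i ω * β0 - M.Z i ω ⬝ᵥ γ0)) P := (hZ j).integrable_mul hX
    have i2 : Integrable (fun ω => M.Z i ω j * M.U i ω) P := (hZ j).integrable_mul hU
    simp_rw [e]
    rw [integral_sub i1 (i2.const_mul _), h1, integral_const_mul, S.integral_Z_mul_U, mul_zero, sub_zero]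
  coercive := S.coercive hB (by linarith) hc

/-- In the expanded score every term with ε, or with U to the first power, vanishes by independence,
and -β0 E U² cancels σ_U²β0. Only the product in `h` is left. -/
lemma integral_score_eq_zero (S : M.Standing P) (hB : M.SubGaussianBound P θ0 γ0 A)
    (hA : 0 ≤ A) (hg : ∀ i, psi2Norm P (fun ω => M.g (M.Z i ω)) ≤ ENNReal.ofReal A) (i : Fin n)
    (h : ∫ ω, (M.X i ω - M.Z i ω ⬝ᵥ θ0) * (M.g (M.Z i ω) - M.Z i ω ⬝ᵥ γ0) ∂P = 0) :
    ∫ ω, M.score β0 θ0 γ0 i ω ∂P = 0 := by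
  have ma : Measurable fun ω => M.X i ω - M.Z i ω ⬝ᵥ θ0 :=
    (S.measurable_X i).sub (S.measurable_Z_dotProduct i θ0)
  have md : Measurable fun ω => M.g (M.Z i ω) - M.Z i ω ⬝ᵥ γ0 :=
    (S.measurable_g.comp (S.measurable_Z i)).sub (S.measurable_Z_dotProduct i γ0)
  have La : MemLp (fun ω => M.X i ω - M.Z i ω ⬝ᵥ θ0) 2 P :=
    (memLp_two_of_psi2 (S.measurable_X i) hA (hB.X i)).sub
      (memLp_two_of_psi2 (S.measurable_Z_dotProduct i θ0) hA (hB.Zθ0 i))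
  have Ld : MemLp (fun ω => M.g (M.Z i ω) - M.Z i ω ⬝ᵥ γ0) 2 P :=
    (memLp_two_of_psi2 (S.measurable_g.comp (S.measurable_Z i)) hA (hg i)).sub
      (memLp_two_of_psi2 (S.measurable_Z_dotProduct i γ0) hA (hB.Zγ0 i))
  have LU := memLp_two_of_psi2 (S.measurable_U i) hA (hB.U i)
  have Lε := memLp_two_of_psi2 (S.measurable_ε i) hA (hB.ε i)
  have mθ := measurable_dotProduct_const θ0
  have mγ := measurable_dotProduct_const γ0
  have mg := S.measurable_g
  have h1 : ∫ ω, M.ε i ω * (M.X i ω - M.Z i ω ⬝ᵥ θ0) ∂P = 0 :=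
    integral_mul_eq_zero_of_indepFun ((S.indep_ε i).comp (φ := id)
      (ψ := fun x : ℝ × (Fin p → ℝ) => x.1 - x.2 ⬝ᵥ θ0) measurable_id
      (measurable_fst.sub (mθ.comp measurable_snd))) (S.measurable_ε i) ma (S.mean_ε i)
  have h2 : ∫ ω, M.U i ω * (M.X i ω - M.Z i ω ⬝ᵥ θ0) ∂P = 0 :=
    integral_mul_eq_zero_of_indepFun ((S.indep_U i).comp (φ := id)
      (ψ := fun x : ℝ × (Fin p → ℝ) × ℝ => x.1 - x.2.1 ⬝ᵥ θ0) measurable_id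
      (measurable_fst.sub (mθ.comp (measurable_fst.comp measurable_snd))))
      (S.measurable_U i) ma (S.mean_U i)
  have h3 : ∫ ω, M.U i ω * M.ε i ω ∂P = 0 :=
    integral_mul_eq_zero_of_indepFun ((S.indep_U i).comp (φ := id)
      (ψ := fun x : ℝ × (Fin p → ℝ) × ℝ => x.2.2) measurable_id (by fun_prop))
      (S.measurable_U i) (S.measurable_ε i) (S.mean_U i)
  have h4 : ∫ ω, M.U i ω * (M.g (M.Z i ω) - M.Z i ω ⬝ᵥ γ0) ∂P = 0 :=
    integral_mul_eq_zero_of_indepFun ((S.indep_U i).comp (φ := id)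
      (ψ := fun x : ℝ × (Fin p → ℝ) × ℝ => M.g x.2.1 - x.2.1 ⬝ᵥ γ0) measurable_id
      ((mg.sub mγ).comp (measurable_fst.comp measurable_snd)))
      (S.measurable_U i) md (S.mean_U i)
  have h5 : ∫ ω, M.U i ω ^ 2 ∂P = M.sigmaU ^ 2 := by
    rw [← S.var_U i, variance_of_integral_eq_zero (S.measurable_U i).aemeasurable (S.mean_U i)]
  have e : ∀ ω, M.score β0 θ0 γ0 i ω = M.ε i ω * (M.X i ω - M.Z i ω ⬝ᵥ θ0) -
      β0 * (M.U i ω * (M.X i ω - M.Z i ω ⬝ᵥ θ0)) +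
      (M.X i ω - M.Z i ω ⬝ᵥ θ0) * (M.g (M.Z i ω) - M.Z i ω ⬝ᵥ γ0) + M.U i ω * M.ε i ω +
      M.U i ω * (M.g (M.Z i ω) - M.Z i ω ⬝ᵥ γ0) - β0 * M.U i ω ^ 2 + M.sigmaU ^ 2 * β0 := by
    intro ω
    rw [score, residualW_eq, residualY_eq]
    ring
  have i1 : Integrable (fun ω => M.ε i ω * (M.X i ω - M.Z i ω ⬝ᵥ θ0)) P := Lε.integrable_mul La
  have i2 : Integrable (fun ω => β0 * (M.U i ω * (M.X i ω - M.Z i ω ⬝ᵥ θ0))) P :=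
    (LU.integrable_mul La).const_mul _
  have i3 : Integrable (fun ω => (M.X i ω - M.Z i ω ⬝ᵥ θ0) *
    (M.g (M.Z i ω) - M.Z i ω ⬝ᵥ γ0)) P := La.integrable_mul Ld
  have i4 : Integrable (fun ω => M.U i ω * M.ε i ω) P := LU.integrable_mul Lε
  have i5 : Integrable (fun ω => M.U i ω * (M.g (M.Z i ω) - M.Z i ω ⬝ᵥ γ0)) P :=
    LU.integrable_mul Ld
  have i6 : Integrable (fun ω => β0 * M.U i ω ^ 2) P := LU.integrable_sq.const_mul _
  simp_rw [e]
  rw [integral_add, integral_sub, integral_add, integral_add, integral_add, integral_sub,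
    integral_const_mul, integral_const_mul, h1, h2, h3, h4, h5, h]
  · simp
    ring
  all_goals fun_prop

/-- The second factor is a function of Z and is pulled out of the conditional expectation. When f is
linear, X - Zᵀθ0 = η and this is the remaining term of the score mean. -/
lemma integral_η_mul_eq_zero (S : M.Standing P) (hB : M.SubGaussianBound P θ0 γ0 A)
    (hA : 0 ≤ A) (hg : ∀ i, psi2Norm P (fun ω => M.g (M.Z i ω)) ≤ ENNReal.ofReal A) (i : Fin n) :
    ∫ ω, M.η i ω * (M.g (M.Z i ω) - M.Z i ω ⬝ᵥ γ0) ∂P = 0 := by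
  have Lη := memLp_two_of_psi2 (S.measurable_η i) hA (hB.η i)
  have Ld : MemLp (fun ω => M.g (M.Z i ω) - M.Z i ω ⬝ᵥ γ0) 2 P :=
    (memLp_two_of_psi2 (S.measurable_g.comp (S.measurable_Z i)) hA (hg i)).sub
      (memLp_two_of_psi2 (S.measurable_Z_dotProduct i γ0) hA (hB.Zγ0 i))
  have hm : MeasurableSpace.comap (M.Z i) inferInstance ≤ ‹MeasurableSpace Ω› :=
    (S.measurable_Z i).comap_le
  have hsm : StronglyMeasurable[MeasurableSpace.comap (M.Z i) inferInstance]
      (fun ω => M.g (M.Z i ω) - M.Z i ω ⬝ᵥ γ0) :=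
    Measurable.stronglyMeasurable
      ((S.measurable_g.sub (measurable_dotProduct_const γ0)).comp (comap_measurable (M.Z i)))
  have h := condExp_mul_of_stronglyMeasurable_right hsm (Lη.integrable_mul Ld)
    (Lη.integrable one_le_two)
  have h1 := integral_condExp (μ := P) (f := M.η i * fun ω => M.g (M.Z i ω) - M.Z i ω ⬝ᵥ γ0) hm
  simp only [Pi.mul_apply] at h1
  rw [← h1, integral_congr_ae h]
  refine integral_eq_zero_of_ae ?_
  filter_upwards [S.condMean_η i] with ω hω
  simp [hω]

lemma sigmaU_sq_le (S : M.Standing P) (hB : M.SubGaussianBound P θ0 γ0 A) (hA : 0 ≤ A)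
    (i : Fin n) : M.sigmaU ^ 2 ≤ 2 * A ^ 2 := by
  rw [← S.var_U i, variance_of_integral_eq_zero (S.measurable_U i).aemeasurable (S.mean_U i)]
  simpa using integral_even_pow_le_of_psi2 (S.measurable_U i).aestronglyMeasurable hA (hB.U i) 1

lemma score_fourth_moment (S : M.Standing P) (hB : M.SubGaussianBound P θ0 γ0 A)
    (hA : 0 ≤ A) (hg : ∀ i, psi2Norm P (fun ω => M.g (M.Z i ω)) ≤ ENNReal.ofReal A) (i : Fin n) :
    Integrable (fun ω => M.score β0 θ0 γ0 i ω ^ 4) P ∧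
      ∫ ω, M.score β0 θ0 γ0 i ω ^ 4 ∂P ≤
        8 * ((6 * ((3 + |β0|) * A) ^ 2) ^ 4 * 24 + (2 * A ^ 2 * |β0|) ^ 4) := by
  have h := product_moment_of_psi2 (S.measurable_residualW θ0 i).aestronglyMeasurable
    (S.measurable_residualY β0 γ0 i).aestronglyMeasurable (by positivity)
    (psi2Norm_mono (S.psi2Norm_residualW_le hB hA i) (by nlinarith [abs_nonneg β0]))
    (S.psi2Norm_residualY_le hB hA hg i) 4
  have h24 : (((4 : ℕ).factorial : ℕ) : ℝ) = 24 := by norm_num [Nat.factorial]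
  rw [h24] at h
  have hs : |M.sigmaU ^ 2 * β0| ≤ 2 * A ^ 2 * |β0| := by
    rw [abs_mul, abs_of_nonneg (sq_nonneg M.sigmaU)]
    have := S.sigmaU_sq_le hB hA i
    gcongr
  have hs4 : (M.sigmaU ^ 2 * β0) ^ 4 ≤ (2 * A ^ 2 * |β0|) ^ 4 := by
    rw [← (by decide : Even 4).pow_abs (M.sigmaU ^ 2 * β0)]
    gcongr
  have hb : ∀ ω, M.score β0 θ0 γ0 i ω ^ 4 ≤
      8 * (|M.residualW θ0 i ω * M.residualY β0 γ0 i ω| ^ 4 + (2 * A ^ 2 * |β0|) ^ 4) := by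
    intro ω
    rw [(by decide : Even 4).pow_abs]
    refine le_trans ?_ (mul_le_mul_of_nonneg_left (add_le_add_right hs4 _) (by norm_num))
    rw [score]
    exact (by decide : Even 4).add_pow_le.trans (by norm_num)
  have hi : Integrable (fun ω => 8 * (|M.residualW θ0 i ω * M.residualY β0 γ0 i ω| ^ 4 +
      (2 * A ^ 2 * |β0|) ^ 4)) P := (h.1.add (integrable_const _)).const_mul _
  have hint : Integrable (fun ω => M.score β0 θ0 γ0 i ω ^ 4) P :=
    hi.mono' ((S.measurable_score β0 θ0 γ0 i).pow_const 4).aestronglyMeasurable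
      (ae_of_all _ fun ω => by
        rw [Real.norm_of_nonneg (by positivity)]
        exact hb ω)
  refine ⟨hint, (integral_mono hint hi hb).trans ?_⟩
  rw [integral_const_mul, integral_add h.1 (integrable_const _)]
  simp only [integral_const, probReal_univ, smul_eq_mul, one_mul]
  linarith [h.2]

end Standing

lemma ModelA.integral_score_sq {K σ0 : ℝ} (h : M.ModelA P β0 θ0 γ0 K σ0) (i : Fin n) :
    ∫ ω, M.score β0 θ0 γ0 i ω ^ 2 ∂P = M.sigma1Sq P β0 θ0 i := by
  refine integral_congr_ae (ae_of_all _ fun ω => ?_)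
  simp only [score]
  rw [residualW_eq, residualY_eq, h.linear, X]
  ring

lemma ModelB.integral_score_sq {K σ0 : ℝ} (h : M.ModelB P β0 θ0 γ0 K σ0) (i : Fin n) :
    ∫ ω, M.score β0 θ0 γ0 i ω ^ 2 ∂P = M.sigma2Sq P β0 γ0 i := by
  refine integral_congr_ae (ae_of_all _ fun ω => ?_)
  simp only [score]
  rw [residualW_eq, residualY_eq, X, h.linear]
  ring

end MEModel

/-! ### Asymptotic coverage of the confidence set. -/

theorem corollary1
    -- true coefficient, constants and penalties, none of which changes with the sample size
    (β0 K1 K2 Cmin σ0 Lγ μγ Lθ μθ : ℝ) (hCmin : 0 < Cmin) (hσ0 : 0 < σ0)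
    (ργ ρθ : ℝ → ℝ → ℝ) (hργ : IsAmenablePenalty ργ Lγ μγ) (hρθ : IsAmenablePenalty ρθ Lθ μθ) :
    ∃ D0 : ℝ, ∀ Dγ Dθ : ℝ, D0 ≤ Dγ → D0 ≤ Dθ →
    -- a triangular array: for every sample size `n`, a dimension, a probability space, a model
    ∀ (p : ℕ → ℕ) (Ω : ℕ → Type u) [∀ n, MeasurableSpace (Ω n)]
      (P : ∀ n, Measure (Ω n)) [∀ n, IsProbabilityMeasure (P n)]
      (M : ∀ n, MEModel n (p n) (Ω n)) (θ0 γ0 : ∀ n, Fin (p n) → ℝ)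
      (θhat : ∀ n, Ω n → Fin (p n) → ℝ) (γhat : ∀ n, ℝ → Ω n → Fin (p n) → ℝ),
    (∀ n, 2 ≤ p n) →
    (∀ n, (M n).Standing (P n)) →
    (∀ n, (M n).IsThetaZero (P n) (θ0 n)) →
    (∀ n, (M n).IsGammaZero (P n) β0 (γ0 n)) →
    -- one of the two models is correctly specified
    ((∀ n, (M n).ModelA (P n) β0 (θ0 n) (γ0 n) K2 σ0) ∨
      (∀ n, (M n).ModelB (P n) β0 (θ0 n) (γ0 n) K2 σ0)) →
    -- moment conditions
    (∀ n, (M n).SubGaussianBound (P n) (θ0 n) (γ0 n) K1) →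
    ((IsLassoPenalty ργ Lγ ∧ IsLassoPenalty ρθ Lθ) ∨
      (∀ n, (M n).SubGaussianVector (P n) K1)) →
    (∀ n, ∀ i, ∀ κ ∈ spectrum ℝ ((M n).secondMoment (P n) i), Cmin ≤ κ) →
    -- sparsity
    ((fun n => (l0Norm (γ0 n) : ℝ)) =o[atTop] fun n : ℕ => √(n : ℝ) / Real.log (p n)) →
    ((fun n => (l0Norm (θ0 n) : ℝ)) =o[atTop] fun n : ℕ => √(n : ℝ) / Real.log (p n)) →
    -- the penalised estimators (that of `γ0` is computed for every tested value `βt`)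
    (∀ n, 1 ≤ n → Measurable (θhat n) ∧ ∀ ω, IsMinOn
      (penalizedLoss ρθ (tuning Dθ n (p n)) (fun i => (M n).W i ω) (fun i => (M n).Z i ω))
      Set.univ (θhat n ω)) →
    (∀ n, 1 ≤ n → ∀ βt : ℝ, Measurable (γhat n βt) ∧ ∀ ω, IsMinOn
      (penalizedLoss ργ (tuning Dγ n (p n))
        (fun i => (M n).Y β0 i ω - (M n).W i ω * βt) (fun i => (M n).Z i ω))
      Set.univ (γhat n βt ω)) →
    ∀ α : ℝ, 0 < α → α < 1 →
    let T : ∀ n, Ω n → ℝ → ℝ := fun n ω βt =>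
      TDF (M n).sigmaU (fun i => (M n).W i ω) (fun i => (M n).Y β0 i ω)
        (fun i => (M n).Z i ω) (θhat n ω) (γhat n βt ω) βt
    (∀ n, (P n).real {ω | β0 ∈ confidenceSet (T n ω) α} =
        (P n).real {ω | |T n ω β0| ≤ stdNormalQuantile (1 - α / 2)}) ∧
      Tendsto (fun n => (P n).real {ω | β0 ∈ confidenceSet (T n ω) α}) atTop (𝓝 (1 - α)) := by
  -- One constant at least 1 that dominates K1 and K2, whose signs are not prescribed.
  set A := 1 + |K1| + |K2| with hA
  have hK1 : K1 ≤ A := by linarith [le_abs_self K1, abs_nonneg K2]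
  have hK2 : K2 ≤ A := by linarith [le_abs_self K2, abs_nonneg K1]
  have hA1 : 1 ≤ A := by linarith [abs_nonneg K1, abs_nonneg K2]
  have hA0 : 0 ≤ A := by linarith
  set K := (3 + |β0|) * A with hK
  have hAK : A ≤ K := by nlinarith [abs_nonneg β0]
  -- Dividing by L turns the thresholds for D L into thresholds for D; the 1 makes D positive.
  refine ⟨max 1 (max (tuningThreshold K Cmin μγ / Lγ) (tuningThreshold K Cmin μθ / Lθ)), ?_⟩
  intro Dγ Dθ hDγ hDθ p Ω _ P _ M θ0 γ0 θhat γhat hp hS hθ hγ hmodel hψ hcase hspec hsγ hsθ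
    hθhat hγhat α hα0 hα1
  rw [max_le_iff, max_le_iff, div_le_iff₀ hργ.L_pos, div_le_iff₀ hρθ.L_pos] at hDγ hDθ
  refine ⟨fun n => rfl, ?_⟩
  have hB : ∀ n, (M n).SubGaussianBound (P n) (θ0 n) (γ0 n) A := fun n => (hψ n).mono hK1
  have hg : ∀ n i, psi2Norm (P n) (fun ω => (M n).g ((M n).Z i ω)) ≤ ENNReal.ofReal A := by
    intro n i
    rcases hmodel with h | h
    · simp_rw [(h n).linear]
      exact (hB n).Zγ0 i
    · exact psi2Norm_mono (psi2Norm_le_of_bounded ((h n).bounded i)) hK2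
  have hmean : ∀ n i, ∫ ω, (M n).score β0 (θ0 n) (γ0 n) i ω ∂(P n) = 0 := by
    intro n i
    refine (hS n).integral_score_eq_zero (hB n) hA0 (hg n) i ?_
    rcases hmodel with h | h
    · simp [(h n).linear]
    · simpa [MEModel.X, (h n).linear] using (hS n).integral_η_mul_eq_zero (hB n) hA0 (hg n) i
  have hvar : ∀ n i, σ0 ^ 2 ≤ ∫ ω, (M n).score β0 (θ0 n) (γ0 n) i ω ^ 2 ∂(P n) := by
    intro n i
    rcases hmodel with h | h
    · rw [(h n).integral_score_sq]
      exact (h n).variance_lower i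
    · rw [(h n).integral_score_sq]
      exact (h n).variance_lower i
  have hSq : ∀ n, RegressionSample (P n) (M n).Z ((M n).residualW (θ0 n)) K Cmin := fun n =>
    (hS n).regressionSample_residualW (hB n) hA1 hCmin (hspec n) (hθ n)
  have hSr : ∀ n, RegressionSample (P n) (M n).Z ((M n).residualY β0 (γ0 n)) K Cmin := fun n =>
    (hS n).regressionSample_residualY (hB n) hA1 (hg n) hCmin (hspec n) (hγ n)
  have hvec : (∀ n, (M n).SubGaussianVector (P n) K1) → ∀ n i, ∀ v : Fin (p n) → ℝ, v ⬝ᵥ v = 1 →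
      psi2Norm (P n) (fun ω => (M n).Z i ω ⬝ᵥ v) ≤ ENNReal.ofReal K :=
    fun h n i v hv => psi2Norm_mono (h n i v hv) (hK1.trans hAK)
  have hu := fun δ (hδ : (0 : ℝ) < δ) => RegressionSample.eventually_errorBound hp hSq hρθ
    hDθ.2.2 (by linarith [hDθ.1]) (hcase.imp (fun h => h.2) hvec)
    (fun n i => psi2Norm_mono ((hB n).Zθ0 i) hAK) hsθ (γ := θhat) (fun n hn ω => by
      simpa [MEModel.residualW, tuning] using (hθhat n hn).2 ω) hδ
  have hv := fun δ (hδ : (0 : ℝ) < δ) => RegressionSample.eventually_errorBound hp hSr hργ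
    hDγ.2.1 (by linarith [hDγ.1]) (hcase.imp (fun h => h.1) hvec)
    (fun n i => psi2Norm_mono ((hB n).Zγ0 i) hAK) hsγ (γ := fun n => γhat n β0) (fun n hn ω => by
      simpa [MEModel.residualY, tuning] using (hγhat n hn β0).2 ω) hδ
  have hpert := fun κ (hκ : (0 : ℝ) < κ) => RegressionSample.tendsto_score_perturbation hp hSq hSr
    (S := fun n i ω => scoreTerm (M n).sigmaU (fun i => (M n).W i ω) (fun i => (M n).Y β0 i ω)
      (fun i => (M n).Z i ω) (θhat n ω) (γhat n β0 ω) β0 i)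
    (ξ := fun n => (M n).score β0 (θ0 n) (γ0 n)) hsθ hsγ hu hv (fun n i ω => by
      simp only [scoreTerm, MEModel.score, MEModel.residualW, MEModel.residualY, dotProduct_sub]
      ring) hκ
  have hclt := studentized_clt P (ξ := fun n => (M n).score β0 (θ0 n) (γ0 n))
    (fun n => (hS n).measurable_score β0 (θ0 n) (γ0 n))
    (fun n => (hS n).indep_score β0 (θ0 n) (γ0 n))
    (fun n => (hS n).ident_score β0 (θ0 n) (γ0 n))
    -- The common variance of row n, read off its first variable; row 0 is empty, and σ0² there
    -- preserves the lower bound.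
    (v := fun n => if h : 0 < n then
      ∫ ω, (M n).score β0 (θ0 n) (γ0 n) ⟨0, h⟩ ω ^ 2 ∂(P n) else σ0 ^ 2)
    hσ0 (fun n i => ((hS n).score_fourth_moment (hB n) hA0 (hg n) i).1) hmean
    (fun n i => by
      have hn : 0 < n := i.pos
      simp only [hn, dite_true]
      exact (((hS n).ident_score β0 (θ0 n) (γ0 n) i ⟨0, hn⟩).comp
        (measurable_id.pow_const 2)).integral_eq)
    (fun n => by
      split_ifs with h
      exacts [hvar n _, le_rfl])
    (fun n i => ((hS n).score_fourth_moment (hB n) hA0 (hg n) i).2)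
    (fun κ hκ => (hpert κ hκ).1) (fun κ hκ => (hpert κ hκ).2)
    (stdNormalQuantile_pos (q := 1 - α / 2) (by linarith) (by linarith))
  rw [cdf_stdNormalQuantile (by linarith) (by linarith)] at hclt
  have e : 2 * (1 - α / 2) - 1 = 1 - α := by ring
  rw [e] at hclt
  exact hclt
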